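/- **Setting.** Let $O=(W,A,Z,M,Y)$, where $A$ takes values in a finite set $\mathcal A$, $Y$ is real-valued, and $W,Z,M$ take values in arbitrary measurable spaces. Let $\nu_W,\nu_Z,\nu_M,\nu_Y$ be $\sigma$-finite measures on the respective ranges, and let $\nu$ be their product with counting measure on $\mathcal A$; $\mathrm d\nu(z)$, $\mathrm d\nu(m)$, etc. denote integration against the corresponding factors. The nonparametric model $\mathcal M$ is the set of all probability distributions of $O$ that have a density with respect to $\nu$. For $P\in\mathcal M$ with density $p$, write $p(w)$, $p(m\mid a,w)$, $p(m\mid a,z,w)$ for the marginal density of $W$ and the conditional densities of $M$; $g(a\mid w)=P(A=a\mid W=w)$; $q(z\mid a,w)$ for the conditional density of $Z$; and $b(a,z,m,w)=E(Y\mid A=a,Z=z,M=m,W=w)$. Fix $a',a^\star\in\mathcal A$ (possibly equal) and put $$\theta=\theta(P)=\int b(a',z,m,w)\,q(z\mid a',w)\,p(m\mid a^\star,w)\,p(w)\,\mathrm d\nu(w,z,m),$$ $$c(a,z,m,w)=\frac{p(m\mid a^\star,w)}{p(m\mid a,z,w)},\qquad u(z,a,w)=\int b(a,z,m,w)\,p(m\mid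 a^\star,w)\,\mathrm d\nu(m),$$ $$v(a,w)=\int b(a',z,m,w)\,q(z\mid a',w)\,p(m\mid a,w)\,\mathrm d\nu(m,z).$$ **Efficient influence function.** A regular submodel through $P$ with score $s\in L^2(P)$ is a family $(P_t)$ in $\mathcal M$, defined for real $t$ near $0$, with densities $p_t$, $p_0=p$, such that $$\int\Big(\frac{\sqrt{p_t}-\sqrt p}{t}-\tfrac12 s\sqrt p\Big)^2\mathrm d\nu\to0\quad(t\to0)$$ and such that for some $C>0$ and all $t$ near $0$, $p\le C\,p_t$ and $p_t\le C\,p$ $\nu$-almost everywhere. The tangent space at $P$ is the closed linear span in $L^2(P)$ of the scores of all regular submodels. A function $\varphi\in L^2(P)$ is an efficient influence function of $\theta$ at $P$ if it belongs to the tangent space and $t\mapsto\theta(P_t)$ is differentiable at $0$ with derivative $\int\varphi\, s\,\mathrm dP$ for every regular submodel with score $s$. **Theorem 1 (Efficient influence function).** Let $P\in\mathcal M$ satisfy $E|Y|<\infty$ and - (positivity) $g(a'\mid w)>0$ and $g(a^\star\mid w)>0$ for $\nu$-almost every $w$ with $p(w)>0$, and $p(m\mid a',z,w)>0$ for $\nu$-almost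 every $(w,z,m)$ with $q(z\mid a',w)\,p(m\mid a^\star,w)\,p(w)>0$; - (square integrability) the first term of $D_P$ below is in $L^2(P)$, and $$\int b(a',z,m,w)^2\Big\{\frac1{g(a'\mid w)}+\frac1{g(a^\star\mid w)}\Big\}q(z\mid a',w)\,p(m\mid a^\star,w)\,p(w)\,\mathrm d\nu(w,z,m)<\infty .$$ (The square integrability condition holds, for instance, if $E(Y^2)<\infty$, $g(a'\mid W)$ and $g(a^\star\mid W)$ are bounded away from $0$, and $c(a',Z,M,W)$ is bounded.) Then the efficient influence function of $\theta$ at $P$ in the nonparametric model exists, is unique up to $P$-null sets, and is equal to $D_P(o)-\theta$, where, for $o=(w,a,z,m,y)$, $$\begin{aligned}D_P(o)&=\frac{\mathbb 1\{a=a'\}}{g(a'\mid w)}\,c(a',z,m,w)\,\{y-b(a',z,m,w)\}\\&\quad+\frac{\mathbb 1\{a=a'\}}{g(a'\mid w)}\Big\{u(z,a',w)-\int u(z,a',w)\,q(z\mid a',w)\,\mathrm d\nu(z)\Big\}\\&\quad+\frac{\mathbb 1\{a=a^\star\}}{g(a^\star\mid w)}\Big\{\int b(a',z,m,w)\,q(z\mid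 a',w)\,\mathrm d\nu(z)-v(a^\star,w)\Big\}\\&\quad+v(a^\star,w).\end{aligned}$$ -/

import Mathlib

open MeasureTheory Filter Topology

namespace MedEIF

noncomputable section

/-! ### Efficient influence functions in a dominated model -/

section General

variable {Ω : Type*} [MeasurableSpace Ω]

/-- The nonparametric model dominated by `ν`: all probability densities with respect to `ν`. -/
def nonparametricModel (ν : Measure Ω) : Set (Ω → ℝ) :=
  {p | Measurable p ∧ (∀ o, 0 ≤ p o) ∧ Integrable p ν ∧ ∫ o, p o ∂ν = 1}

/-- The distribution with density `p` with respect to `ν`. -/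
def law (ν : Measure Ω) (p : Ω → ℝ) : Measure Ω :=
  ν.withDensity fun o => ENNReal.ofReal (p o)

/-- `path` is a regular one-dimensional submodel of the model `𝓜` through the density `p`, with
score `s` at `t = 0`: it is differentiable in quadratic mean at `0`, and near `t = 0` its
likelihood ratios with respect to `p` are bounded and bounded away from `0`. -/
structure IsRegularPath (ν : Measure Ω) (𝓜 : Set (Ω → ℝ)) (p : Ω → ℝ)
    (path : ℝ → Ω → ℝ) (s : Ω → ℝ) : Prop where
  mem_model : ∀ᶠ t in 𝓝 (0 : ℝ), path t ∈ 𝓜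
  at_zero : path 0 = p
  score_memLp : MemLp s 2 (law ν p)
  quadratic_mean :
    Tendsto (fun t : ℝ => ∫⁻ o, ENNReal.ofReal
      (((Real.sqrt (path t o) - Real.sqrt (p o)) / t - s o * Real.sqrt (p o) / 2) ^ 2) ∂ν)
      (𝓝[≠] 0) (𝓝 0)
  likelihood_ratio : ∃ C : ℝ, 0 < C ∧ ∀ᶠ t in 𝓝 (0 : ℝ), ∀ᵐ o ∂ν,
    p o ≤ C * path t o ∧ path t o ≤ C * p o

/-- The tangent space of `𝓜` at `p`: the closed linear span, in `L²` of the distribution with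
density `p`, of the scores of all regular submodels. -/
def tangentSpace (ν : Measure Ω) (𝓜 : Set (Ω → ℝ)) (p : Ω → ℝ) :
    Submodule ℝ (Lp ℝ 2 (law ν p)) :=
  (Submodule.span ℝ {f : Lp ℝ 2 (law ν p) |
    ∃ path : ℝ → Ω → ℝ, IsRegularPath ν 𝓜 p path f}).topologicalClosure

/-- `φ` is an efficient influence function of the parameter `Ψ` at `p` in the model `𝓜`: it is
square integrable, it represents the pathwise derivative of `Ψ` along every regular submodel, and
it lies in the tangent space. -/
def IsEfficientInfluenceFunction (ν : Measure Ω) (𝓜 : Set (Ω → ℝ)) (Ψ : (Ω → ℝ) → ℝ)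
    (p : Ω → ℝ) (φ : Ω → ℝ) : Prop :=
  ∃ hφ : MemLp φ 2 (law ν p),
    hφ.toLp φ ∈ tangentSpace ν 𝓜 p ∧
    ∀ (path : ℝ → Ω → ℝ) (s : Ω → ℝ), IsRegularPath ν 𝓜 p path s →
      HasDerivAt (fun t => Ψ (path t)) (∫ o, φ o * s o ∂(law ν p)) 0

end General

/-! ### The observed data `O = (W, A, Z, M, Y)` and the interventional parameter -/

section Mediation

variable {W A Z M : Type*} [MeasurableSpace W] [MeasurableSpace A] [MeasurableSpace Z]
  [MeasurableSpace M]

/-- The dominating measure on `(w, a, z, m, y)`: a product, with counting measure for the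
categorical treatment. -/
def refMeasure (νW : Measure W) (νZ : Measure Z) (νM : Measure M) (νY : Measure ℝ) :
    Measure (W × A × Z × M × ℝ) :=
  νW.prod ((Measure.count : Measure A).prod (νZ.prod (νM.prod νY)))

/-- Joint density of `(W, A, Z, M)`. -/
def densWAZM (νY : Measure ℝ) (p : W × A × Z × M × ℝ → ℝ) (w : W) (a : A) (z : Z) (m : M) : ℝ :=
  ∫ y, p (w, a, z, m, y) ∂νY

/-- Joint density of `(W, A, Z)`. -/
def densWAZ (νM : Measure M) (νY : Measure ℝ) (p : W × A × Z × M × ℝ → ℝ)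
    (w : W) (a : A) (z : Z) : ℝ :=
  ∫ m, densWAZM νY p w a z m ∂νM

/-- Joint density of `(W, A, M)`. -/
def densWAM (νZ : Measure Z) (νY : Measure ℝ) (p : W × A × Z × M × ℝ → ℝ)
    (w : W) (a : A) (m : M) : ℝ :=
  ∫ z, densWAZM νY p w a z m ∂νZ

/-- Joint density of `(W, A)`. -/
def densWA (νZ : Measure Z) (νM : Measure M) (νY : Measure ℝ) (p : W × A × Z × M × ℝ → ℝ)
    (w : W) (a : A) : ℝ :=
  ∫ z, densWAZ νM νY p w a z ∂νZ

/-- `p(w)`, the density of `W`. -/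
def densW [Fintype A] (νZ : Measure Z) (νM : Measure M) (νY : Measure ℝ)
    (p : W × A × Z × M × ℝ → ℝ) (w : W) : ℝ :=
  ∑ a, densWA νZ νM νY p w a

/-- `g(a ∣ w)`, the conditional probability of `A = a` given `W = w`. -/
def g [Fintype A] (νZ : Measure Z) (νM : Measure M) (νY : Measure ℝ)
    (p : W × A × Z × M × ℝ → ℝ) (a : A) (w : W) : ℝ :=
  densWA νZ νM νY p w a / densW νZ νM νY p w

/-- `q(z ∣ a, w)`, the conditional density of `Z` given `(A, W) = (a, w)`. -/
def q (νZ : Measure Z) (νM : Measure M) (νY : Measure ℝ) (p : W × A × Z × M × ℝ → ℝ)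
    (z : Z) (a : A) (w : W) : ℝ :=
  densWAZ νM νY p w a z / densWA νZ νM νY p w a

/-- `p(m ∣ a, w)`, the conditional density of `M` given `(A, W) = (a, w)`. -/
def pM (νZ : Measure Z) (νM : Measure M) (νY : Measure ℝ) (p : W × A × Z × M × ℝ → ℝ)
    (m : M) (a : A) (w : W) : ℝ :=
  densWAM νZ νY p w a m / densWA νZ νM νY p w a

/-- `p(m ∣ a, z, w)`, the conditional density of `M` given `(A, Z, W) = (a, z, w)`. -/
def pMZ (νM : Measure M) (νY : Measure ℝ) (p : W × A × Z × M × ℝ → ℝ)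
    (m : M) (a : A) (z : Z) (w : W) : ℝ :=
  densWAZM νY p w a z m / densWAZ νM νY p w a z

/-- `b(a, z, m, w)`, the conditional expectation of `Y` given `(A, Z, M, W) = (a, z, m, w)`. -/
def b (νY : Measure ℝ) (p : W × A × Z × M × ℝ → ℝ) (a : A) (z : Z) (m : M) (w : W) : ℝ :=
  (∫ y, y * p (w, a, z, m, y) ∂νY) / densWAZM νY p w a z m

/-- The density in `(w, z, m)` against which `b(a', z, m, w)` is averaged:
`q(z ∣ a', w) p(m ∣ a⋆, w) p(w)`. -/
def targetDensity [Fintype A] (νZ : Measure Z) (νM : Measure M) (νY : Measure ℝ) (a' astar : A)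
    (p : W × A × Z × M × ℝ → ℝ) (x : W × Z × M) : ℝ :=
  q νZ νM νY p x.2.1 a' x.1 * pM νZ νM νY p x.2.2 astar x.1 * densW νZ νM νY p x.1

/-- The interventional parameter
`θ = ∫ b(a', z, m, w) q(z ∣ a', w) p(m ∣ a⋆, w) p(w) dν(w, z, m)`. -/
def theta [Fintype A] (νW : Measure W) (νZ : Measure Z) (νM : Measure M) (νY : Measure ℝ)
    (a' astar : A) (p : W × A × Z × M × ℝ → ℝ) : ℝ :=
  ∫ x, b νY p a' x.2.1 x.2.2 x.1 * targetDensity νZ νM νY a' astar p x ∂(νW.prod (νZ.prod νM))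

/-- `c(a, z, m, w) = p(m ∣ a⋆, w) / p(m ∣ a, z, w)`. -/
def c (νZ : Measure Z) (νM : Measure M) (νY : Measure ℝ) (astar : A)
    (p : W × A × Z × M × ℝ → ℝ) (a : A) (z : Z) (m : M) (w : W) : ℝ :=
  pM νZ νM νY p m astar w / pMZ νM νY p m a z w

/-- `u(z, a, w) = ∫ b(a, z, m, w) p(m ∣ a⋆, w) dν(m)`. -/
def u (νZ : Measure Z) (νM : Measure M) (νY : Measure ℝ) (astar : A)
    (p : W × A × Z × M × ℝ → ℝ) (z : Z) (a : A) (w : W) : ℝ :=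
  ∫ m, b νY p a z m w * pM νZ νM νY p m astar w ∂νM

/-- `v(a, w) = ∫ b(a', z, m, w) q(z ∣ a', w) p(m ∣ a, w) dν(m, z)`. -/
def v (νZ : Measure Z) (νM : Measure M) (νY : Measure ℝ) (a' : A)
    (p : W × A × Z × M × ℝ → ℝ) (a : A) (w : W) : ℝ :=
  ∫ x : M × Z, b νY p a' x.2 x.1 w * q νZ νM νY p x.2 a' w * pM νZ νM νY p x.1 a w
    ∂(νM.prod νZ)

/-- The weighted outcome residual
`1{a = a'} / g(a' ∣ w) * c(a', z, m, w) * (y - b(a', z, m, w))`. -/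
def DY [Fintype A] [DecidableEq A] (νZ : Measure Z) (νM : Measure M) (νY : Measure ℝ)
    (a' astar : A) (p : W × A × Z × M × ℝ → ℝ) : W × A × Z × M × ℝ → ℝ :=
  fun (w, a, z, m, y) =>
    (if a = a' then 1 else 0) / g νZ νM νY p a' w * c νZ νM νY astar p a' z m w *
      (y - b νY p a' z m w)

/-- The centred `u`-term. -/
def DZ [Fintype A] [DecidableEq A] (νZ : Measure Z) (νM : Measure M) (νY : Measure ℝ)
    (a' astar : A) (p : W × A × Z × M × ℝ → ℝ) : W × A × Z × M × ℝ → ℝ :=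
  fun (w, a, z, _, _) =>
    (if a = a' then 1 else 0) / g νZ νM νY p a' w *
      (u νZ νM νY astar p z a' w -
        ∫ z', u νZ νM νY astar p z' a' w * q νZ νM νY p z' a' w ∂νZ)

/-- The centred `v`-term. -/
def DM [Fintype A] [DecidableEq A] (νZ : Measure Z) (νM : Measure M) (νY : Measure ℝ)
    (a' astar : A) (p : W × A × Z × M × ℝ → ℝ) : W × A × Z × M × ℝ → ℝ :=
  fun (w, a, _, m, _) =>
    (if a = astar then 1 else 0) / g νZ νM νY p astar w *
      ((∫ z', b νY p a' z' m w * q νZ νM νY p z' a' w ∂νZ) - v νZ νM νY a' p astar w)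

/-- The uncentred efficient influence function `D_P`. -/
def D [Fintype A] [DecidableEq A] (νZ : Measure Z) (νM : Measure M) (νY : Measure ℝ)
    (a' astar : A) (p : W × A × Z × M × ℝ → ℝ) : W × A × Z × M × ℝ → ℝ :=
  fun o => DY νZ νM νY a' astar p o + DZ νZ νM νY a' astar p o + DM νZ νM νY a' astar p o +
    v νZ νM νY a' p astar o.1

end Mediation

end

end MedEIF

/-!
The parameter is differentiated through an exact expansion rather than through remainder estimates.
For a density `pt` comparable with `p`, let `gradient p pt` be the function `D` in which the outcome
regression `b`, the density `q` and all centrings are those of `p`, while the weights (and the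
mediator density inside `u`) are those of `pt`. Then `gradient p p = D`, and by telescoping
`b q p(m) p(w)` one factor at a time, `gradient p pt` integrates to `θ(pt)` against `pt` and to `θ(p)`
against `p` (`integral_gradient`). Hence `θ(pt) - θ(p) = ∫ gradient p pt (pt - p) dν` without
remainder.

Along a regular path, `(√p_t - √p) / t` converges in `L²(ν)`, and along a subsequence `p_t → p` almost
everywhere. Bounded likelihood ratios make all marginal and conditional densities of `p_t` comparable
with those of `p` (`Approx`), so the gradients converge almost surely to `D` and are dominated by a
fixed function. That function is square integrable: the residual term by assumption, the other terms
by Jensen's inequality and the weighted second-moment condition (`integral_sq_condMean_le`,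
`integral_sq_scaled_le`). The difference quotient of `θ` is then an `L²`-convergent sequence
integrated against a dominated convergent one (`tendsto_integral_mul_of_eLpNorm`), which gives the
derivative `∫ D s dP` (`HasExactExpansion.hasDerivAt`).

Scores have mean zero because total mass is constant along a path, and the linear paths
`p (1 + t g)` show that every centred indicator is a score; so the tangent space is the space of
mean-zero functions (`mem_tangentSpace_iff`). A mean-zero square-integrable gradient is therefore the
efficient influence function, and the only one (`isEfficientInfluenceFunction_iff`).
-/

set_option linter.unusedSectionVars false

namespace MedEIF

section General

variable {Ω : Type*} [MeasurableSpace Ω] {ν : Measure Ω} {p : Ω → ℝ}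

/-! ### Integration against a law with a density -/

lemma ae_law_iff (hp : Measurable p) {Q : Ω → Prop} :
    (∀ᵐ o ∂law ν p, Q o) ↔ ∀ᵐ o ∂ν, 0 < p o → Q o := by
  rw [law, ae_withDensity_iff (by fun_prop)]
  simp

lemma integrable_law_iff (hp : Measurable p) (h0 : ∀ o, 0 ≤ p o) {f : Ω → ℝ} :
    Integrable f (law ν p) ↔ Integrable (fun o => f o * p o) ν := by
  rw [law, integrable_withDensity_iff (by fun_prop) (by simp)]
  simp only [ENNReal.toReal_ofReal (h0 _)]

lemma integral_law (hp : Measurable p) (h0 : ∀ o, 0 ≤ p o) (f : Ω → ℝ) :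
    ∫ o, f o ∂law ν p = ∫ o, f o * p o ∂ν := by
  rw [law, integral_withDensity_eq_integral_toReal_smul (by fun_prop) (by simp)]
  simp only [ENNReal.toReal_ofReal (h0 _), smul_eq_mul, mul_comm]

lemma isProbabilityMeasure_law (hp : p ∈ nonparametricModel ν) :
    IsProbabilityMeasure (law ν p) := by
  obtain ⟨_, h0, hi, h1⟩ := hp
  refine ⟨?_⟩
  rw [law, withDensity_apply _ MeasurableSet.univ, Measure.restrict_univ,
    ← ofReal_integral_eq_lintegral_ofReal hi (ae_of_all _ h0), h1, ENNReal.ofReal_one]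

/-! ### Differentiating a parameter with an exact first-order expansion -/

lemma eLpNorm_two_eq (f : Ω → ℝ) :
    eLpNorm f 2 ν = (∫⁻ o, ENNReal.ofReal (f o ^ 2) ∂ν) ^ (1 / 2 : ℝ) := by
  rw [eLpNorm_eq_lintegral_rpow_enorm_toReal (by norm_num) (by norm_num)]
  simp only [ENNReal.toReal_ofNat]
  congr 1
  refine lintegral_congr fun o => ?_
  rw [← sq_abs, ENNReal.ofReal_pow (abs_nonneg _), ← Real.enorm_eq_ofReal_abs]
  norm_cast

/-- Products of an `L²`-convergent sequence with a sequence that converges almost everywhere and is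
dominated in `L²` have convergent integrals. -/
lemma tendsto_integral_mul_of_eLpNorm {δ E : ℕ → Ω → ℝ} {δ₀ E₀ B : Ω → ℝ}
    (hδ : ∀ n, AEStronglyMeasurable (δ n) ν) (hδ₀ : MemLp δ₀ 2 ν)
    (hlim : Tendsto (fun n => eLpNorm (δ n - δ₀) 2 ν) atTop (𝓝 0))
    (hE : ∀ n, AEStronglyMeasurable (E n) ν) (hB : MemLp B 2 ν)
    (hEB : ∀ n, ∀ᵐ o ∂ν, |E n o| ≤ B o)
    (hElim : ∀ᵐ o ∂ν, Tendsto (fun n => E n o) atTop (𝓝 (E₀ o))) :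
    Tendsto (fun n => ∫ o, δ n o * E n o ∂ν) atTop (𝓝 (∫ o, δ₀ o * E₀ o ∂ν)) := by
  have hEL : ∀ n, MemLp (E n) 2 ν := fun n => hB.mono (hE n) <| by
    filter_upwards [hEB n] with o ho
    exact ho.trans (le_abs_self _)
  have h1 : Tendsto (fun n => ∫ o, δ₀ o * E n o ∂ν) atTop (𝓝 (∫ o, δ₀ o * E₀ o ∂ν)) := by
    refine tendsto_integral_of_dominated_convergence (fun o => |δ₀ o| * B o)
      (fun n => hδ₀.1.mul (hE n)) (hδ₀.abs.integrable_mul hB) (fun n => ?_) ?_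
    · filter_upwards [hEB n] with o ho
      rw [norm_mul]
      exact mul_le_mul_of_nonneg_left ho (abs_nonneg _)
    · filter_upwards [hElim] with o ho using ho.const_mul _
  have hbd : ∀ n, eLpNorm (fun o => (δ n - δ₀) o * E n o) 1 ν
      ≤ eLpNorm (δ n - δ₀) 2 ν * eLpNorm B 2 ν := fun n => by
    refine (eLpNorm_smul_le_mul_eLpNorm (p := 2) (q := 2) (r := 1) (hE n)
      ((hδ n).sub hδ₀.1)).trans ?_
    gcongr
    refine eLpNorm_mono_ae ?_
    filter_upwards [hEB n] with o ho
    exact ho.trans (le_abs_self _)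
  have h2 : Tendsto (fun n => ∫ o, (δ n - δ₀) o * E n o ∂ν) atTop (𝓝 0) := by
    have h3 : Tendsto (fun n => eLpNorm (δ n - δ₀) 2 ν * eLpNorm B 2 ν) atTop (𝓝 0) := by
      simpa using ENNReal.Tendsto.mul_const hlim (Or.inr hB.eLpNorm_ne_top)
    rw [tendsto_zero_iff_enorm_tendsto_zero]
    refine tendsto_of_tendsto_of_tendsto_of_le_of_le tendsto_const_nhds h3 (fun _ => zero_le)
      fun n => ?_
    refine (enorm_integral_le_lintegral_enorm _).trans ?_
    rw [← eLpNorm_one_eq_lintegral_enorm]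
    exact hbd n
  have hev : ∀ᶠ n in atTop, MemLp (δ n - δ₀) 2 ν := by
    filter_upwards [hlim.eventually (gt_mem_nhds one_pos)] with n hn
    exact ⟨(hδ n).sub hδ₀.1, hn.trans ENNReal.one_lt_top⟩
  have h4 := h2.add h1
  rw [zero_add] at h4
  refine h4.congr' ?_
  filter_upwards [hev] with n hn
  have hi₁ : Integrable (fun o => (δ n - δ₀) o * E n o) ν := hn.integrable_mul (hEL n)
  have hi₂ : Integrable (fun o => δ₀ o * E n o) ν := hδ₀.integrable_mul (hEL n)
  rw [← integral_add hi₁ hi₂]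
  refine integral_congr_ae (ae_of_all _ fun o => ?_)
  simp only [Pi.sub_apply]
  ring

/-- Two densities comparable up to the factor `C`, almost everywhere. -/
def Comparable (ν : Measure Ω) (C : ℝ) (f p : Ω → ℝ) : Prop :=
  ∀ᵐ o ∂ν, p o ≤ C * f o ∧ f o ≤ C * p o

/-- The parameter `Ψ` has an exact first-order expansion at `p` with gradient `D`: along every
sequence of densities that are uniformly comparable with `p` and converge to `p` almost everywhere,
the increment of `Ψ` is the integral of the increment of the density against functions that
converge to `D` and are dominated in `L²` of the law. -/
def HasExactExpansion (ν : Measure Ω) (Ψ : (Ω → ℝ) → ℝ) (p D : Ω → ℝ) : Prop :=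
  ∀ (P : ℕ → Ω → ℝ) (C : ℝ), 0 < C → (∀ n, P n ∈ nonparametricModel ν) →
    (∀ n, Comparable ν C (P n) p) →
    (∀ᵐ o ∂ν, Tendsto (fun n => P n o) atTop (𝓝 (p o))) →
    ∃ (E : ℕ → Ω → ℝ) (B : Ω → ℝ), (∀ n, Measurable (E n)) ∧ Measurable B ∧
      MemLp B 2 (law ν p) ∧ (∀ n, ∀ᵐ o ∂law ν p, |E n o| ≤ B o) ∧
      (∀ᵐ o ∂law ν p, Tendsto (fun n => E n o) atTop (𝓝 (D o))) ∧
      ∀ n, Ψ (P n) - Ψ p = ∫ o, E n o * (P n o - p o) ∂ν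

lemma memLp_mul_sqrt (hp : Measurable p) (h0 : ∀ o, 0 ≤ p o) {f : Ω → ℝ} (hf : Measurable f)
    (h : MemLp f 2 (law ν p)) (k : ℝ) : MemLp (fun o => k * (f o * Real.sqrt (p o))) 2 ν := by
  have hm : Measurable fun o => f o * Real.sqrt (p o) := hf.mul hp.sqrt
  refine MemLp.const_mul ?_ k
  rw [memLp_two_iff_integrable_sq hm.aestronglyMeasurable]
  have := (integrable_law_iff hp h0).1 h.integrable_sq
  refine this.congr (ae_of_all _ fun o => ?_)
  simp only [mul_pow, Real.sq_sqrt (h0 o)]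

/-- A differentiable-in-quadratic-mean path converges almost everywhere along a subsequence, and a
parameter with an exact expansion has the corresponding difference quotients converge. -/
lemma IsRegularPath.exists_subseq_tendsto_slope (hp : p ∈ nonparametricModel ν)
    {path : ℝ → Ω → ℝ} {s : Ω → ℝ} (h : IsRegularPath ν (nonparametricModel ν) p path s)
    {Ψ : (Ω → ℝ) → ℝ} {D : Ω → ℝ} (hΨ : HasExactExpansion ν Ψ p D)
    {t : ℕ → ℝ} (ht : Tendsto t atTop (𝓝[≠] 0)) :
    ∃ ns : ℕ → ℕ, Tendsto (fun n => (Ψ (path (t (ns n))) - Ψ p) / t (ns n)) atTop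
      (𝓝 (∫ o, D o * s o ∂law ν p)) := by
  obtain ⟨hpm, hp0, hpi, hp1⟩ := hp
  obtain ⟨C, hC, hratio⟩ := h.likelihood_ratio
  have ht0 : Tendsto t atTop (𝓝 0) := tendsto_nhds_of_tendsto_nhdsWithin ht
  have hev : ∀ᶠ n in atTop, (path (t n) ∈ nonparametricModel ν ∧ t n ≠ 0) ∧
      Comparable ν C (path (t n)) p :=
    ((ht0.eventually h.mem_model).and (ht.eventually self_mem_nhdsWithin)).and
      (ht0.eventually hratio)
  obtain ⟨N, hN⟩ := eventually_atTop.1 hev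
  -- the score is replaced by a measurable version
  obtain ⟨s', hs'm, hs'⟩ := h.score_memLp.1
  have hs'L : MemLp s' 2 (law ν p) := h.score_memLp.ae_eq hs'
  have hs'e : ∀ᵐ o ∂ν, 0 < p o → s o = s' o := (ae_law_iff hpm).1 hs'
  set δ : ℕ → Ω → ℝ := fun n o =>
    (Real.sqrt (path (t (n + N)) o) - Real.sqrt (p o)) / t (n + N) with hδdef
  set δ₀ : Ω → ℝ := fun o => 1 / 2 * (s' o * Real.sqrt (p o)) with hδ₀def
  have hδm : ∀ n, Measurable (δ n) := fun n =>
    ((hN (n + N) (by omega)).1.1.1.sqrt.sub hpm.sqrt).div_const _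
  have hδ₀ : MemLp δ₀ 2 ν := memLp_mul_sqrt hpm hp0 hs'm.measurable hs'L _
  have hlim : Tendsto (fun n => eLpNorm (δ n - δ₀) 2 ν) atTop (𝓝 0) := by
    have h1 := h.quadratic_mean.comp (ht.comp (tendsto_add_atTop_nat N))
    have h2 := h1.ennrpow_const (1 / 2)
    rw [ENNReal.zero_rpow_of_pos (by norm_num)] at h2
    refine h2.congr fun n => ?_
    rw [eLpNorm_two_eq]
    simp only [Function.comp]
    congr 1
    refine lintegral_congr_ae ?_
    filter_upwards [hs'e] with o ho
    rcases (hp0 o).eq_or_lt with h0 | h0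
    · simp [hδdef, hδ₀def, ← h0]
    · simp only [hδdef, hδ₀def, Pi.sub_apply, ho h0]
      ring_nf
  obtain ⟨ns, hns, hae⟩ := (tendstoInMeasure_of_tendsto_eLpNorm (by norm_num)
    (fun n => (hδm n).aestronglyMeasurable) hδ₀.1 hlim).exists_seq_tendsto_ae
  set τ : ℕ → ℝ := fun n => t (ns n + N) with hτ
  have hτ0 : Tendsto τ atTop (𝓝 0) :=
    ht0.comp ((tendsto_add_atTop_nat N).comp hns.tendsto_atTop)
  have hτne : ∀ n, τ n ≠ 0 := fun n => (hN (ns n + N) (by omega)).1.2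
  have hmem : ∀ n, path (τ n) ∈ nonparametricModel ν := fun n => (hN (ns n + N) (by omega)).1.1
  have hcomp : ∀ n, Comparable ν C (path (τ n)) p := fun n => (hN (ns n + N) (by omega)).2
  have hsqrt : ∀ᵐ o ∂ν, Tendsto (fun n => Real.sqrt (path (τ n) o)) atTop
      (𝓝 (Real.sqrt (p o))) := by
    filter_upwards [hae] with o ho
    have h1 := (hτ0.mul ho).add_const (Real.sqrt (p o))
    rw [zero_mul, zero_add] at h1
    refine h1.congr fun n => ?_
    have := hτne n
    simp only [hδdef]
    change τ n * ((Real.sqrt (path (τ n) o) - Real.sqrt (p o)) / τ n) + _ = _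
    field_simp
    ring
  have hpath : ∀ᵐ o ∂ν, Tendsto (fun n => path (τ n) o) atTop (𝓝 (p o)) := by
    filter_upwards [hsqrt] with o ho
    have h1 := ho.pow 2
    simpa only [Real.sq_sqrt (hp0 o), Real.sq_sqrt ((hmem _).2.1 o)] using h1
  obtain ⟨E, B, hEm, hBm, hBL, hEB, hElim, hexp⟩ :=
    hΨ (fun n => path (τ n)) C hC hmem hcomp hpath
  -- factor `p_t - p = (√p_t - √p) (√p_t + √p)`: the first factor over `t` converges in `L²(ν)`
  have hkey := tendsto_integral_mul_of_eLpNorm (ν := ν) (δ := fun n => δ (ns n)) (δ₀ := δ₀)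
    (E := fun n o => E n o * (Real.sqrt (path (τ n) o) + Real.sqrt (p o)))
    (E₀ := fun o => D o * (Real.sqrt (p o) + Real.sqrt (p o)))
    (B := fun o => (Real.sqrt C + 1) * (B o * Real.sqrt (p o)))
    (fun n => (hδm _).aestronglyMeasurable) hδ₀ (hlim.comp hns.tendsto_atTop)
    (fun n => ((hEm n).mul ((hmem n).1.sqrt.add hpm.sqrt)).aestronglyMeasurable)
    (memLp_mul_sqrt hpm hp0 hBm hBL _) ?_ ?_
  · refine ⟨fun n => ns n + N, ?_⟩
    have hR : ∫ o, δ₀ o * (D o * (Real.sqrt (p o) + Real.sqrt (p o))) ∂ν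
        = ∫ o, D o * s o ∂law ν p := by
      rw [integral_law hpm hp0]
      refine integral_congr_ae ?_
      filter_upwards [hs'e] with o ho
      rcases (hp0 o).eq_or_lt with h0 | h0
      · simp [← h0]
      · have h1 : Real.sqrt (p o) * Real.sqrt (p o) = p o := Real.mul_self_sqrt h0.le
        simp only [hδ₀def, ho h0]
        linear_combination (s' o * D o) * h1
    rw [hR] at hkey
    refine hkey.congr fun n => ?_
    change _ = (Ψ (path (τ n)) - Ψ p) / τ n
    rw [hexp n, div_eq_mul_inv, ← integral_mul_const]
    refine integral_congr_ae (ae_of_all _ fun o => ?_)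
    have h1 : Real.sqrt (p o) * Real.sqrt (p o) = p o := Real.mul_self_sqrt (hp0 o)
    have h2 : Real.sqrt (path (τ n) o) * Real.sqrt (path (τ n) o) = path (τ n) o :=
      Real.mul_self_sqrt ((hmem n).2.1 o)
    change (Real.sqrt (path (τ n) o) - Real.sqrt (p o)) / τ n * (E n o * _) = _
    dsimp only
    rw [div_eq_mul_inv]
    linear_combination (τ n)⁻¹ * E n o * (h2 - h1)
  · intro n
    filter_upwards [(ae_law_iff hpm).1 (hEB n), hcomp n] with o ho hc
    -- off the support of `p` the whole path vanishes, by comparability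
    rcases (hp0 o).eq_or_lt with h0 | h0
    · have : path (τ n) o ≤ 0 := by simpa [← h0] using hc.2
      simp [← h0, Real.sqrt_eq_zero_of_nonpos this]
    · have h1 : Real.sqrt (path (τ n) o) ≤ Real.sqrt C * Real.sqrt (p o) := by
        rw [← Real.sqrt_mul hC.le]
        exact Real.sqrt_le_sqrt hc.2
      have h2 := ho h0
      rw [abs_mul, abs_of_nonneg (by positivity :
        0 ≤ Real.sqrt (path (τ n) o) + Real.sqrt (p o))]
      calc |E n o| * (Real.sqrt (path (τ n) o) + Real.sqrt (p o))
          ≤ B o * (Real.sqrt C * Real.sqrt (p o) + Real.sqrt (p o)) := by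
            have : 0 ≤ B o := (abs_nonneg _).trans h2
            gcongr
        _ = _ := by ring
  · filter_upwards [(ae_law_iff hpm).1 hElim, hsqrt, ae_all_iff.2 hcomp] with o ho hs hc
    rcases (hp0 o).eq_or_lt with h0 | h0
    · have : ∀ n, Real.sqrt (path (τ n) o) = 0 := fun n =>
        Real.sqrt_eq_zero_of_nonpos (by simpa [← h0] using (hc n).2)
      simp [← h0, this]
    · exact (ho h0).mul (hs.add_const _)

/-- A parameter with an exact expansion is differentiable along every regular path. -/
theorem HasExactExpansion.hasDerivAt (hp : p ∈ nonparametricModel ν)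
    {path : ℝ → Ω → ℝ} {s : Ω → ℝ} (h : IsRegularPath ν (nonparametricModel ν) p path s)
    {Ψ : (Ω → ℝ) → ℝ} {D : Ω → ℝ} (hΨ : HasExactExpansion ν Ψ p D) :
    HasDerivAt (fun t => Ψ (path t)) (∫ o, D o * s o ∂law ν p) 0 := by
  rw [hasDerivAt_iff_tendsto_slope]
  refine tendsto_of_subseq_tendsto fun t ht => ?_
  obtain ⟨ns, hns⟩ := h.exists_subseq_tendsto_slope hp hΨ ht
  refine ⟨ns, hns.congr fun n => ?_⟩
  rw [slope_def_field, h.at_zero, sub_zero]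

/-! ### Scores and the tangent space of the nonparametric model -/

/-- The total mass is constant on the model, and its derivative is the mean of the score. -/
theorem IsRegularPath.integral_score_eq_zero (hp : p ∈ nonparametricModel ν)
    {path : ℝ → Ω → ℝ} {s : Ω → ℝ} (h : IsRegularPath ν (nonparametricModel ν) p path s) :
    ∫ o, s o ∂law ν p = 0 := by
  have := isProbabilityMeasure_law hp
  have hexp : HasExactExpansion ν (fun f => ∫ o, f o ∂ν) p fun _ => 1 := by
    intro P C _ hP _ _
    refine ⟨fun _ _ => 1, fun _ => 1, fun _ => measurable_const, measurable_const,
      memLp_const 1, by simp, by simp, fun n => ?_⟩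
    simp only [one_mul]
    rw [integral_sub (hP n).2.2.1 hp.2.2.1]
  have h1 := hexp.hasDerivAt hp h
  have h2 : HasDerivAt (fun t => ∫ o, path t o ∂ν) 0 0 := by
    refine (hasDerivAt_const (0 : ℝ) (1 : ℝ)).congr_of_eventuallyEq ?_
    filter_upwards [h.mem_model] with t ht using ht.2.2.2
  simpa using h1.unique h2

/-- Second-order control of the square root, which makes linear paths differentiable in quadratic
mean. -/
lemma abs_sqrt_one_add_sub_le {x : ℝ} (hx : -1 ≤ x) :
    |Real.sqrt (1 + x) - 1 - x / 2| ≤ x ^ 2 := by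
  have h0 : 0 ≤ Real.sqrt (1 + x) := Real.sqrt_nonneg _
  have h1 : Real.sqrt (1 + x) * Real.sqrt (1 + x) = 1 + x := Real.mul_self_sqrt (by linarith)
  set y := Real.sqrt (1 + x)
  have hx' : x = y * y - 1 := by linarith
  rw [hx', abs_le]
  constructor <;> nlinarith [sq_nonneg (y - 1), mul_nonneg h0 (sq_nonneg (y - 1)),
    mul_nonneg h0 h0]

/-- The linear path `p (1 + t g)` with a bounded mean-zero direction `g` is a regular submodel with
score `g`. -/
theorem isRegularPath_linear (hp : p ∈ nonparametricModel ν) {g s : Ω → ℝ} (hg : Measurable g)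
    (hg1 : ∀ o, |g o| ≤ 1) (hg0 : ∫ o, g o ∂law ν p = 0) (hs : s =ᵐ[law ν p] g) :
    IsRegularPath ν (nonparametricModel ν) p (fun t o => p o * (1 + t * g o)) s := by
  have := isProbabilityMeasure_law hp
  obtain ⟨hpm, hp0, hpi, hp1⟩ := hp
  have hgL : MemLp g 2 (law ν p) :=
    MemLp.of_bound hg.aestronglyMeasurable 1 (ae_of_all _ hg1)
  have hgi : Integrable (fun o => g o * p o) ν :=
    (integrable_law_iff hpm hp0).1 (hgL.integrable (by norm_num))
  rw [integral_law hpm hp0] at hg0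
  -- for `|t| < 1/2` the factor `1 + t g` lies in `[1/2, 3/2]`, so `2` bounds the likelihood ratios
  have hnear : ∀ᶠ t : ℝ in 𝓝 0, |t| < 1 / 2 := by
    have : Tendsto (fun t : ℝ => |t|) (𝓝 0) (𝓝 0) := by
      simpa using (continuous_abs.tendsto (0 : ℝ))
    exact this.eventually (gt_mem_nhds (by norm_num))
  have hbd : ∀ t : ℝ, |t| < 1 / 2 → ∀ o, |t * g o| ≤ 1 / 2 := fun t ht o => by
    rw [abs_mul]
    nlinarith [hg1 o, abs_nonneg t, abs_nonneg (g o)]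
  refine ⟨?_, by simp, hgL.ae_eq hs.symm, ?_, 2, by norm_num, ?_⟩
  · filter_upwards [hnear] with t ht
    have hd : (fun o => p o * (1 + t * g o)) = fun o => p o + t * (g o * p o) := by
      ext o; ring
    refine ⟨by fun_prop, fun o => mul_nonneg (hp0 o) ?_, ?_, ?_⟩
    · linarith [(abs_le.1 (hbd t ht o)).1]
    · rw [hd]; exact hpi.add (hgi.const_mul t)
    · rw [hd, integral_add hpi (hgi.const_mul t), integral_const_mul, hg0, hp1]; simp
  · have hs' : ∀ᵐ o ∂ν, 0 < p o → s o = g o := (ae_law_iff hpm).1 hs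
    have hz : Tendsto (fun t : ℝ => ENNReal.ofReal (t ^ 2) * ∫⁻ o, ENNReal.ofReal (p o) ∂ν)
        (𝓝[≠] 0) (𝓝 0) := by
      have h1 : Tendsto (fun t : ℝ => ENNReal.ofReal (t ^ 2)) (𝓝[≠] 0) (𝓝 0) := by
        have h2 : Tendsto (fun t : ℝ => t ^ 2) (𝓝 0) (𝓝 0) := by
          simpa using (continuous_pow 2).tendsto (0 : ℝ)
        simpa using (ENNReal.tendsto_ofReal h2).mono_left nhdsWithin_le_nhds
      have h3 : ∫⁻ o, ENNReal.ofReal (p o) ∂ν ≠ ⊤ := by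
        rw [← ofReal_integral_eq_lintegral_ofReal hpi (ae_of_all _ hp0)]
        exact ENNReal.ofReal_ne_top
      simpa using ENNReal.Tendsto.mul_const h1 (Or.inr h3)
    refine tendsto_of_tendsto_of_tendsto_of_le_of_le' tendsto_const_nhds hz
      (Eventually.of_forall fun _ => zero_le) ?_
    filter_upwards [hnear.filter_mono nhdsWithin_le_nhds, self_mem_nhdsWithin] with t ht htne
    rw [← lintegral_const_mul _ (by fun_prop)]
    refine lintegral_mono_ae ?_
    filter_upwards [hs'] with o ho
    rw [← ENNReal.ofReal_mul (sq_nonneg _)]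
    refine ENNReal.ofReal_le_ofReal ?_
    rcases (hp0 o).eq_or_lt with h0 | h0
    · simp [← h0]
    have htne' : t ≠ 0 := htne
    have h1 := hbd t ht o
    have h2 := abs_sqrt_one_add_sub_le (x := t * g o) (by linarith [(abs_le.1 h1).1])
    have h3 : (Real.sqrt (p o * (1 + t * g o)) - Real.sqrt (p o)) / t - s o * Real.sqrt (p o) / 2
        = Real.sqrt (p o) * ((Real.sqrt (1 + t * g o) - 1 - t * g o / 2) / t) := by
      rw [Real.sqrt_mul h0.le, ho h0]
      field_simp
    rw [h3, mul_pow, Real.sq_sqrt h0.le, mul_comm]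
    refine mul_le_mul_of_nonneg_right ?_ h0.le
    rw [sq_le_sq, abs_div, div_le_iff₀ (abs_pos.2 htne')]
    refine h2.trans ?_
    rw [mul_pow, ← sq_abs t, sq]
    have : g o ^ 2 ≤ 1 := by rw [← sq_abs]; nlinarith [hg1 o, abs_nonneg (g o)]
    nlinarith [mul_self_nonneg |t|]
  · filter_upwards [hnear] with t ht
    refine ae_of_all _ fun o => ?_
    have h1 := abs_le.1 (hbd t ht o)
    constructor <;> nlinarith [hp0 o, mul_le_mul_of_nonneg_left h1.1 (hp0 o),
      mul_le_mul_of_nonneg_left h1.2 (hp0 o)]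

/-- A square-integrable function that is orthogonal to every score is almost surely constant: the
centred indicators are scores. -/
lemma ae_eq_const_of_forall_score (hp : p ∈ nonparametricModel ν) {f : Ω → ℝ}
    (hf : MemLp f 2 (law ν p))
    (h : ∀ (path : ℝ → Ω → ℝ) (s : Ω → ℝ), Measurable s →
      IsRegularPath ν (nonparametricModel ν) p path s → ∫ o, f o * s o ∂law ν p = 0) :
    f =ᵐ[law ν p] fun _ => ∫ o, f o ∂law ν p := by
  have := isProbabilityMeasure_law hp
  have hfi : Integrable f (law ν p) := hf.integrable (by norm_num)
  refine Integrable.ae_eq_of_forall_setIntegral_eq _ _ hfi (integrable_const _) fun A hA _ => ?_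
  set c := (law ν p).real A with hc
  have hc0 : 0 ≤ c := measureReal_nonneg
  have hc1 : c ≤ 1 := measureReal_le_one
  have hgm : Measurable (fun o => A.indicator 1 o - c : Ω → ℝ) :=
    (measurable_one.indicator hA).sub_const c
  have hpath := isRegularPath_linear hp (g := fun o => A.indicator 1 o - c) hgm
    (fun o => by
      by_cases ho : o ∈ A
      · simp only [Set.indicator_of_mem ho, Pi.one_apply]; rw [abs_le]; constructor <;> linarith
      · simp only [Set.indicator_of_notMem ho]; rw [abs_le]; constructor <;> linarith)
    (by
      have hi : Integrable (A.indicator (1 : Ω → ℝ)) (law ν p) :=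
        (integrable_const (1 : ℝ)).indicator hA
      rw [integral_sub hi (integrable_const _), integral_indicator hA]
      simp [hc]) (ae_eq_refl _)
  have h1 := h _ _ hgm hpath
  have h2 : (fun o => f o * (A.indicator 1 o - c)) = fun o => A.indicator f o - c * f o := by
    ext o
    by_cases ho : o ∈ A
    · simp [ho]; ring
    · simp [ho]; ring
  rw [h2, integral_sub (hfi.indicator hA) (hfi.const_mul c), integral_indicator hA,
    integral_const_mul] at h1
  rw [setIntegral_const, smul_eq_mul]
  linarith

/-- The tangent space of the nonparametric model consists of the mean-zero functions. -/
theorem mem_tangentSpace_iff (hp : p ∈ nonparametricModel ν) (f : Lp ℝ 2 (law ν p)) :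
    f ∈ tangentSpace ν (nonparametricModel ν) p ↔ ∫ o, f o ∂law ν p = 0 := by
  have := isProbabilityMeasure_law hp
  have hone : ∀ f : Lp ℝ 2 (law ν p),
      inner ℝ ((memLp_const (1 : ℝ)).toLp (fun _ : Ω => (1 : ℝ)) : Lp ℝ 2 (law ν p)) f
        = ∫ o, f o ∂law ν p := fun f => by
    rw [L2.inner_def]
    refine integral_congr_ae ?_
    filter_upwards [(memLp_const (μ := law ν p) (p := 2) (1 : ℝ)).coeFn_toLp] with o ho
    rw [ho]; simp
  constructor
  · intro hf
    have hle : tangentSpace ν (nonparametricModel ν) p ≤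
        (Submodule.span ℝ {((memLp_const (1 : ℝ)).toLp (fun _ : Ω => (1 : ℝ)) :
          Lp ℝ 2 (law ν p))})ᗮ := by
      refine Submodule.topologicalClosure_minimal _ ?_ (Submodule.isClosed_orthogonal _)
      rw [Submodule.span_le]
      rintro s ⟨path, hs⟩
      rw [SetLike.mem_coe, Submodule.mem_orthogonal_singleton_iff_inner_right, hone]
      exact hs.integral_score_eq_zero hp
    have := hle hf
    rwa [Submodule.mem_orthogonal_singleton_iff_inner_right, hone] at this
  · intro hf
    have : CompleteSpace (tangentSpace ν (nonparametricModel ν) p) :=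
      (Submodule.isClosed_topologicalClosure _).completeSpace_coe
    rw [← Submodule.orthogonal_orthogonal (tangentSpace ν (nonparametricModel ν) p),
      Submodule.mem_orthogonal]
    intro k hk
    -- a vector orthogonal to all scores is constant, hence orthogonal to the mean-zero `f`
    have hkc := ae_eq_const_of_forall_score hp (Lp.memLp k) fun path s hsm hs => by
      have hsL := hs.score_memLp
      have hmem : hsL.toLp s ∈ tangentSpace ν (nonparametricModel ν) p := by
        refine Submodule.le_topologicalClosure _ (Submodule.subset_span ⟨path, ?_⟩)
        have hae : ∀ᵐ o ∂ν, 0 < p o → hsL.toLp s o = s o := (ae_law_iff hp.1).1 hsL.coeFn_toLp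
        refine ⟨hs.mem_model, hs.at_zero, hsL.ae_eq hsL.coeFn_toLp.symm, ?_, hs.likelihood_ratio⟩
        refine hs.quadratic_mean.congr fun t => lintegral_congr_ae ?_
        filter_upwards [hae] with o ho
        rcases (hp.2.1 o).eq_or_lt with h0 | h0
        · simp [← h0]
        · rw [ho h0]
      have h1 := (Submodule.mem_orthogonal _ _).1 hk _ hmem
      rw [L2.inner_def] at h1
      rw [← h1]
      refine integral_congr_ae ?_
      filter_upwards [hsL.coeFn_toLp] with o ho
      rw [ho]; simp
    rw [L2.inner_def]
    calc ∫ o, inner ℝ (k o) (f o) ∂law ν p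
        = ∫ o, (∫ o, k o ∂law ν p) * f o ∂law ν p := by
          refine integral_congr_ae ?_
          filter_upwards [hkc] with o ho
          rw [← ho]; simp [mul_comm]
      _ = 0 := by rw [integral_const_mul, hf, mul_zero]

/-- In the nonparametric model, a mean-zero square-integrable gradient is the efficient influence
function, and the only one. -/
theorem isEfficientInfluenceFunction_iff (hp : p ∈ nonparametricModel ν) {Ψ : (Ω → ℝ) → ℝ}
    {ψ : Ω → ℝ} (hψ : MemLp ψ 2 (law ν p)) (hψ0 : ∫ o, ψ o ∂law ν p = 0)
    (hderiv : ∀ (path : ℝ → Ω → ℝ) (s : Ω → ℝ),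
      IsRegularPath ν (nonparametricModel ν) p path s →
      HasDerivAt (fun t => Ψ (path t)) (∫ o, ψ o * s o ∂law ν p) 0) (φ : Ω → ℝ) :
    IsEfficientInfluenceFunction ν (nonparametricModel ν) Ψ p φ ↔ φ =ᵐ[law ν p] ψ := by
  have := isProbabilityMeasure_law hp
  constructor
  · rintro ⟨hφ, hφT, hφd⟩
    rw [mem_tangentSpace_iff hp, integral_congr_ae hφ.coeFn_toLp] at hφT
    have hc := ae_eq_const_of_forall_score hp (hφ.sub hψ) fun path s _ hs => by
      have h1 := (hφd path s hs).unique (hderiv path s hs)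
      simp only [Pi.sub_apply, sub_mul]
      have hi₁ : Integrable (fun o => φ o * s o) (law ν p) := hφ.integrable_mul hs.score_memLp
      have hi₂ : Integrable (fun o => ψ o * s o) (law ν p) := hψ.integrable_mul hs.score_memLp
      rw [integral_sub hi₁ hi₂, h1, sub_self]
    simp only [Pi.sub_apply] at hc
    rw [integral_sub (hφ.integrable (by norm_num)) (hψ.integrable (by norm_num)), hφT, hψ0,
      sub_zero] at hc
    filter_upwards [hc] with o ho
    simp only [Pi.sub_apply] at ho
    linarith
  · intro h
    have hφ : MemLp φ 2 (law ν p) := hψ.ae_eq h.symm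
    refine ⟨hφ, ?_, fun path s hs => ?_⟩
    · rw [mem_tangentSpace_iff hp, integral_congr_ae hφ.coeFn_toLp, integral_congr_ae h, hψ0]
    · have : ∫ o, φ o * s o ∂law ν p = ∫ o, ψ o * s o ∂law ν p := by
        refine integral_congr_ae ?_
        filter_upwards [h] with o ho
        rw [ho]
      rw [this]
      exact hderiv path s hs

end General

/-! ### Comparable nonnegative quantities and their limits -/

/-- The sequence `x` of nonnegative numbers is comparable with `x₀` up to the factor `C`, and
converges to it. -/
structure Approx (C : ℝ) (x₀ : ℝ) (x : ℕ → ℝ) : Prop where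
  nonneg : 0 ≤ x₀
  nonneg_seq : ∀ n, 0 ≤ x n
  le_seq : ∀ n, x₀ ≤ C * x n
  seq_le : ∀ n, x n ≤ C * x₀
  tendsto : Tendsto x atTop (𝓝 x₀)

namespace Approx

variable {C K x₀ y₀ : ℝ} {x y : ℕ → ℝ}

lemma eq_zero (h : Approx C x₀ x) (h0 : x₀ = 0) (n : ℕ) : x n = 0 :=
  le_antisymm (by simpa [h0] using h.seq_le n) (h.nonneg_seq n)

lemma pos (h : Approx C x₀ x) (h0 : 0 < x₀) (n : ℕ) : 0 < x n := by
  refine (h.nonneg_seq n).lt_of_ne fun h1 => ?_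
  have := h.le_seq n
  rw [← h1, mul_zero] at this
  linarith

lemma mul (hx : Approx C x₀ x) (hy : Approx K y₀ y) :
    Approx (C * K) (x₀ * y₀) fun n => x n * y n where
  nonneg := mul_nonneg hx.nonneg hy.nonneg
  nonneg_seq n := mul_nonneg (hx.nonneg_seq n) (hy.nonneg_seq n)
  le_seq n := (mul_le_mul (hx.le_seq n) (hy.le_seq n) hy.nonneg
    (hx.nonneg.trans (hx.le_seq n))).trans_eq (by ring)
  seq_le n := (mul_le_mul (hx.seq_le n) (hy.seq_le n) (hy.nonneg_seq n)
    ((hx.nonneg_seq n).trans (hx.seq_le n))).trans_eq (by ring)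
  tendsto := hx.tendsto.mul hy.tendsto

lemma inv (hy : Approx K y₀ y) : Approx K y₀⁻¹ fun n => (y n)⁻¹ := by
  rcases hy.nonneg.eq_or_lt with h0 | h0
  · have : ∀ n, y n = 0 := hy.eq_zero h0.symm
    simp only [← h0, this, inv_zero]
    exact ⟨le_rfl, by simp, by simp, by simp, tendsto_const_nhds⟩
  · have hp := hy.pos h0
    refine ⟨by positivity, fun n => (inv_pos.2 (hp n)).le, fun n => ?_, fun n => ?_,
      hy.tendsto.inv₀ h0.ne'⟩
    · rw [← div_eq_mul_inv, le_div_iff₀ (hp n), inv_mul_le_iff₀ h0, mul_comm]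
      exact hy.seq_le n
    · rw [← div_eq_mul_inv, le_div_iff₀ h0, inv_mul_le_iff₀ (hp n), mul_comm]
      exact hy.le_seq n

/-- Division respects comparability even at zero denominators, since those vanish
simultaneously. -/
lemma div (hx : Approx C x₀ x) (hy : Approx K y₀ y) :
    Approx (C * K) (x₀ / y₀) fun n => x n / y n := by
  simpa only [div_eq_mul_inv] using hx.mul hy.inv

lemma sum {ι : Type*} (s : Finset ι) {f₀ : ι → ℝ} {f : ι → ℕ → ℝ}
    (h : ∀ i ∈ s, Approx C (f₀ i) (f i)) : Approx C (∑ i ∈ s, f₀ i) fun n => ∑ i ∈ s, f i n where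
  nonneg := Finset.sum_nonneg fun i hi => (h i hi).nonneg
  nonneg_seq n := Finset.sum_nonneg fun i hi => (h i hi).nonneg_seq n
  le_seq n := by
    rw [Finset.mul_sum]; exact Finset.sum_le_sum fun i hi => (h i hi).le_seq n
  seq_le n := by
    rw [Finset.mul_sum]; exact Finset.sum_le_sum fun i hi => (h i hi).seq_le n
  tendsto := tendsto_finsetSum _ fun i hi => (h i hi).tendsto

lemma integral {α : Type*} [MeasurableSpace α] {μ : Measure α} {f₀ : α → ℝ} {f : ℕ → α → ℝ}
    (h : ∀ᵐ a ∂μ, Approx C (f₀ a) fun n => f n a) (hf₀ : Integrable f₀ μ)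
    (hf : ∀ n, Integrable (f n) μ) : Approx C (∫ a, f₀ a ∂μ) fun n => ∫ a, f n a ∂μ where
  nonneg := integral_nonneg_of_ae <| h.mono fun _ ha => ha.nonneg
  nonneg_seq n := integral_nonneg_of_ae <| h.mono fun _ ha => ha.nonneg_seq n
  le_seq n := by
    rw [← integral_const_mul]
    exact integral_mono_ae hf₀ ((hf n).const_mul C) (h.mono fun _ ha => ha.le_seq n)
  seq_le n := by
    rw [← integral_const_mul]
    exact integral_mono_ae (hf n) (hf₀.const_mul C) (h.mono fun _ ha => ha.seq_le n)
  tendsto := by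
    refine tendsto_integral_of_dominated_convergence (fun a => C * f₀ a) (fun n => (hf n).1)
      (hf₀.const_mul C) (fun n => ?_) (h.mono fun _ ha => ha.tendsto)
    filter_upwards [h] with a ha
    rw [Real.norm_of_nonneg (ha.nonneg_seq n)]
    exact ha.seq_le n

end Approx

/-! ### Marginals of nonnegative densities -/

section Marginal

variable {α β : Type*} [MeasurableSpace α] [MeasurableSpace β] {μ : Measure α} {ν : Measure β}

lemma integrable_abs_mul_of_sq {f r : α → ℝ} (hf : Measurable f) (hr0 : ∀ x, 0 ≤ r x)
    (hr : Integrable r μ) (h : Integrable (fun x => f x ^ 2 * r x) μ) :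
    Integrable (fun x => |f x| * r x) μ := by
  refine (hr.add h).mono' ((hf.norm).aestronglyMeasurable.mul hr.1) (ae_of_all _ fun x => ?_)
  rw [Real.norm_of_nonneg (mul_nonneg (abs_nonneg _) (hr0 x)), Pi.add_apply, ← sq_abs]
  nlinarith [hr0 x, sq_nonneg (|f x| - 1), abs_nonneg (f x),
    mul_nonneg (hr0 x) (sq_nonneg (|f x| - 1)), mul_nonneg (hr0 x) (sq_nonneg (f x))]

/-- Jensen's inequality for a probability density, in the form used for conditional means. -/
lemma sq_integral_abs_mul_le {f r : α → ℝ} (hf : Measurable f) (hr0 : ∀ x, 0 ≤ r x)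
    (hr : Integrable r μ) (hr1 : ∫ x, r x ∂μ = 1) (h : Integrable (fun x => f x ^ 2 * r x) μ) :
    (∫ x, |f x| * r x ∂μ) ^ 2 ≤ ∫ x, f x ^ 2 * r x ∂μ := by
  have hi := integrable_abs_mul_of_sq hf hr0 hr h
  set c := ∫ x, |f x| * r x ∂μ
  -- integrate the tangent bound `2 c |f| - c² ≤ f²` at the mean `c`
  have h1 : ∫ x, (2 * c * (|f x| * r x) - c ^ 2 * r x) ∂μ ≤ ∫ x, f x ^ 2 * r x ∂μ := by
    refine integral_mono ((hi.const_mul _).sub (hr.const_mul _)) h fun x => ?_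
    have := mul_nonneg (hr0 x) (sq_nonneg (|f x| - c))
    have h2 := sq_abs (f x)
    dsimp only
    rw [← h2]
    linarith
  rw [integral_sub (hi.const_mul _) (hr.const_mul _), integral_const_mul, integral_const_mul,
    hr1] at h1
  change 2 * c * c - c ^ 2 * 1 ≤ _ at h1
  linarith

variable [SigmaFinite ν]

lemma integrable_mul_iff_marginal [SigmaFinite μ] {d : α × β → ℝ} (hd : Integrable d (μ.prod ν))
    (h0 : ∀ x, 0 ≤ d x) {F : α → ℝ} (hF : Measurable F) :
    Integrable (fun x => F x.1 * d x) (μ.prod ν) ↔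
      Integrable (fun x => F x * ∫ y, d (x, y) ∂ν) μ := by
  have hm : AEStronglyMeasurable (fun x : α × β => F x.1 * d x) (μ.prod ν) :=
    (hF.comp measurable_fst).aestronglyMeasurable.mul hd.1
  have hm' : AEStronglyMeasurable (fun x => F x * ∫ y, d (x, y) ∂ν) μ :=
    hF.aestronglyMeasurable.mul hd.integral_prod_left.1
  rw [integrable_prod_iff hm, ← integrable_norm_iff hm', and_iff_right]
  · refine integrable_congr (ae_of_all _ fun x => ?_)
    simp only [norm_mul, Real.norm_of_nonneg (h0 _), integral_const_mul]
    rw [Real.norm_of_nonneg (integral_nonneg fun _ => h0 _)]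
  · filter_upwards [hd.prod_right_ae] with x hx using hx.const_mul _

lemma integral_mul_eq_marginal [SigmaFinite μ] {d : α × β → ℝ} {F : α → ℝ}
    (h : Integrable (fun x => F x.1 * d x) (μ.prod ν)) :
    ∫ x, F x.1 * d x ∂μ.prod ν = ∫ x, F x * ∫ y, d (x, y) ∂ν ∂μ := by
  rw [integral_prod _ h]
  simp only [integral_const_mul]

/-- A density vanishes almost everywhere on the zero set of its marginal. -/
lemma ae_marginal_pos [SigmaFinite μ] {d : α × β → ℝ} (hm : Measurable d) (hd : Integrable d (μ.prod ν))
    (h0 : ∀ x, 0 ≤ d x) : ∀ᵐ x ∂μ.prod ν, 0 < d x → 0 < ∫ y, d (x.1, y) ∂ν := by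
  have hmarg : Measurable fun x => ∫ y, d (x, y) ∂ν :=
    (hm.stronglyMeasurable.integral_prod_right' (ν := ν)).measurable
  set F : α → ℝ := {x | ∫ y, d (x, y) ∂ν = 0}.indicator 1 with hF
  have hFm : Measurable F := measurable_one.indicator (hmarg (measurableSet_singleton 0))
  have hz : ∀ x, F x * ∫ y, d (x, y) ∂ν = 0 := fun x => by
    by_cases hx : ∫ y, d (x, y) ∂ν = 0
    · simp [hx]
    · simp [hF, hx]
  -- the mass of `d` on the zero set of its marginal is zero
  have hi : Integrable (fun x => F x.1 * d x) (μ.prod ν) := by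
    rw [integrable_mul_iff_marginal hd h0 hFm]
    simp [hz]
  have h1 := integral_mul_eq_marginal hi
  simp only [hz, integral_zero] at h1
  have hFn : ∀ x, 0 ≤ F x := fun x => Set.indicator_nonneg (fun _ _ => zero_le_one) _
  rw [integral_eq_zero_iff_of_nonneg (fun x => mul_nonneg (hFn _) (h0 _)) hi] at h1
  filter_upwards [h1] with x hx hpos
  refine (integral_nonneg fun _ => h0 _).lt_of_ne fun h2 => ?_
  have : F x.1 = 1 := by simp [hF, ← h2]
  simp only [this, one_mul, Pi.zero_apply] at hx
  exact hpos.ne' hx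

/-- The conditional mean of `|f|` under `r`, squared and averaged over `q₀`, is bounded by the
second moment of `f`. -/
lemma integral_sq_condMean_le [SigmaFinite μ] {f : α × β → ℝ} (hf : Measurable f) {q₀ : α → ℝ} {r : β → ℝ}
    (hq : Measurable q₀) (hq0 : ∀ x, 0 ≤ q₀ x) (hrm : Measurable r) (hr0 : ∀ y, 0 ≤ r y)
    (hr : Integrable r ν)
    (hr1 : ∫ y, r y ∂ν = 1) (h : Integrable (fun x => f x ^ 2 * (q₀ x.1 * r x.2)) (μ.prod ν)) :
    Integrable (fun x => (∫ y, |f (x, y)| * r y ∂ν) ^ 2 * q₀ x) μ ∧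
      ∫ x, (∫ y, |f (x, y)| * r y ∂ν) ^ 2 * q₀ x ∂μ ≤
        ∫ x, f x ^ 2 * (q₀ x.1 * r x.2) ∂μ.prod ν := by
  have hm : Measurable fun x => ∫ y, |f (x, y)| * r y ∂ν :=
    ((hf.norm.mul (hrm.comp measurable_snd)).stronglyMeasurable.integral_prod_right
      (ν := ν)).measurable
  have hle : ∀ᵐ x ∂μ, (∫ y, |f (x, y)| * r y ∂ν) ^ 2 * q₀ x ≤
      ∫ y, f (x, y) ^ 2 * (q₀ x * r y) ∂ν := by
    filter_upwards [h.prod_right_ae] with x hx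
    have e : (fun y => f (x, y) ^ 2 * (q₀ x * r y)) = fun y => q₀ x * (f (x, y) ^ 2 * r y) := by
      ext y; ring
    rw [e] at hx ⊢
    rcases (hq0 x).eq_or_lt with h0 | h0
    · simp [← h0]
    · rw [integral_const_mul, mul_comm]
      refine mul_le_mul_of_nonneg_left ?_ h0.le
      refine sq_integral_abs_mul_le (hf.comp measurable_prodMk_left) hr0 hr hr1 ?_
      simpa [← mul_assoc, inv_mul_cancel₀ h0.ne'] using hx.const_mul (q₀ x)⁻¹
  have hi : Integrable (fun x => (∫ y, |f (x, y)| * r y ∂ν) ^ 2 * q₀ x) μ := by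
    refine h.integral_prod_left.mono' ((hm.pow_const 2).mul hq).aestronglyMeasurable ?_
    filter_upwards [hle] with x hx
    rwa [Real.norm_of_nonneg (mul_nonneg (sq_nonneg _) (hq0 x))]
  exact ⟨hi, (integral_mono_ae hi h.integral_prod_left hle).trans_eq (integral_prod _ h).symm⟩

/-- A nonnegative function on a product is integrable if its partial integrals are dominated by an
integrable function. -/
lemma integrable_prod_of_integral_le {F : α × β → ℝ} (hF : Measurable F) (h0 : ∀ x, 0 ≤ F x)
    {I : α → ℝ} (hI : Integrable I μ)
    (h : ∀ᵐ x ∂μ, Integrable (fun y => F (x, y)) ν ∧ ∫ y, F (x, y) ∂ν ≤ I x) :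
    Integrable F (μ.prod ν) := by
  rw [integrable_prod_iff hF.aestronglyMeasurable]
  refine ⟨h.mono fun x hx => hx.1, ?_⟩
  refine hI.mono' ?_ ?_
  · exact (hF.norm.stronglyMeasurable.integral_prod_right (ν := ν)).aestronglyMeasurable
  · filter_upwards [h] with x hx
    simp only [Real.norm_of_nonneg (h0 _)]
    rw [Real.norm_of_nonneg (integral_nonneg fun _ => h0 _)]
    exact hx.2

end Marginal

/-! ### Slicing the reference measure along the treatment -/

section Slice

variable {W A Z M : Type*} [MeasurableSpace W] [MeasurableSpace A] [MeasurableSpace Z]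
  [MeasurableSpace M]

/-- The observation with treatment `a` and remaining coordinates `((w, z, m), y)`. -/
def slice (a : A) (x : (W × Z × M) × ℝ) : W × A × Z × M × ℝ :=
  (x.1.1, a, x.1.2.1, x.1.2.2, x.2)

@[fun_prop]
lemma measurable_slice (a : A) : Measurable (slice a : (W × Z × M) × ℝ → W × A × Z × M × ℝ) := by
  unfold slice; fun_prop

variable [Fintype A] [MeasurableSingletonClass A]
  (νW : Measure W) (νZ : Measure Z) (νM : Measure M) (νY : Measure ℝ)
  [SigmaFinite νW] [SigmaFinite νZ] [SigmaFinite νM] [SigmaFinite νY]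

lemma refMeasure_eq_sum :
    (refMeasure νW νZ νM νY : Measure (W × A × Z × M × ℝ)) =
      ∑ a, Measure.map (slice a) ((νW.prod (νZ.prod νM)).prod νY) := by
  refine Measure.ext_of_lintegral _ fun f hf => ?_
  have h1 : ∫⁻ o, f o ∂refMeasure νW νZ νM νY =
      ∫⁻ w, ∑ a, ∫⁻ z, ∫⁻ m, ∫⁻ y, f (w, a, z, m, y) ∂νY ∂νM ∂νZ ∂νW := by
    rw [refMeasure, lintegral_prod _ hf.aemeasurable]
    refine lintegral_congr fun w => ?_
    rw [lintegral_prod _ (by fun_prop), lintegral_count, tsum_fintype]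
    refine Finset.sum_congr rfl fun a _ => ?_
    rw [lintegral_prod _ (by fun_prop)]
    refine lintegral_congr fun z => ?_
    rw [lintegral_prod _ (by fun_prop)]
  rw [h1, lintegral_finsetSum _ (fun a _ => by fun_prop), lintegral_finsetSum_measure]
  refine Finset.sum_congr rfl fun a _ => ?_
  rw [lintegral_map hf (measurable_slice a), lintegral_prod _ (by fun_prop),
    lintegral_prod _ (by fun_prop)]
  refine lintegral_congr fun w => ?_
  rw [lintegral_prod _ (by fun_prop)]
  rfl

variable {νW νZ νM νY}

lemma ae_refMeasure_iff {Q : W × A × Z × M × ℝ → Prop} (hQ : MeasurableSet {o | Q o}) :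
    (∀ᵐ o ∂refMeasure νW νZ νM νY, Q o) ↔
      ∀ a, ∀ᵐ x ∂(νW.prod (νZ.prod νM)).prod νY, Q (slice a x) := by
  simp only [refMeasure_eq_sum, ae_finsetSum_measure_iff, Finset.mem_univ, true_imp_iff,
    ae_map_iff (measurable_slice _).aemeasurable hQ]

lemma ae_slice_of_ae {Q : W × A × Z × M × ℝ → Prop} (h : ∀ᵐ o ∂refMeasure νW νZ νM νY, Q o)
    (a : A) : ∀ᵐ x ∂(νW.prod (νZ.prod νM)).prod νY, Q (slice a x) := by
  simp only [refMeasure_eq_sum, ae_finsetSum_measure_iff, Finset.mem_univ, true_imp_iff] at h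
  exact ae_of_ae_map (measurable_slice a).aemeasurable (h a)

lemma integrable_refMeasure_iff {f : W × A × Z × M × ℝ → ℝ} (hf : Measurable f) :
    Integrable f (refMeasure νW νZ νM νY) ↔
      ∀ a, Integrable (fun x => f (slice a x)) ((νW.prod (νZ.prod νM)).prod νY) := by
  simp only [refMeasure_eq_sum, integrable_finsetSum_measure, Finset.mem_univ, true_imp_iff]
  refine forall_congr' fun a => ?_
  rw [integrable_map_measure hf.aestronglyMeasurable (measurable_slice a).aemeasurable]
  rfl

lemma integral_refMeasure {f : W × A × Z × M × ℝ → ℝ} (hf : Measurable f)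
    (hi : Integrable f (refMeasure νW νZ νM νY)) :
    ∫ o, f o ∂refMeasure νW νZ νM νY =
      ∑ a, ∫ x, f (slice a x) ∂(νW.prod (νZ.prod νM)).prod νY := by
  rw [refMeasure_eq_sum, integrable_finsetSum_measure] at hi
  rw [refMeasure_eq_sum, integral_finsetSum_measure hi]
  refine Finset.sum_congr rfl fun a _ => ?_
  rw [integral_map (measurable_slice a).aemeasurable hf.aestronglyMeasurable]

end Slice

/-! ### Measurability of the marginal and conditional densities -/

section Measurability

variable {W A Z M T : Type*} [MeasurableSpace W] [MeasurableSpace A] [MeasurableSpace Z]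
  [MeasurableSpace M] [MeasurableSpace T] {νZ : Measure Z} {νM : Measure M} {νY : Measure ℝ}
  [SigmaFinite νZ] [SigmaFinite νM] [SigmaFinite νY] {p : W × A × Z × M × ℝ → ℝ}

lemma measurable_integral_right {γ : Type*} [MeasurableSpace γ] {ν : Measure γ} [SigmaFinite ν]
    {f : T → γ → ℝ} (hf : Measurable (Function.uncurry f)) : Measurable fun t => ∫ y, f t y ∂ν :=
  (hf.stronglyMeasurable.integral_prod_right (ν := ν)).measurable

lemma measurable_densWAZM (hp : Measurable p) {w : T → W} {z : T → Z} {m : T → M}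
    (hw : Measurable w) (a : A) (hz : Measurable z) (hm : Measurable m) :
    Measurable fun t => densWAZM νY p (w t) a (z t) (m t) :=
  measurable_integral_right (by unfold Function.uncurry; fun_prop)

lemma measurable_b (hp : Measurable p) {w : T → W} {z : T → Z} {m : T → M}
    (a : A) (hz : Measurable z) (hm : Measurable m) (hw : Measurable w) :
    Measurable fun t => b νY p a (z t) (m t) (w t) :=
  (measurable_integral_right (by unfold Function.uncurry; fun_prop)).div
    (measurable_densWAZM hp hw a hz hm)

lemma measurable_densWAZ (hp : Measurable p) {w : T → W} {z : T → Z}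
    (hw : Measurable w) (a : A) (hz : Measurable z) :
    Measurable fun t => densWAZ νM νY p (w t) a (z t) :=
  measurable_integral_right (measurable_densWAZM hp (by fun_prop) a (by fun_prop) (by fun_prop))

lemma measurable_densWAM (hp : Measurable p) {w : T → W} {m : T → M}
    (hw : Measurable w) (a : A) (hm : Measurable m) :
    Measurable fun t => densWAM νZ νY p (w t) a (m t) :=
  measurable_integral_right (measurable_densWAZM hp (by fun_prop) a (by fun_prop) (by fun_prop))

lemma measurable_densWA (hp : Measurable p) {w : T → W} (hw : Measurable w) (a : A) :
    Measurable fun t => densWA νZ νM νY p (w t) a :=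
  measurable_integral_right (measurable_densWAZ hp (by fun_prop) a (by fun_prop))

lemma measurable_densW [Fintype A] (hp : Measurable p) {w : T → W} (hw : Measurable w) :
    Measurable fun t => densW νZ νM νY p (w t) :=
  Finset.measurable_fun_sum _ fun a _ => measurable_densWA hp hw a

lemma measurable_q (hp : Measurable p) {w : T → W} {z : T → Z}
    (hz : Measurable z) (a : A) (hw : Measurable w) :
    Measurable fun t => q νZ νM νY p (z t) a (w t) :=
  (measurable_densWAZ hp hw a hz).div (measurable_densWA hp hw a)

lemma measurable_pM (hp : Measurable p) {w : T → W} {m : T → M}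
    (hm : Measurable m) (a : A) (hw : Measurable w) :
    Measurable fun t => pM νZ νM νY p (m t) a (w t) :=
  (measurable_densWAM hp hw a hm).div (measurable_densWA hp hw a)

lemma measurable_targetDensity [Fintype A] (hp : Measurable p) (a' astar : A)
    {x : T → W × Z × M} (hx : Measurable x) :
    Measurable fun t => targetDensity νZ νM νY a' astar p (x t) :=
  ((measurable_q hp (by fun_prop) a' (by fun_prop)).mul
    (measurable_pM hp (by fun_prop) astar (by fun_prop))).mul (measurable_densW hp (by fun_prop))

end Measurability

/-! ### Centred regressions on a product space -/

section Centred

variable {α β : Type*} [MeasurableSpace α] [MeasurableSpace β] {μ : Measure α} {ν : Measure β}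
  [SigmaFinite μ] [SigmaFinite ν]

/-- Integral of a recentred function of the first coordinate against a joint density with marginal
`e` of total mass `h`: only the mean under the conditional density `e / h` remains. -/
lemma integral_recentred {d : α × β → ℝ} (hd : Integrable d (μ.prod ν)) (h0 : ∀ x, 0 ≤ d x)
    {e : α → ℝ} (he : ∀ x, ∫ y, d (x, y) ∂ν = e x) {h κ : ℝ} (hh : ∫ x, e x ∂μ = h)
    (hκ : h = 0 → κ = 0) {f : α → ℝ} (hf : Measurable f)
    (hfi : Integrable (fun x => f x * (e x / h)) μ) (k : ℝ) :
    Integrable (fun x => κ * (f x.1 - k) * d x) (μ.prod ν) ∧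
      ∫ x, κ * (f x.1 - k) * d x ∂μ.prod ν = κ * h * (∫ x, f x * (e x / h) ∂μ - k) := by
  by_cases h1 : h = 0
  · simp [hκ h1]
  have hei : Integrable e μ := by
    refine hd.integral_prod_left.congr (ae_of_all _ he)
  have hqi : Integrable (fun x => e x / h) μ := hei.div_const h
  have hq1 : ∫ x, e x / h ∂μ = 1 := by rw [integral_div, hh, div_self h1]
  have hs : (fun x => κ * (f x - k) * e x) =
      fun x => κ * h * (f x * (e x / h) - k * (e x / h)) := by
    ext x; field_simp
  have hF : Measurable fun x => κ * (f x - k) := by fun_prop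
  have hi : Integrable (fun x => κ * (f x.1 - k) * d x) (μ.prod ν) := by
    rw [integrable_mul_iff_marginal (F := fun x => κ * (f x - k)) hd h0 hF]
    simp only [he, hs]
    exact (hfi.sub (hqi.const_mul k)).const_mul _
  refine ⟨hi, ?_⟩
  rw [integral_mul_eq_marginal (F := fun x => κ * (f x - k)) hi]
  simp only [he, hs]
  rw [integral_const_mul, integral_sub hfi (hqi.const_mul k), integral_const_mul, hq1, mul_one]

/-- Second-moment bound for a scaled conditional mean `κ (g + V)`. -/
lemma integral_sq_scaled_le {d : α × β → ℝ} (hd : Integrable d (μ.prod ν)) (h0 : ∀ x, 0 ≤ d x)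
    {e : α → ℝ} (he : ∀ x, ∫ y, d (x, y) ∂ν = e x) {h κ : ℝ} (hh : ∫ x, e x ∂μ = h)
    (hκ : h = 0 → κ = 0) {f : α → ℝ} (hf : Measurable f)
    (hfi : Integrable (fun x => f x ^ 2 * (e x / h)) μ) {V S : ℝ}
    (hfS : ∫ x, f x ^ 2 * (e x / h) ∂μ ≤ S) (hV : V ^ 2 ≤ S) :
    Integrable (fun x => (κ * (f x.1 + V)) ^ 2 * d x) (μ.prod ν) ∧
      ∫ x, (κ * (f x.1 + V)) ^ 2 * d x ∂μ.prod ν ≤ κ ^ 2 * h * (4 * S) := by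
  by_cases h1 : h = 0
  · simp [hκ h1]
  have hei : Integrable e μ := by
    refine hd.integral_prod_left.congr (ae_of_all _ he)
  have he0 : ∀ x, 0 ≤ e x := fun x => by rw [← he]; exact integral_nonneg fun _ => h0 _
  have hhpos : 0 < h := (hh ▸ integral_nonneg he0 : 0 ≤ h).lt_of_ne' h1
  have hqi : Integrable (fun x => e x / h) μ := hei.div_const h
  have hq1 : ∫ x, e x / h ∂μ = 1 := by rw [integral_div, hh, div_self h1]
  have hF : Measurable fun x => (κ * (f x + V)) ^ 2 := by fun_prop
  have hdom : Integrable (fun x => κ ^ 2 * h * (2 * (f x ^ 2 * (e x / h)) +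
      2 * V ^ 2 * (e x / h))) μ := ((hfi.const_mul 2).add (hqi.const_mul _)).const_mul _
  have hle : ∀ x, (κ * (f x + V)) ^ 2 * e x ≤
      κ ^ 2 * h * (2 * (f x ^ 2 * (e x / h)) + 2 * V ^ 2 * (e x / h)) := fun x => by
    have h2 : κ ^ 2 * h * (2 * (f x ^ 2 * (e x / h)) + 2 * V ^ 2 * (e x / h)) =
        κ ^ 2 * (2 * f x ^ 2 + 2 * V ^ 2) * e x := by field_simp
    rw [h2, mul_pow]
    have := he0 x
    gcongr
    nlinarith [sq_nonneg (f x - V)]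
  have hi' : Integrable (fun x => (κ * (f x + V)) ^ 2 * e x) μ := by
    refine hdom.mono' (hF.aestronglyMeasurable.mul hei.1) (ae_of_all _ fun x => ?_)
    rw [Real.norm_of_nonneg (mul_nonneg (sq_nonneg _) (he0 x))]
    exact hle x
  have hi : Integrable (fun x => (κ * (f x.1 + V)) ^ 2 * d x) (μ.prod ν) := by
    rw [integrable_mul_iff_marginal (F := fun x => (κ * (f x + V)) ^ 2) hd h0 hF]
    simpa only [he] using hi'
  refine ⟨hi, ?_⟩
  rw [integral_mul_eq_marginal (F := fun x => (κ * (f x + V)) ^ 2) hi]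
  simp only [he]
  refine (integral_mono hi' hdom hle).trans ?_
  rw [integral_const_mul, integral_add (hfi.const_mul 2) (hqi.const_mul _), integral_const_mul,
    integral_const_mul, hq1]
  have : 0 ≤ κ ^ 2 * h := by positivity
  gcongr
  linarith

end Centred

/-! ### Marginal and conditional densities at a fixed covariate value -/

section Nonneg

variable {W A Z M : Type*} [MeasurableSpace Z] [MeasurableSpace M] {νZ : Measure Z}
  {νM : Measure M} {νY : Measure ℝ} {p : W × A × Z × M × ℝ → ℝ}

lemma densWAZ_nonneg (h0 : ∀ o, 0 ≤ p o) (w : W) (a : A) (z : Z) :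
    0 ≤ densWAZ νM νY p w a z :=
  integral_nonneg fun _ => integral_nonneg fun _ => h0 _

lemma densWAM_nonneg (h0 : ∀ o, 0 ≤ p o) (w : W) (a : A) (m : M) :
    0 ≤ densWAM νZ νY p w a m :=
  integral_nonneg fun _ => integral_nonneg fun _ => h0 _

lemma densWA_nonneg (h0 : ∀ o, 0 ≤ p o) (w : W) (a : A) :
    0 ≤ densWA νZ νM νY p w a :=
  integral_nonneg fun _ => densWAZ_nonneg h0 _ _ _

lemma densW_nonneg [Fintype A] (h0 : ∀ o, 0 ≤ p o) (w : W) :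
    0 ≤ densW νZ νM νY p w :=
  Finset.sum_nonneg fun _ _ => densWA_nonneg h0 _ _

lemma densWA_le_densW [Fintype A] (h0 : ∀ o, 0 ≤ p o) (w : W) (a : A) :
    densWA νZ νM νY p w a ≤ densW νZ νM νY p w :=
  Finset.single_le_sum (f := fun a => densWA νZ νM νY p w a)
    (fun _ _ => densWA_nonneg h0 _ _) (Finset.mem_univ a)

lemma q_nonneg (h0 : ∀ o, 0 ≤ p o) (w : W) (a : A) (z : Z) :
    0 ≤ q νZ νM νY p z a w :=
  div_nonneg (densWAZ_nonneg h0 _ _ _) (densWA_nonneg h0 _ _)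

lemma pM_nonneg (h0 : ∀ o, 0 ≤ p o) (w : W) (a : A) (m : M) :
    0 ≤ pM νZ νM νY p m a w :=
  div_nonneg (densWAM_nonneg h0 _ _ _) (densWA_nonneg h0 _ _)

end Nonneg

section Fiber

variable {W A Z M : Type*} [MeasurableSpace W] [MeasurableSpace A] [MeasurableSpace Z]
  [MeasurableSpace M] {νZ : Measure Z} {νM : Measure M} {νY : Measure ℝ}
  [SigmaFinite νZ] [SigmaFinite νM] {p : W × A × Z × M × ℝ → ℝ}

/-- The joint density of `(Z, M)` and treatment is integrable at the covariate value `w`. -/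
def FiberIntegrable (νZ : Measure Z) (νM : Measure M) (νY : Measure ℝ)
    (p : W × A × Z × M × ℝ → ℝ) (w : W) : Prop :=
  ∀ a, Integrable (fun x : Z × M => densWAZM νY p w a x.1 x.2) (νZ.prod νM)

namespace FiberIntegrable

variable {w : W}

lemma densWAZ (h : FiberIntegrable νZ νM νY p w) (a : A) :
    Integrable (fun z => MedEIF.densWAZ νM νY p w a z) νZ :=
  (h a).integral_prod_left

lemma densWAM (h : FiberIntegrable νZ νM νY p w) (a : A) :
    Integrable (fun m => MedEIF.densWAM νZ νY p w a m) νM :=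
  (h a).integral_prod_right

/-- Integrating the mediator out of `(W, A, M)` gives the same marginal as integrating `Z` out of
`(W, A, Z)`. -/
lemma integral_densWAM (h : FiberIntegrable νZ νM νY p w) (a : A) :
    ∫ m, MedEIF.densWAM νZ νY p w a m ∂νM = densWA νZ νM νY p w a :=
  (integral_integral_swap (f := fun z m => densWAZM νY p w a z m) (h a)).symm

lemma q (h : FiberIntegrable νZ νM νY p w) (a : A) :
    Integrable (fun z => MedEIF.q νZ νM νY p z a w) νZ :=
  (h.densWAZ a).div_const _

lemma pM (h : FiberIntegrable νZ νM νY p w) (a : A) :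
    Integrable (fun m => MedEIF.pM νZ νM νY p m a w) νM :=
  (h.densWAM a).div_const _

lemma integral_q {a : A} (h1 : densWA νZ νM νY p w a ≠ 0) :
    ∫ z, MedEIF.q νZ νM νY p z a w ∂νZ = 1 := by
  unfold MedEIF.q
  rw [integral_div]
  exact div_self h1

lemma integral_pM (h : FiberIntegrable νZ νM νY p w) {a : A} (h1 : densWA νZ νM νY p w a ≠ 0) :
    ∫ m, MedEIF.pM νZ νM νY p m a w ∂νM = 1 := by
  unfold MedEIF.pM
  rw [integral_div, h.integral_densWAM]
  exact div_self h1

lemma q_mul_pM (h : FiberIntegrable νZ νM νY p w) (a a₂ : A) :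
    Integrable (fun x : Z × M => MedEIF.q νZ νM νY p x.1 a w * MedEIF.pM νZ νM νY p x.2 a₂ w)
      (νZ.prod νM) :=
  (h.q a).mul_prod (h.pM a₂)

end FiberIntegrable

/-- Along the sequence `P`, the joint densities of `(Z, M)` and treatment at the covariate value
`w` are integrable, comparable with those of `p`, and convergent. -/
structure FiberApprox (νZ : Measure Z) (νM : Measure M) (νY : Measure ℝ) (C : ℝ)
    (p : W × A × Z × M × ℝ → ℝ) (P : ℕ → W × A × Z × M × ℝ → ℝ) (w : W) : Prop where
  base : FiberIntegrable νZ νM νY p w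
  seq : ∀ n, FiberIntegrable νZ νM νY (P n) w
  approx : ∀ a, ∀ᵐ x ∂νZ.prod νM, Approx C (densWAZM νY p w a x.1 x.2)
    fun n => densWAZM νY (P n) w a x.1 x.2

namespace FiberApprox

variable {C : ℝ} {P : ℕ → W × A × Z × M × ℝ → ℝ} {w : W}

lemma densWAZ (h : FiberApprox νZ νM νY C p P w) (a : A) :
    ∀ᵐ z ∂νZ, Approx C (densWAZ νM νY p w a z) fun n => MedEIF.densWAZ νM νY (P n) w a z := by
  filter_upwards [Measure.ae_ae_of_ae_prod (h.approx a), (h.base a).prod_right_ae,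
    ae_all_iff.2 fun n => (h.seq n a).prod_right_ae] with z h1 h2 h3
  exact Approx.integral h1 h2 h3

lemma densWAM (h : FiberApprox νZ νM νY C p P w) (a : A) :
    ∀ᵐ m ∂νM, Approx C (densWAM νZ νY p w a m) fun n => MedEIF.densWAM νZ νY (P n) w a m := by
  have h1 : ∀ᵐ x ∂νM.prod νZ, Approx C (densWAZM νY p w a x.2 x.1)
      fun n => densWAZM νY (P n) w a x.2 x.1 :=
    (Measure.measurePreserving_swap (μ := νM) (ν := νZ)).quasiMeasurePreserving.ae (h.approx a)
  filter_upwards [Measure.ae_ae_of_ae_prod h1, (h.base a).prod_left_ae,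
    ae_all_iff.2 fun n => (h.seq n a).prod_left_ae] with z h1 h2 h3
  exact Approx.integral h1 h2 h3

lemma densWA (h : FiberApprox νZ νM νY C p P w) (a : A) :
    Approx C (densWA νZ νM νY p w a) fun n => MedEIF.densWA νZ νM νY (P n) w a :=
  Approx.integral (h.densWAZ a) (h.base.densWAZ a) fun n => (h.seq n).densWAZ a

lemma densW [Fintype A] (h : FiberApprox νZ νM νY C p P w) :
    Approx C (densW νZ νM νY p w) fun n => MedEIF.densW νZ νM νY (P n) w :=
  Approx.sum _ fun a _ => h.densWA a

lemma q (h : FiberApprox νZ νM νY C p P w) (a : A) :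
    ∀ᵐ z ∂νZ, Approx (C * C) (q νZ νM νY p z a w) fun n => MedEIF.q νZ νM νY (P n) z a w :=
  (h.densWAZ a).mono fun _ hz => hz.div (h.densWA a)

lemma pM (h : FiberApprox νZ νM νY C p P w) (a : A) :
    ∀ᵐ m ∂νM, Approx (C * C) (pM νZ νM νY p m a w) fun n => MedEIF.pM νZ νM νY (P n) m a w :=
  (h.densWAM a).mono fun _ hm => hm.div (h.densWA a)

lemma ratio [Fintype A] (h : FiberApprox νZ νM νY C p P w) (a : A) :
    Approx (C * C) (MedEIF.densW νZ νM νY p w / MedEIF.densWA νZ νM νY p w a)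
      fun n => MedEIF.densW νZ νM νY (P n) w / MedEIF.densWA νZ νM νY (P n) w a :=
  h.densW.div (h.densWA a)

end FiberApprox

/-- Almost every covariate value is of this kind under the assumptions of the theorem: the joint
density is integrable, both treatments have positive probability where the covariate density is
positive, and the outcome regression has a second moment under `q(z ∣ a', w) p(m ∣ a⋆, w)`. -/
structure RegularFiber [Fintype A] (νZ : Measure Z) (νM : Measure M) (νY : Measure ℝ)
    (a' astar : A) (p : W × A × Z × M × ℝ → ℝ) (w : W) : Prop where
  int : FiberIntegrable νZ νM νY p w
  pos : 0 < densW νZ νM νY p w →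
    0 < densWA νZ νM νY p w a' ∧ 0 < densWA νZ νM νY p w astar
  sq : Integrable (fun x : Z × M => b νY p a' x.1 x.2 w ^ 2 *
    (q νZ νM νY p x.1 a' w * pM νZ νM νY p x.2 astar w)) (νZ.prod νM)

/-- The mean of `|b(a', Z, M, w)|` under `q(z ∣ a', w) p(m ∣ a⋆, w)`. -/
noncomputable def absMean (νZ : Measure Z) (νM : Measure M) (νY : Measure ℝ) (a' astar : A)
    (p : W × A × Z × M × ℝ → ℝ) (w : W) : ℝ :=
  ∫ x : Z × M, |b νY p a' x.1 x.2 w| * (q νZ νM νY p x.1 a' w * pM νZ νM νY p x.2 astar w)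
    ∂νZ.prod νM

/-- The mean of `|b(a', z, M, w)|` under `p(m ∣ a⋆, w)`. -/
noncomputable def absMeanM (νZ : Measure Z) (νM : Measure M) (νY : Measure ℝ) (a' astar : A)
    (p : W × A × Z × M × ℝ → ℝ) (w : W) (z : Z) : ℝ :=
  ∫ m, |b νY p a' z m w| * pM νZ νM νY p m astar w ∂νM

/-- The mean of `|b(a', Z, m, w)|` under `q(z ∣ a', w)`. -/
noncomputable def absMeanZ (νZ : Measure Z) (νM : Measure M) (νY : Measure ℝ) (a' : A)
    (p : W × A × Z × M × ℝ → ℝ) (w : W) (m : M) : ℝ :=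
  ∫ z, |b νY p a' z m w| * q νZ νM νY p z a' w ∂νZ

/-- The second moment of `b(a', Z, M, w)` under `q(z ∣ a', w) p(m ∣ a⋆, w)`. -/
noncomputable def sqMean (νZ : Measure Z) (νM : Measure M) (νY : Measure ℝ) (a' astar : A)
    (p : W × A × Z × M × ℝ → ℝ) (w : W) : ℝ :=
  ∫ x : Z × M, b νY p a' x.1 x.2 w ^ 2 * (q νZ νM νY p x.1 a' w * pM νZ νM νY p x.2 astar w)
    ∂νZ.prod νM

/-- The mean of the outcome regression `b(a', ·)` of `p` under `q(z ∣ a', w)` computed from `p₁` and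
`p(m ∣ a⋆, w)` computed from `p₂`. -/
noncomputable def mixMean (νZ : Measure Z) (νM : Measure M) (νY : Measure ℝ) (a' astar : A)
    (p p₁ p₂ : W × A × Z × M × ℝ → ℝ) (w : W) : ℝ :=
  ∫ x : Z × M, b νY p a' x.1 x.2 w * (q νZ νM νY p₁ x.1 a' w * pM νZ νM νY p₂ x.2 astar w)
    ∂νZ.prod νM

/-- The outcome regression `b(a', z, ·)` of `p` averaged over the mediator density of `pt`. -/
noncomputable def mixU (νZ : Measure Z) (νM : Measure M) (νY : Measure ℝ) (a' astar : A)
    (p pt : W × A × Z × M × ℝ → ℝ) (w : W) (z : Z) : ℝ :=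
  ∫ m, b νY p a' z m w * pM νZ νM νY pt m astar w ∂νM

variable {a' astar : A} {w : W}

lemma v_eq_mixMean : v νZ νM νY a' p astar w = mixMean νZ νM νY a' astar p p p w := by
  rw [mixMean, v, ← integral_prod_swap]
  refine integral_congr_ae (ae_of_all _ fun x => ?_)
  simp only [Prod.fst_swap, Prod.snd_swap]
  ring

variable [Fintype A] [SigmaFinite νY]

namespace RegularFiber

lemma abs_int (h : RegularFiber νZ νM νY a' astar p w) (hp : Measurable p) (h0 : ∀ o, 0 ≤ p o) :
    Integrable (fun x : Z × M => |b νY p a' x.1 x.2 w| *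
      (q νZ νM νY p x.1 a' w * pM νZ νM νY p x.2 astar w)) (νZ.prod νM) :=
  integrable_abs_mul_of_sq (measurable_b hp a' measurable_fst measurable_snd measurable_const)
    (fun _ => mul_nonneg (q_nonneg h0 _ _ _) (pM_nonneg h0 _ _ _)) (h.int.q_mul_pM _ _) h.sq

lemma sqMean_nonneg (h0 : ∀ o, 0 ≤ p o) : 0 ≤ sqMean νZ νM νY a' astar p w :=
  integral_nonneg fun _ => mul_nonneg (sq_nonneg _)
    (mul_nonneg (q_nonneg h0 _ _ _) (pM_nonneg h0 _ _ _))

lemma densW_eq_zero (h : RegularFiber νZ νM νY a' astar p w) (h0 : ∀ o, 0 ≤ p o)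
    (h1 : densWA νZ νM νY p w a' = 0 ∨ densWA νZ νM νY p w astar = 0) :
    densW νZ νM νY p w = 0 := by
  by_contra h2
  have h3 := h.pos ((densW_nonneg h0 w).lt_of_ne' h2)
  rcases h1 with h1 | h1
  · exact h3.1.ne' h1
  · exact h3.2.ne' h1

lemma densWA_eq_zero (h0 : ∀ o, 0 ≤ p o) (h1 : densW νZ νM νY p w = 0) (a : A) :
    densWA νZ νM νY p w a = 0 :=
  le_antisymm (h1 ▸ densWA_le_densW h0 w a) (densWA_nonneg h0 w a)

lemma absMean_sq_le (h : RegularFiber νZ νM νY a' astar p w) (hp : Measurable p)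
    (h0 : ∀ o, 0 ≤ p o) : absMean νZ νM νY a' astar p w ^ 2 ≤ sqMean νZ νM νY a' astar p w := by
  by_cases h1 : densW νZ νM νY p w = 0
  · have : absMean νZ νM νY a' astar p w = 0 := by
      simp [absMean, q, densWA_eq_zero h0 h1]
    rw [this]
    simpa using sqMean_nonneg h0
  · have h2 := h.pos ((densW_nonneg h0 w).lt_of_ne' h1)
    refine sq_integral_abs_mul_le
      (measurable_b hp a' measurable_fst measurable_snd measurable_const)
      (fun _ => mul_nonneg (q_nonneg h0 _ _ _) (pM_nonneg h0 _ _ _)) (h.int.q_mul_pM _ _) ?_ h.sq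
    rw [integral_prod_mul (fun z => q νZ νM νY p z a' w) (fun m => pM νZ νM νY p m astar w),
      FiberIntegrable.integral_q h2.1.ne', h.int.integral_pM h2.2.ne', mul_one]

lemma condMeanM_sq (h : RegularFiber νZ νM νY a' astar p w) (hp : Measurable p)
    (h0 : ∀ o, 0 ≤ p o) (h1 : densWA νZ νM νY p w astar ≠ 0) :
    Integrable (fun z => absMeanM νZ νM νY a' astar p w z ^ 2 * q νZ νM νY p z a' w) νZ ∧
      ∫ z, absMeanM νZ νM νY a' astar p w z ^ 2 * q νZ νM νY p z a' w ∂νZ ≤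
        sqMean νZ νM νY a' astar p w :=
  integral_sq_condMean_le (f := fun x : Z × M => b νY p a' x.1 x.2 w)
    (measurable_b hp a' measurable_fst measurable_snd measurable_const)
    (measurable_q hp measurable_id a' measurable_const) (fun _ => q_nonneg h0 _ _ _)
    (measurable_pM hp measurable_id astar measurable_const) (fun _ => pM_nonneg h0 _ _ _)
    (h.int.pM astar) (h.int.integral_pM h1) h.sq

lemma condMeanZ_sq (h : RegularFiber νZ νM νY a' astar p w) (hp : Measurable p)
    (h0 : ∀ o, 0 ≤ p o) (h1 : densWA νZ νM νY p w a' ≠ 0) :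
    Integrable (fun m => absMeanZ νZ νM νY a' p w m ^ 2 * pM νZ νM νY p m astar w) νM ∧
      ∫ m, absMeanZ νZ νM νY a' p w m ^ 2 * pM νZ νM νY p m astar w ∂νM ≤
        sqMean νZ νM νY a' astar p w := by
  have hsw : Integrable (fun x : M × Z => b νY p a' x.2 x.1 w ^ 2 *
      (pM νZ νM νY p x.1 astar w * q νZ νM νY p x.2 a' w)) (νM.prod νZ) := by
    refine h.sq.swap.congr (ae_of_all _ fun x => ?_)
    simp only [Function.comp, Prod.fst_swap, Prod.snd_swap]
    ring
  have h2 := integral_sq_condMean_le (f := fun x : M × Z => b νY p a' x.2 x.1 w)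
    (measurable_b hp a' measurable_snd measurable_fst measurable_const)
    (measurable_pM hp measurable_id astar measurable_const) (fun _ => pM_nonneg h0 _ _ _)
    (measurable_q hp measurable_id a' measurable_const) (fun _ => q_nonneg h0 _ _ _)
    (h.int.q a') (FiberIntegrable.integral_q h1) hsw
  refine ⟨h2.1, h2.2.trans_eq ?_⟩
  rw [sqMean, ← integral_prod_swap]
  refine integral_congr_ae (ae_of_all _ fun x => ?_)
  simp only [Prod.fst_swap, Prod.snd_swap, id]
  ring

/-- Second moment of the dominating function for the `Z`-part of the gradient. -/
lemma sq_boundZ (h : RegularFiber νZ νM νY a' astar p w) (hp : Measurable p)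
    (h0 : ∀ o, 0 ≤ p o) :
    Integrable (fun x : Z × M => (densW νZ νM νY p w / densWA νZ νM νY p w a' *
        (absMeanM νZ νM νY a' astar p w x.1 + absMean νZ νM νY a' astar p w)) ^ 2 *
        densWAZM νY p w a' x.1 x.2) (νZ.prod νM) ∧
      ∫ x : Z × M, (densW νZ νM νY p w / densWA νZ νM νY p w a' *
        (absMeanM νZ νM νY a' astar p w x.1 + absMean νZ νM νY a' astar p w)) ^ 2 *
        densWAZM νY p w a' x.1 x.2 ∂νZ.prod νM ≤
      4 * (densW νZ νM νY p w / densWA νZ νM νY p w a' * densW νZ νM νY p w *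
        sqMean νZ νM νY a' astar p w) := by
  by_cases h1 : densW νZ νM νY p w = 0
  · simp [h1]
  have h2 := h.pos ((densW_nonneg h0 w).lt_of_ne' h1)
  have h3 := h.condMeanM_sq hp h0 h2.2.ne'
  have h4 := integral_sq_scaled_le (κ := densW νZ νM νY p w / densWA νZ νM νY p w a')
    (f := absMeanM νZ νM νY a' astar p w) (h.int a')
    (fun x => integral_nonneg fun _ => h0 _) (e := fun z => densWAZ νM νY p w a' z)
    (fun _ => rfl) (h := densWA νZ νM νY p w a') rfl (fun h5 => by rw [h5, div_zero])
    (measurable_integral_right ((measurable_b hp a' measurable_fst measurable_snd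
      measurable_const).norm.mul (measurable_pM hp measurable_snd astar measurable_const)))
    h3.1 h3.2 (h.absMean_sq_le hp h0)
  refine ⟨h4.1, h4.2.trans_eq ?_⟩
  have := h2.1.ne'
  field_simp

/-- Second moment of the dominating function for the `M`-part of the gradient. -/
lemma sq_boundM (h : RegularFiber νZ νM νY a' astar p w) (hp : Measurable p)
    (h0 : ∀ o, 0 ≤ p o) :
    Integrable (fun x : Z × M => (densW νZ νM νY p w / densWA νZ νM νY p w astar *
        (absMeanZ νZ νM νY a' p w x.2 + absMean νZ νM νY a' astar p w)) ^ 2 *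
        densWAZM νY p w astar x.1 x.2) (νZ.prod νM) ∧
      ∫ x : Z × M, (densW νZ νM νY p w / densWA νZ νM νY p w astar *
        (absMeanZ νZ νM νY a' p w x.2 + absMean νZ νM νY a' astar p w)) ^ 2 *
        densWAZM νY p w astar x.1 x.2 ∂νZ.prod νM ≤
      4 * (densW νZ νM νY p w / densWA νZ νM νY p w astar * densW νZ νM νY p w *
        sqMean νZ νM νY a' astar p w) := by
  by_cases h1 : densW νZ νM νY p w = 0
  · simp [h1]
  have h2 := h.pos ((densW_nonneg h0 w).lt_of_ne' h1)
  have h3 := h.condMeanZ_sq hp h0 h2.1.ne'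
  have h4 := integral_sq_scaled_le (κ := densW νZ νM νY p w / densWA νZ νM νY p w astar)
    (f := absMeanZ νZ νM νY a' p w) (h.int astar).swap
    (fun x => integral_nonneg fun _ => h0 _) (e := fun m => densWAM νZ νY p w astar m)
    (fun _ => rfl) (h := densWA νZ νM νY p w astar) (h.int.integral_densWAM astar)
    (fun h5 => by rw [h5, div_zero])
    (measurable_integral_right ((measurable_b hp a' measurable_snd measurable_fst
      measurable_const).norm.mul (measurable_q hp measurable_snd a' measurable_const)))
    h3.1 h3.2 (h.absMean_sq_le hp h0)
  refine ⟨h4.1.swap, ?_⟩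
  rw [← integral_prod_swap]
  refine h4.2.trans_eq ?_
  have := h2.2.ne'
  field_simp

/-- Second moment of the dominating function for the remaining part of the gradient. -/
lemma sq_absMean (h : RegularFiber νZ νM νY a' astar p w) (hp : Measurable p)
    (h0 : ∀ o, 0 ≤ p o) (a : A) :
    Integrable (fun x : Z × M => absMean νZ νM νY a' astar p w ^ 2 *
        densWAZM νY p w a x.1 x.2) (νZ.prod νM) ∧
      ∫ x : Z × M, absMean νZ νM νY a' astar p w ^ 2 * densWAZM νY p w a x.1 x.2 ∂νZ.prod νM ≤
      densW νZ νM νY p w / densWA νZ νM νY p w a' * densW νZ νM νY p w *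
        sqMean νZ νM νY a' astar p w := by
  refine ⟨(h.int a).const_mul _, ?_⟩
  have hd : ∫ x : Z × M, densWAZM νY p w a x.1 x.2 ∂νZ.prod νM = densWA νZ νM νY p w a :=
    integral_prod _ (h.int a)
  rw [integral_const_mul, hd]
  by_cases h1 : densW νZ νM νY p w = 0
  · simp [h1, densWA_eq_zero h0 h1]
  have h2 := h.pos ((densW_nonneg h0 w).lt_of_ne' h1)
  have h3 : 1 ≤ densW νZ νM νY p w / densWA νZ νM νY p w a' := by
    rw [one_le_div h2.1]; exact densWA_le_densW h0 w a'
  calc _ ≤ sqMean νZ νM νY a' astar p w * densW νZ νM νY p w :=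
        mul_le_mul (h.absMean_sq_le hp h0) (densWA_le_densW h0 w a) (densWA_nonneg h0 _ _)
          (sqMean_nonneg h0)
    _ ≤ densW νZ νM νY p w / densWA νZ νM νY p w a' *
        (sqMean νZ νM νY a' astar p w * densW νZ νM νY p w) :=
        le_mul_of_one_le_left (mul_nonneg (sqMean_nonneg h0) (densW_nonneg h0 _)) h3
    _ = _ := by ring

end RegularFiber

end Fiber

/-! ### The gradient with perturbed weights at a fixed covariate value -/

section Steps

variable {W A Z M : Type*} [MeasurableSpace W] [MeasurableSpace A] [MeasurableSpace Z]
  [MeasurableSpace M] [Fintype A] {νZ : Measure Z} {νM : Measure M} {νY : Measure ℝ}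
  [SigmaFinite νZ] [SigmaFinite νM] [SigmaFinite νY] {p : W × A × Z × M × ℝ → ℝ}

/-- The `Z`-part of the gradient, without its treatment indicator: the outcome regression, the
density of `Z` and the centring come from `p`, the mediator density and the treatment weight from
`pt`. -/
noncomputable def stepZ (νZ : Measure Z) (νM : Measure M) (νY : Measure ℝ) (a' astar : A)
    (p pt : W × A × Z × M × ℝ → ℝ) (w : W) (z : Z) : ℝ :=
  densW νZ νM νY pt w / densWA νZ νM νY pt w a' *
    (mixU νZ νM νY a' astar p pt w z -
      ∫ z', mixU νZ νM νY a' astar p pt w z' * q νZ νM νY p z' a' w ∂νZ)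

/-- The `M`-part of the gradient, without its treatment indicator: only the treatment weight comes
from `pt`. -/
noncomputable def stepM (νZ : Measure Z) (νM : Measure M) (νY : Measure ℝ) (a' astar : A)
    (p pt : W × A × Z × M × ℝ → ℝ) (w : W) (m : M) : ℝ :=
  densW νZ νM νY pt w / densWA νZ νM νY pt w astar *
    ((∫ z', b νY p a' z' m w * q νZ νM νY p z' a' w ∂νZ) - v νZ νM νY a' p astar w)

/-- Dominates the `Z`-part of the gradient up to a constant. -/
noncomputable def boundZ (νZ : Measure Z) (νM : Measure M) (νY : Measure ℝ) (a' astar : A)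
    (p : W × A × Z × M × ℝ → ℝ) (w : W) (z : Z) : ℝ :=
  densW νZ νM νY p w / densWA νZ νM νY p w a' *
    (absMeanM νZ νM νY a' astar p w z + absMean νZ νM νY a' astar p w)

/-- Dominates the `M`-part of the gradient up to a constant. -/
noncomputable def boundM (νZ : Measure Z) (νM : Measure M) (νY : Measure ℝ) (a' astar : A)
    (p : W × A × Z × M × ℝ → ℝ) (w : W) (m : M) : ℝ :=
  densW νZ νM νY p w / densWA νZ νM νY p w astar *
    (absMeanZ νZ νM νY a' p w m + absMean νZ νM νY a' astar p w)

variable {C : ℝ} {P : ℕ → W × A × Z × M × ℝ → ℝ} {a' astar : A} {w : W}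

lemma FiberApprox.ae_q_pM (h : FiberApprox νZ νM νY C p P w) (a a₂ : A) :
    ∀ᵐ x ∂νZ.prod νM,
      Approx (C * C) (MedEIF.q νZ νM νY p x.1 a w)
        (fun n => MedEIF.q νZ νM νY (P n) x.1 a w) ∧
      Approx (C * C) (MedEIF.pM νZ νM νY p x.2 a₂ w)
        (fun n => MedEIF.pM νZ νM νY (P n) x.2 a₂ w) := by
  filter_upwards [Measure.quasiMeasurePreserving_fst.ae (h.q a),
    Measure.quasiMeasurePreserving_snd.ae (h.pM a₂)] with x h1 h2 using ⟨h1, h2⟩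

/-- Only the mediator density is perturbed. -/
lemma integrable_mixMean₁ (h : FiberApprox νZ νM νY C p P w)
    (hr : RegularFiber νZ νM νY a' astar p w) (hp : Measurable p) (h0 : ∀ o, 0 ≤ p o)
    (hP : ∀ n, Measurable (P n)) (n : ℕ) :
    Integrable (fun x : Z × M => b νY p a' x.1 x.2 w *
      (q νZ νM νY p x.1 a' w * pM νZ νM νY (P n) x.2 astar w)) (νZ.prod νM) := by
  refine ((hr.abs_int hp h0).const_mul (C * C)).mono' ?_ ?_
  · exact ((measurable_b hp a' measurable_fst measurable_snd measurable_const).mul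
      ((measurable_q hp measurable_fst a' measurable_const).mul
        (measurable_pM (hP n) measurable_snd astar measurable_const))).aestronglyMeasurable
  · filter_upwards [h.ae_q_pM a' astar] with x hx
    rw [norm_mul, Real.norm_of_nonneg (mul_nonneg hx.1.nonneg (hx.2.nonneg_seq n)),
      Real.norm_eq_abs]
    calc _ ≤ |b νY p a' x.1 x.2 w| *
          (q νZ νM νY p x.1 a' w * (C * C * pM νZ νM νY p x.2 astar w)) := by
          have := hx.1.nonneg
          have := hx.2.seq_le n
          gcongr
      _ = _ := by ring

/-- The densities of `Z` and of the mediator are both perturbed. -/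
lemma integrable_mixMean₂ (h : FiberApprox νZ νM νY C p P w)
    (hr : RegularFiber νZ νM νY a' astar p w) (hp : Measurable p) (h0 : ∀ o, 0 ≤ p o)
    (hP : ∀ n, Measurable (P n)) (n : ℕ) :
    Integrable (fun x : Z × M => b νY p a' x.1 x.2 w *
      (q νZ νM νY (P n) x.1 a' w * pM νZ νM νY (P n) x.2 astar w)) (νZ.prod νM) := by
  refine ((hr.abs_int hp h0).const_mul (C * C * (C * C))).mono' ?_ ?_
  · exact ((measurable_b hp a' measurable_fst measurable_snd measurable_const).mul
      ((measurable_q (hP n) measurable_fst a' measurable_const).mul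
        (measurable_pM (hP n) measurable_snd astar measurable_const))).aestronglyMeasurable
  · filter_upwards [h.ae_q_pM a' astar] with x hx
    have h1 := hx.1.mul hx.2
    rw [norm_mul, Real.norm_of_nonneg (h1.nonneg_seq n), Real.norm_eq_abs]
    calc _ ≤ |b νY p a' x.1 x.2 w| * (C * C * (C * C) *
          (q νZ νM νY p x.1 a' w * pM νZ νM νY p x.2 astar w)) := by
          have := h1.seq_le n
          gcongr
      _ = _ := by ring

lemma integrable_mixMean₀ (hr : RegularFiber νZ νM νY a' astar p w) (hp : Measurable p)
    (h0 : ∀ o, 0 ≤ p o) :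
    Integrable (fun x : Z × M => b νY p a' x.1 x.2 w *
      (q νZ νM νY p x.1 a' w * pM νZ νM νY p x.2 astar w)) (νZ.prod νM) := by
  refine (hr.abs_int hp h0).mono' ?_ (ae_of_all _ fun x => ?_)
  · exact ((measurable_b hp a' measurable_fst measurable_snd measurable_const).mul
      ((measurable_q hp measurable_fst a' measurable_const).mul
        (measurable_pM hp measurable_snd astar measurable_const))).aestronglyMeasurable
  · rw [norm_mul, Real.norm_of_nonneg (mul_nonneg (q_nonneg h0 _ _ _) (pM_nonneg h0 _ _ _)),
      Real.norm_eq_abs]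

/-- Averaging `mixU` over a conditional density of `Z` is a mean over `(Z, M)`. -/
lemma integral_mixU_mul (p₁ pt : W × A × Z × M × ℝ → ℝ)
    (hi : Integrable (fun x : Z × M => b νY p a' x.1 x.2 w *
      (q νZ νM νY p₁ x.1 a' w * pM νZ νM νY pt x.2 astar w)) (νZ.prod νM)) :
    Integrable (fun z => mixU νZ νM νY a' astar p pt w z * q νZ νM νY p₁ z a' w) νZ ∧
      ∫ z, mixU νZ νM νY a' astar p pt w z * q νZ νM νY p₁ z a' w ∂νZ =
        mixMean νZ νM νY a' astar p p₁ pt w := by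
  have e : ∀ z, ∫ m, b νY p a' z m w *
      (q νZ νM νY p₁ z a' w * pM νZ νM νY pt m astar w) ∂νM =
      mixU νZ νM νY a' astar p pt w z * q νZ νM νY p₁ z a' w := fun z => by
    rw [mixU, ← integral_mul_const]
    congr 1; ext m; ring
  refine ⟨hi.integral_prod_left.congr (ae_of_all _ e), ?_⟩
  rw [mixMean, integral_prod _ hi]
  exact integral_congr_ae (ae_of_all _ fun z => (e z).symm)

/-- Averaging the `q`-mean of `b` over a conditional density of `M` is a mean over `(Z, M)`. -/
lemma integral_bq_mul (pt : W × A × Z × M × ℝ → ℝ)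
    (hi : Integrable (fun x : Z × M => b νY p a' x.1 x.2 w *
      (q νZ νM νY p x.1 a' w * pM νZ νM νY pt x.2 astar w)) (νZ.prod νM)) :
    Integrable (fun m => (∫ z, b νY p a' z m w * q νZ νM νY p z a' w ∂νZ) *
        pM νZ νM νY pt m astar w) νM ∧
      ∫ m, (∫ z, b νY p a' z m w * q νZ νM νY p z a' w ∂νZ) *
        pM νZ νM νY pt m astar w ∂νM = mixMean νZ νM νY a' astar p p pt w := by
  have e : ∀ m, ∫ z, b νY p a' z m w *
      (q νZ νM νY p z a' w * pM νZ νM νY pt m astar w) ∂νZ =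
      (∫ z, b νY p a' z m w * q νZ νM νY p z a' w ∂νZ) * pM νZ νM νY pt m astar w := fun z => by
    rw [← integral_mul_const]
    congr 1; ext m; ring
  refine ⟨hi.integral_prod_right.congr (ae_of_all _ e), ?_⟩
  rw [mixMean, integral_prod_symm _ hi]
  exact integral_congr_ae (ae_of_all _ fun z => (e z).symm)

lemma measurable_mixU {T : Type*} [MeasurableSpace T] (hp : Measurable p)
    {pt : W × A × Z × M × ℝ → ℝ} (hpt : Measurable pt) {w : T → W} {z : T → Z}
    (hw : Measurable w) (hz : Measurable z) :
    Measurable fun t => mixU νZ νM νY a' astar p pt (w t) (z t) :=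
  measurable_integral_right ((measurable_b hp a' (by fun_prop) (by fun_prop) (by fun_prop)).mul
    (measurable_pM hpt (by fun_prop) astar (by fun_prop)))

lemma measurable_bq {T : Type*} [MeasurableSpace T] (hp : Measurable p) {w : T → W} {m : T → M}
    (hw : Measurable w) (hm : Measurable m) :
    Measurable fun t => ∫ z, b νY p a' z (m t) (w t) * q νZ νM νY p z a' (w t) ∂νZ :=
  measurable_integral_right ((measurable_b hp a' (by fun_prop) (by fun_prop) (by fun_prop)).mul
    (measurable_q hp (by fun_prop) a' (by fun_prop)))

lemma FiberApprox.densWA_seq_eq_zero (h : FiberApprox νZ νM νY C p P w)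
    (hr : RegularFiber νZ νM νY a' astar p w) (h0 : ∀ o, 0 ≤ p o) {a : A} (ha : a = a' ∨ a = astar)
    {n : ℕ} (hn : MedEIF.densWA νZ νM νY (P n) w a = 0) : MedEIF.densW νZ νM νY (P n) w = 0 := by
  refine h.densW.eq_zero (hr.densW_eq_zero h0 ?_) n
  have h1 : MedEIF.densWA νZ νM νY p w a = 0 := by
    by_contra h2
    exact ((h.densWA a).pos ((h.densWA a).nonneg.lt_of_ne' h2) n).ne' hn
  rcases ha with rfl | rfl
  exacts [Or.inl h1, Or.inr h1]

section Integrals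

variable (h : FiberApprox νZ νM νY C p P w) (hr : RegularFiber νZ νM νY a' astar p w)
  (hp : Measurable p) (h0 : ∀ o, 0 ≤ p o) (hP : ∀ n, Measurable (P n))
  (hP0 : ∀ n o, 0 ≤ P n o)
include h hr hp h0 hP hP0

/-- Under `P n`, the `Z`-part accounts for replacing the density of `Z`. -/
lemma integral_stepZ_mul_seq (n : ℕ) :
    Integrable (fun x : Z × M => stepZ νZ νM νY a' astar p (P n) w x.1 *
        densWAZM νY (P n) w a' x.1 x.2) (νZ.prod νM) ∧
      ∫ x : Z × M, stepZ νZ νM νY a' astar p (P n) w x.1 *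
        densWAZM νY (P n) w a' x.1 x.2 ∂νZ.prod νM =
      densW νZ νM νY (P n) w * (mixMean νZ νM νY a' astar p (P n) (P n) w -
        mixMean νZ νM νY a' astar p p (P n) w) := by
  have h1 := integral_mixU_mul _ _ (integrable_mixMean₂ h hr hp h0 hP n)
  have h2 := integral_mixU_mul _ _ (integrable_mixMean₁ h hr hp h0 hP n)
  have h3 := integral_recentred
    (κ := densW νZ νM νY (P n) w / densWA νZ νM νY (P n) w a')
    (h := densWA νZ νM νY (P n) w a') ((h.seq n) a')
    (fun x => integral_nonneg fun _ => hP0 n _) (e := fun z => densWAZ νM νY (P n) w a' z)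
    (fun _ => rfl) rfl (fun h5 => by rw [h5, div_zero])
    (measurable_mixU hp (hP n) measurable_const measurable_id) h1.1
    (mixMean νZ νM νY a' astar p p (P n) w)
  simp only [stepZ, h2.2]
  refine ⟨h3.1, h3.2.trans ?_⟩
  change _ * (∫ z, mixU νZ νM νY a' astar p (P n) w z * q νZ νM νY (P n) z a' w ∂νZ - _) = _
  rw [h1.2, div_mul_cancel_of_imp fun h5 => h.densWA_seq_eq_zero hr h0 (Or.inl rfl) h5]

/-- Under `p`, the `Z`-part is centred. -/
lemma integral_stepZ_mul_base (n : ℕ) :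
    Integrable (fun x : Z × M => stepZ νZ νM νY a' astar p (P n) w x.1 *
        densWAZM νY p w a' x.1 x.2) (νZ.prod νM) ∧
      ∫ x : Z × M, stepZ νZ νM νY a' astar p (P n) w x.1 *
        densWAZM νY p w a' x.1 x.2 ∂νZ.prod νM = 0 := by
  have h2 := integral_mixU_mul _ _ (integrable_mixMean₁ h hr hp h0 hP n)
  have h3 := integral_recentred
    (κ := densW νZ νM νY (P n) w / densWA νZ νM νY (P n) w a')
    (h := densWA νZ νM νY p w a') (h.base a')
    (fun x => integral_nonneg fun _ => h0 _) (e := fun z => densWAZ νM νY p w a' z)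
    (fun _ => rfl) rfl (fun h5 => by rw [(h.densWA a').eq_zero h5, div_zero])
    (measurable_mixU hp (hP n) measurable_const measurable_id) h2.1
    (mixMean νZ νM νY a' astar p p (P n) w)
  simp only [stepZ, h2.2]
  refine ⟨h3.1, h3.2.trans ?_⟩
  change _ * (∫ z, mixU νZ νM νY a' astar p (P n) w z * q νZ νM νY p z a' w ∂νZ - _) = _
  rw [h2.2, sub_self, mul_zero]

/-- Under `P n`, the `M`-part accounts for replacing the mediator density. -/
lemma integral_stepM_mul_seq (n : ℕ) :
    Integrable (fun x : Z × M => stepM νZ νM νY a' astar p (P n) w x.2 *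
        densWAZM νY (P n) w astar x.1 x.2) (νZ.prod νM) ∧
      ∫ x : Z × M, stepM νZ νM νY a' astar p (P n) w x.2 *
        densWAZM νY (P n) w astar x.1 x.2 ∂νZ.prod νM =
      densW νZ νM νY (P n) w * (mixMean νZ νM νY a' astar p p (P n) w -
        mixMean νZ νM νY a' astar p p p w) := by
  have h1 := integral_bq_mul _ (integrable_mixMean₁ h hr hp h0 hP n)
  have h3 := integral_recentred
    (κ := densW νZ νM νY (P n) w / densWA νZ νM νY (P n) w astar)
    (h := densWA νZ νM νY (P n) w astar) ((h.seq n) astar).swap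
    (fun x => integral_nonneg fun _ => hP0 n _) (e := fun m => densWAM νZ νY (P n) w astar m)
    (fun _ => rfl) ((h.seq n).integral_densWAM astar) (fun h5 => by rw [h5, div_zero])
    (measurable_bq hp measurable_const measurable_id) h1.1
    (mixMean νZ νM νY a' astar p p p w)
  simp only [stepM, v_eq_mixMean]
  refine ⟨h3.1.swap, ?_⟩
  rw [← integral_prod_swap]
  refine h3.2.trans ?_
  change _ * (∫ m, (∫ z, b νY p a' z m w * q νZ νM νY p z a' w ∂νZ) *
    pM νZ νM νY (P n) m astar w ∂νM - _) = _
  rw [h1.2, div_mul_cancel_of_imp fun h5 => h.densWA_seq_eq_zero hr h0 (Or.inr rfl) h5]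

/-- Under `p`, the `M`-part is centred. -/
lemma integral_stepM_mul_base (n : ℕ) :
    Integrable (fun x : Z × M => stepM νZ νM νY a' astar p (P n) w x.2 *
        densWAZM νY p w astar x.1 x.2) (νZ.prod νM) ∧
      ∫ x : Z × M, stepM νZ νM νY a' astar p (P n) w x.2 *
        densWAZM νY p w astar x.1 x.2 ∂νZ.prod νM = 0 := by
  have h1 := integral_bq_mul _ (integrable_mixMean₀ hr hp h0)
  have h3 := integral_recentred
    (κ := densW νZ νM νY (P n) w / densWA νZ νM νY (P n) w astar)
    (h := densWA νZ νM νY p w astar) (h.base astar).swap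
    (fun x => integral_nonneg fun _ => h0 _) (e := fun m => densWAM νZ νY p w astar m)
    (fun _ => rfl) (h.base.integral_densWAM astar)
    (fun h5 => by rw [(h.densWA astar).eq_zero h5, div_zero])
    (measurable_bq hp measurable_const measurable_id) h1.1
    (mixMean νZ νM νY a' astar p p p w)
  simp only [stepM, v_eq_mixMean]
  refine ⟨h3.1.swap, ?_⟩
  rw [← integral_prod_swap]
  refine h3.2.trans ?_
  change _ * (∫ m, (∫ z, b νY p a' z m w * q νZ νM νY p z a' w ∂νZ) *
    pM νZ νM νY p m astar w ∂νM - _) = _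
  rw [h1.2, sub_self, mul_zero]

end Integrals

/-- On the fiber over `w`, the `Z`-parts are dominated and converge wherever the joint density is
positive. -/
lemma ae_stepZ (h : FiberApprox νZ νM νY C p P w) (hr : RegularFiber νZ νM νY a' astar p w)
    (hp : Measurable p) (h0 : ∀ o, 0 ≤ p o) (hP : ∀ n, Measurable (P n)) :
    ∀ᵐ x ∂νZ.prod νM, 0 < densWAZM νY p w a' x.1 x.2 →
      (∀ n, |stepZ νZ νM νY a' astar p (P n) w x.1| ≤
        C ^ 4 * boundZ νZ νM νY a' astar p w x.1) ∧
      Tendsto (fun n => stepZ νZ νM νY a' astar p (P n) w x.1) atTop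
        (𝓝 (stepZ νZ νM νY a' astar p p w x.1)) := by
  have hκ := h.ratio a'
  -- with zero treatment density all weights are quotients by zero, and every term vanishes
  by_cases h1 : densWA νZ νM νY p w a' = 0
  · have h2 : ∀ n, densWA νZ νM νY (P n) w a' = 0 := (h.densWA a').eq_zero h1
    refine ae_of_all _ fun x _ => ?_
    simp [stepZ, boundZ, h1, h2]
  have hhpos : 0 < densWA νZ νM νY p w a' := (densWA_nonneg h0 _ _).lt_of_ne' h1
  -- the centring converges
  have hcb : ∀ n, |mixMean νZ νM νY a' astar p p (P n) w| ≤
      C * C * absMean νZ νM νY a' astar p w := fun n => by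
    refine abs_integral_le_integral_abs.trans ?_
    rw [absMean, ← integral_const_mul]
    refine integral_mono_ae (integrable_mixMean₁ h hr hp h0 hP n).abs
      ((hr.abs_int hp h0).const_mul _) ?_
    filter_upwards [h.ae_q_pM a' astar] with x hx
    rw [abs_mul, abs_of_nonneg (mul_nonneg hx.1.nonneg (hx.2.nonneg_seq n))]
    calc _ ≤ |b νY p a' x.1 x.2 w| *
          (q νZ νM νY p x.1 a' w * (C * C * pM νZ νM νY p x.2 astar w)) := by
          have := hx.1.nonneg
          have := hx.2.seq_le n
          gcongr
      _ = _ := by ring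
  have hct : Tendsto (fun n => mixMean νZ νM νY a' astar p p (P n) w) atTop
      (𝓝 (mixMean νZ νM νY a' astar p p p w)) := by
    refine tendsto_integral_of_dominated_convergence _
      (fun n => (integrable_mixMean₁ h hr hp h0 hP n).1)
      ((hr.abs_int hp h0).const_mul (C * C)) (fun n => ?_) ?_
    · filter_upwards [h.ae_q_pM a' astar] with x hx
      rw [norm_mul, Real.norm_of_nonneg (mul_nonneg hx.1.nonneg (hx.2.nonneg_seq n)),
        Real.norm_eq_abs]
      calc _ ≤ |b νY p a' x.1 x.2 w| *
            (q νZ νM νY p x.1 a' w * (C * C * pM νZ νM νY p x.2 astar w)) := by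
            have := hx.1.nonneg
            have := hx.2.seq_le n
            gcongr
        _ = _ := by ring
    · filter_upwards [h.ae_q_pM a' astar] with x hx
      exact (hx.2.tendsto.const_mul _).const_mul _
  have hd := ae_marginal_pos ((measurable_densWAZM hp measurable_const a' measurable_fst
    measurable_snd)) (h.base a') (fun x => integral_nonneg fun _ => h0 _)
  have hz : ∀ᵐ z ∂νZ, Integrable (fun m => |b νY p a' z m w| *
      (q νZ νM νY p z a' w * pM νZ νM νY p m astar w)) νM := (hr.abs_int hp h0).prod_right_ae
  filter_upwards [hd, Measure.quasiMeasurePreserving_fst.ae hz] with x hx hint hpos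
  have hq : 0 < q νZ νM νY p x.1 a' w := div_pos (hx hpos) hhpos
  -- where `q > 0` it can be divided out of the joint integrability
  have hint' : Integrable (fun m => |b νY p a' x.1 m w| * pM νZ νM νY p m astar w) νM := by
    refine (hint.const_mul (q νZ νM νY p x.1 a' w)⁻¹).congr (ae_of_all _ fun m => ?_)
    have := hq.ne'
    field_simp
  have hle : ∀ n, ∀ᵐ m ∂νM, ‖b νY p a' x.1 m w * pM νZ νM νY (P n) m astar w‖ ≤
      C * C * (|b νY p a' x.1 m w| * pM νZ νM νY p m astar w) := fun n => by
    filter_upwards [h.pM astar] with m hm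
    rw [norm_mul, Real.norm_of_nonneg (hm.nonneg_seq n), Real.norm_eq_abs]
    calc _ ≤ |b νY p a' x.1 m w| * (C * C * pM νZ νM νY p m astar w) := by
          have := hm.seq_le n
          gcongr
      _ = _ := by ring
  have hmeas : ∀ n, AEStronglyMeasurable
      (fun m => b νY p a' x.1 m w * pM νZ νM νY (P n) m astar w) νM := fun n =>
    ((measurable_b hp a' measurable_const measurable_id measurable_const).mul
      (measurable_pM (hP n) measurable_id astar measurable_const)).aestronglyMeasurable
  have hUb : ∀ n, |mixU νZ νM νY a' astar p (P n) w x.1| ≤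
      C * C * absMeanM νZ νM νY a' astar p w x.1 := fun n => by
    rw [absMeanM, ← integral_const_mul]
    exact norm_integral_le_of_norm_le (hint'.const_mul _) (hle n)
  have hUt : Tendsto (fun n => mixU νZ νM νY a' astar p (P n) w x.1) atTop
      (𝓝 (mixU νZ νM νY a' astar p p w x.1)) := by
    refine tendsto_integral_of_dominated_convergence _ hmeas (hint'.const_mul _) hle ?_
    filter_upwards [h.pM astar] with m hm using hm.tendsto.const_mul _
  have h2 := fun n => (integral_mixU_mul _ _ (integrable_mixMean₁ h hr hp h0 hP n)).2
  have h3 := (integral_mixU_mul _ _ (integrable_mixMean₀ hr hp h0)).2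
  simp only [stepZ, h2, h3]
  refine ⟨fun n => ?_, hκ.tendsto.mul (hUt.sub hct)⟩
  rw [abs_mul, abs_of_nonneg (hκ.nonneg_seq n)]
  calc _ ≤ C * C * (densW νZ νM νY p w / densWA νZ νM νY p w a') *
        (C * C * absMeanM νZ νM νY a' astar p w x.1 + C * C * absMean νZ νM νY a' astar p w) :=
        mul_le_mul (hκ.seq_le n) ((abs_sub _ _).trans (add_le_add (hUb n) (hcb n)))
          (abs_nonneg _) ((hκ.nonneg_seq n).trans (hκ.seq_le n))
    _ = _ := by rw [boundZ]; ring

lemma abs_v_le (h0 : ∀ o, 0 ≤ p o) :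
    |v νZ νM νY a' p astar w| ≤ absMean νZ νM νY a' astar p w := by
  rw [v_eq_mixMean]
  refine abs_integral_le_integral_abs.trans_eq ?_
  refine integral_congr_ae (ae_of_all _ fun x => ?_)
  dsimp only
  rw [abs_mul, abs_of_nonneg (mul_nonneg (q_nonneg h0 _ _ _) (pM_nonneg h0 _ _ _))]

lemma abs_stepM_le (h : FiberApprox νZ νM νY C p P w) (h0 : ∀ o, 0 ≤ p o) (m : M) (n : ℕ) :
    |stepM νZ νM νY a' astar p (P n) w m| ≤ C ^ 2 * boundM νZ νM νY a' astar p w m := by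
  have hκ := h.ratio astar
  have h1 : |∫ z, b νY p a' z m w * q νZ νM νY p z a' w ∂νZ| ≤ absMeanZ νZ νM νY a' p w m := by
    refine abs_integral_le_integral_abs.trans_eq ?_
    refine integral_congr_ae (ae_of_all _ fun x => ?_)
    dsimp only
    rw [abs_mul, abs_of_nonneg (q_nonneg h0 _ _ _)]
  rw [stepM, abs_mul, abs_of_nonneg (hκ.nonneg_seq n)]
  calc _ ≤ C * C * (densW νZ νM νY p w / densWA νZ νM νY p w astar) *
        (absMeanZ νZ νM νY a' p w m + absMean νZ νM νY a' astar p w) :=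
        mul_le_mul (hκ.seq_le n) ((abs_sub _ _).trans (add_le_add h1 (abs_v_le h0)))
          (abs_nonneg _) ((hκ.nonneg_seq n).trans (hκ.seq_le n))
    _ = _ := by rw [boundM]; ring

lemma tendsto_stepM (h : FiberApprox νZ νM νY C p P w) (m : M) :
    Tendsto (fun n => stepM νZ νM νY a' astar p (P n) w m) atTop
      (𝓝 (stepM νZ νM νY a' astar p p w m)) :=
  (h.ratio astar).tendsto.mul_const _

end Steps

/-! ### Dominated convergence statements as measurable events -/

/-- The sequence `f` is bounded by `B` and converges to `f₀`. -/
def DominatedTendsto (B : ℝ) (f : ℕ → ℝ) (f₀ : ℝ) : Prop :=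
  (∀ n, |f n| ≤ B) ∧ Tendsto f atTop (𝓝 f₀)

lemma DominatedTendsto.add {B B' f₀ g₀ : ℝ} {f g : ℕ → ℝ} (hf : DominatedTendsto B f f₀)
    (hg : DominatedTendsto B' g g₀) : DominatedTendsto (B + B') (fun n => f n + g n) (f₀ + g₀) :=
  ⟨fun n => (abs_add_le _ _).trans (add_le_add (hf.1 n) (hg.1 n)), hf.2.add hg.2⟩

section MeasurableEvents

variable {T : Type*} [MeasurableSpace T]

lemma measurableSet_dominatedTendsto {B f₀ : T → ℝ} {f : ℕ → T → ℝ} (hB : Measurable B)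
    (hf : ∀ n, Measurable (f n)) (hf₀ : Measurable f₀) :
    MeasurableSet {x | DominatedTendsto (B x) (fun n => f n x) (f₀ x)} := by
  simp only [DominatedTendsto, Set.ofPred_and, Set.ofPred_forall]
  exact (MeasurableSet.iInter fun n => measurableSet_le (hf n).norm hB).inter
    (measurableSet_tendsto_fun hf hf₀)

lemma measurableSet_approx {C : ℝ} {f₀ : T → ℝ} {f : ℕ → T → ℝ}
    (hf : ∀ n, Measurable (f n)) (hf₀ : Measurable f₀) :
    MeasurableSet {x | Approx C (f₀ x) fun n => f n x} := by
  have h : {x | Approx C (f₀ x) fun n => f n x} =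
      {x | 0 ≤ f₀ x} ∩ ((⋂ n, {x | 0 ≤ f n x}) ∩ ((⋂ n, {x | f₀ x ≤ C * f n x}) ∩
        ((⋂ n, {x | f n x ≤ C * f₀ x}) ∩ {x | Tendsto (fun n => f n x) atTop (𝓝 (f₀ x))}))) := by
    ext x
    simp only [Set.mem_inter_iff, Set.mem_iInter, Set.mem_ofPred_eq]
    exact ⟨fun h => ⟨h.1, h.2, h.3, h.4, h.5⟩, fun h => ⟨h.1, h.2.1, h.2.2.1, h.2.2.2.1, h.2.2.2.2⟩⟩
  rw [h]
  exact (measurableSet_le measurable_const hf₀).inter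
    ((MeasurableSet.iInter fun n => measurableSet_le measurable_const (hf n)).inter
    ((MeasurableSet.iInter fun n => measurableSet_le hf₀ ((hf n).const_mul C)).inter
    ((MeasurableSet.iInter fun n => measurableSet_le (hf n) (hf₀.const_mul C)).inter
    (measurableSet_tendsto_fun hf hf₀))))

end MeasurableEvents

section Global

variable {W A Z M : Type*} [MeasurableSpace W] [MeasurableSpace A] [MeasurableSpace Z]
  [MeasurableSpace M] [Fintype A] [MeasurableSingletonClass A]
  {νW : Measure W} {νZ : Measure Z} {νM : Measure M} {νY : Measure ℝ}
  [SigmaFinite νW] [SigmaFinite νZ] [SigmaFinite νM] [SigmaFinite νY]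
  {p f : W × A × Z × M × ℝ → ℝ} {P : ℕ → W × A × Z × M × ℝ → ℝ} {C : ℝ} {a' astar : A}

/-! ### Densities on the slices of the reference measure -/

section Density

variable (hf : f ∈ nonparametricModel (refMeasure νW νZ νM νY))
include hf

lemma integrable_slice (a : A) :
    Integrable (fun x => f (slice a x)) ((νW.prod (νZ.prod νM)).prod νY) :=
  (integrable_refMeasure_iff hf.1).1 hf.2.2.1 a

lemma integrable_densWAZM (a : A) :
    Integrable (fun x : W × Z × M => densWAZM νY f x.1 a x.2.1 x.2.2)
      (νW.prod (νZ.prod νM)) :=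
  (integrable_slice hf a).integral_prod_left

lemma ae_fiberIntegrable : ∀ᵐ w ∂νW, FiberIntegrable νZ νM νY f w :=
  ae_all_iff.2 fun a => (integrable_densWAZM hf a).prod_right_ae

/-- A function of `(W, A, Z, M)` integrates against a density iteratively: over the covariates and,
within each treatment arm, over `(Z, M)`. -/
lemma integral_mul_density {F : W × A × Z × M → ℝ} (hF : Measurable F)
    (hi : Integrable (fun o => F (o.1, o.2.1, o.2.2.1, o.2.2.2.1) * f o)
      (refMeasure νW νZ νM νY)) :
    (∀ a, Integrable (fun w => ∫ x, F (w, a, x) * densWAZM νY f w a x.1 x.2 ∂νZ.prod νM) νW) ∧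
    ∫ o, F (o.1, o.2.1, o.2.2.1, o.2.2.2.1) * f o ∂refMeasure νW νZ νM νY =
      ∑ a, ∫ w, ∫ x, F (w, a, x) * densWAZM νY f w a x.1 x.2 ∂νZ.prod νM ∂νW := by
  have hm : Measurable fun o : W × A × Z × M × ℝ =>
      F (o.1, o.2.1, o.2.2.1, o.2.2.2.1) * f o := (hF.comp (by fun_prop)).mul hf.1
  have h1 := (integrable_refMeasure_iff hm).1 hi
  have h2 : ∀ a, Integrable (fun x : W × Z × M => F (x.1, a, x.2) *
      densWAZM νY f x.1 a x.2.1 x.2.2) (νW.prod (νZ.prod νM)) := fun a =>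
    (integrable_mul_iff_marginal (F := fun x : W × Z × M => F (x.1, a, x.2))
      (integrable_slice hf a) (fun _ => hf.2.1 _) (hF.comp (by fun_prop))).1 (h1 a)
  refine ⟨fun a => (h2 a).integral_prod_left, ?_⟩
  rw [integral_refMeasure hm hi]
  refine Finset.sum_congr rfl fun a _ => ?_
  rw [← integral_prod _ (h2 a)]
  exact integral_mul_eq_marginal (F := fun x : W × Z × M => F (x.1, a, x.2)) (h1 a)

/-- Square integrability under the law of a function of `(W, A, Z, M)`, from the treatment arms. -/
lemma memLp_of_arms {F : W × A × Z × M → ℝ} (hF : Measurable F)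
    (h : ∀ a, Integrable (fun x : W × Z × M => F (x.1, a, x.2) ^ 2 *
      densWAZM νY f x.1 a x.2.1 x.2.2) (νW.prod (νZ.prod νM))) :
    MemLp (fun o => F (o.1, o.2.1, o.2.2.1, o.2.2.2.1)) 2 (law (refMeasure νW νZ νM νY) f) := by
  have hm : Measurable fun o : W × A × Z × M × ℝ => F (o.1, o.2.1, o.2.2.1, o.2.2.2.1) :=
    hF.comp (by fun_prop)
  have hm' : Measurable fun o : W × A × Z × M × ℝ =>
      F (o.1, o.2.1, o.2.2.1, o.2.2.2.1) ^ 2 * f o := (hm.pow_const 2).mul hf.1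
  rw [memLp_two_iff_integrable_sq hm.aestronglyMeasurable, integrable_law_iff hf.1 hf.2.1,
    integrable_refMeasure_iff hm']
  intro a
  exact (integrable_mul_iff_marginal (F := fun x : W × Z × M => F (x.1, a, x.2) ^ 2)
    (integrable_slice hf a) (fun _ => hf.2.1 _) ((hF.comp (by fun_prop)).pow_const 2)).2 (h a)

/-- On each slice, almost surely the density of `(W, A, Z, M)` is positive. -/
lemma ae_densWAZM_pos (a : A) : ∀ᵐ x ∂(νW.prod (νZ.prod νM)).prod νY,
    0 < f (slice a x) → 0 < densWAZM νY f x.1.1 a x.1.2.1 x.1.2.2 :=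
  ae_marginal_pos (hf.1.comp (measurable_slice a)) (integrable_slice hf a) fun _ => hf.2.1 _

end Density

/-- To check domination and convergence almost surely, it suffices to do so on each slice. -/
lemma ae_law_dominatedTendsto (hp : Measurable p) {B F₀ : W × A × Z × M × ℝ → ℝ}
    {F : ℕ → W × A × Z × M × ℝ → ℝ} (hB : Measurable B) (hF : ∀ n, Measurable (F n))
    (hF₀ : Measurable F₀)
    (h : ∀ a, ∀ᵐ x ∂(νW.prod (νZ.prod νM)).prod νY, 0 < p (slice a x) →
      DominatedTendsto (B (slice a x)) (fun n => F n (slice a x)) (F₀ (slice a x))) :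
    ∀ᵐ o ∂law (refMeasure νW νZ νM νY) p, DominatedTendsto (B o) (fun n => F n o) (F₀ o) := by
  rw [ae_law_iff hp]
  refine (ae_refMeasure_iff ?_).2 h
  exact (measurableSet_lt measurable_const hp).imp (measurableSet_dominatedTendsto hB hF hF₀)

/-! ### Sequences of comparable densities -/

/-- A sequence in the nonparametric model that is uniformly comparable with `p` and converges to it
almost everywhere. -/
structure ComparableSeq (νW : Measure W) (νZ : Measure Z) (νM : Measure M) (νY : Measure ℝ)
    (C : ℝ) (p : W × A × Z × M × ℝ → ℝ) (P : ℕ → W × A × Z × M × ℝ → ℝ) : Prop where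
  mem : ∀ n, P n ∈ nonparametricModel (refMeasure νW νZ νM νY)
  comparable : ∀ n, Comparable (refMeasure νW νZ νM νY) C (P n) p
  tendsto : ∀ᵐ o ∂refMeasure νW νZ νM νY, Tendsto (fun n => P n o) atTop (𝓝 (p o))

section Seq

variable (hp : p ∈ nonparametricModel (refMeasure νW νZ νM νY))
  (h : ComparableSeq νW νZ νM νY C p P)
include hp h

lemma ComparableSeq.ae_approx (a : A) : ∀ᵐ x ∂(νW.prod (νZ.prod νM)).prod νY,
    Approx C (p (slice a x)) fun n => P n (slice a x) := by
  have h1 : ∀ᵐ o ∂refMeasure νW νZ νM νY, Approx C (p o) fun n => P n o := by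
    filter_upwards [ae_all_iff.2 h.comparable, h.tendsto] with o h1 h2
    exact ⟨hp.2.1 o, fun n => (h.mem n).2.1 o, fun n => (h1 n).1, fun n => (h1 n).2, h2⟩
  exact ae_slice_of_ae h1 a

lemma ComparableSeq.ae_approx_densWAZM (a : A) : ∀ᵐ x ∂νW.prod (νZ.prod νM),
    Approx C (densWAZM νY p x.1 a x.2.1 x.2.2) fun n => densWAZM νY (P n) x.1 a x.2.1 x.2.2 := by
  filter_upwards [Measure.ae_ae_of_ae_prod (h.ae_approx hp a),
    (integrable_slice hp a).prod_right_ae,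
    ae_all_iff.2 fun n => (integrable_slice (h.mem n) a).prod_right_ae] with x h1 h2 h3
  exact Approx.integral h1 h2 h3

lemma ComparableSeq.ae_fiberApprox : ∀ᵐ w ∂νW, FiberApprox νZ νM νY C p P w := by
  filter_upwards [ae_fiberIntegrable hp, ae_all_iff.2 fun n => ae_fiberIntegrable (h.mem n),
    ae_all_iff.2 fun a => Measure.ae_ae_of_ae_prod (h.ae_approx_densWAZM hp a)] with w h1 h2 h3
  exact ⟨h1, h2, h3⟩

lemma ComparableSeq.ae_approx_targetDensity (a' astar : A) : ∀ᵐ x ∂νW.prod (νZ.prod νM),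
    Approx (C ^ 5) (targetDensity νZ νM νY a' astar p x)
      fun n => targetDensity νZ νM νY a' astar (P n) x := by
  refine (Measure.ae_prod_iff_ae_ae (measurableSet_approx
    (fun n => measurable_targetDensity (h.mem n).1 a' astar measurable_id)
    (measurable_targetDensity hp.1 a' astar measurable_id))).2 ?_
  filter_upwards [h.ae_fiberApprox hp] with w hw
  filter_upwards [hw.ae_q_pM a' astar] with x hx
  have := (hx.1.mul hx.2).mul hw.densW
  rwa [show C * C * (C * C) * C = C ^ 5 by ring] at this

end Seq

end Global

section Mediation

variable {W A Z M : Type*} [MeasurableSpace W] [MeasurableSpace A] [MeasurableSpace Z]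
  [MeasurableSpace M] [Fintype A] [DecidableEq A] [MeasurableSingletonClass A]
  {νW : Measure W} {νZ : Measure Z} {νM : Measure M} {νY : Measure ℝ}
  [SigmaFinite νW] [SigmaFinite νZ] [SigmaFinite νM] [SigmaFinite νY]
  {p : W × A × Z × M × ℝ → ℝ} {P : ℕ → W × A × Z × M × ℝ → ℝ} {C : ℝ} {a' astar : A}

/-! ### Consequences of positivity and square integrability -/

/-- The assumptions under which the parameter is differentiated: a density with integrable outcome,
positivity, and weighted second moments. -/
structure RegularLaw (νW : Measure W) (νZ : Measure Z) (νM : Measure M) (νY : Measure ℝ)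
    (a' astar : A) (p : W × A × Z × M × ℝ → ℝ) : Prop where
  mem : p ∈ nonparametricModel (refMeasure νW νZ νM νY)
  outcome : Integrable (fun o : W × A × Z × M × ℝ => o.2.2.2.2) (law (refMeasure νW νZ νM νY) p)
  pos_g : ∀ᵐ w ∂νW, 0 < densW νZ νM νY p w → 0 < g νZ νM νY p a' w ∧ 0 < g νZ νM νY p astar w
  pos_pMZ : ∀ᵐ x ∂νW.prod (νZ.prod νM), 0 < targetDensity νZ νM νY a' astar p x →
    0 < pMZ νM νY p x.2.2 a' x.2.1 x.1
  memLp_DY : MemLp (DY νZ νM νY a' astar p) 2 (law (refMeasure νW νZ νM νY) p)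
  sq : Integrable (fun x : W × Z × M => b νY p a' x.2.1 x.2.2 x.1 ^ 2 *
    (1 / g νZ νM νY p a' x.1 + 1 / g νZ νM νY p astar x.1) *
      targetDensity νZ νM νY a' astar p x) (νW.prod (νZ.prod νM))

lemma integrable_densW {f : W × A × Z × M × ℝ → ℝ}
    (hf : f ∈ nonparametricModel (refMeasure νW νZ νM νY)) :
    Integrable (fun w => densW νZ νM νY f w) νW := by
  refine integrable_finsetSum _ fun a _ => ?_
  refine (integrable_densWAZM hf a).integral_prod_left.congr ?_
  filter_upwards [ae_fiberIntegrable hf] with w hw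
  exact integral_prod _ (hw a)

/-- The covariate-wise weighted second moment of the outcome regression; it dominates the second
moments of all regression parts of the gradient. -/
noncomputable def weightedSq (νZ : Measure Z) (νM : Measure M) (νY : Measure ℝ) (a' astar : A)
    (p : W × A × Z × M × ℝ → ℝ) (w : W) : ℝ :=
  (densW νZ νM νY p w / densWA νZ νM νY p w a' +
    densW νZ νM νY p w / densWA νZ νM νY p w astar) * densW νZ νM νY p w *
    sqMean νZ νM νY a' astar p w

namespace RegularLaw

variable (hL : RegularLaw νW νZ νM νY a' astar p)
include hL

lemma ae_regularFiber : ∀ᵐ w ∂νW, RegularFiber νZ νM νY a' astar p w := by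
  have h0 := hL.mem.2.1
  filter_upwards [ae_fiberIntegrable hL.mem, hL.pos_g, hL.sq.prod_right_ae] with w h1 h2 h3
  have hpos : 0 < densW νZ νM νY p w →
      0 < densWA νZ νM νY p w a' ∧ 0 < densWA νZ νM νY p w astar := fun h4 =>
    ⟨(div_pos_iff_of_pos_right h4).1 (h2 h4).1, (div_pos_iff_of_pos_right h4).1 (h2 h4).2⟩
  refine ⟨h1, hpos, ?_⟩
  -- where `p(w) = 0` the density `q` is a quotient by zero and the integrand vanishes
  by_cases hn : densW νZ νM νY p w = 0
  · have : densWA νZ νM νY p w a' = 0 := RegularFiber.densWA_eq_zero h0 hn a'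
    simp [q, this]
  · have hn' : 0 < densW νZ νM νY p w := (densW_nonneg h0 w).lt_of_ne' hn
    have hg := h2 hn'
    set k := (1 / g νZ νM νY p a' w + 1 / g νZ νM νY p astar w) * densW νZ νM νY p w
    have hk : 0 < k := mul_pos (add_pos (one_div_pos.2 hg.1) (one_div_pos.2 hg.2)) hn'
    refine (h3.const_mul k⁻¹).congr (ae_of_all _ fun x => ?_)
    simp only [targetDensity]
    rw [show ∀ s t u : ℝ, s * t * (u * densW νZ νM νY p w) =
      s * u * (t * densW νZ νM νY p w) from fun _ _ _ => by ring]
    change k⁻¹ * (_ * k) = _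
    field_simp

lemma integrable_weightedSq : Integrable (weightedSq νZ νM νY a' astar p) νW := by
  refine hL.sq.integral_prod_left.congr (ae_of_all _ fun w => ?_)
  simp only [weightedSq, sqMean, g, one_div_div, targetDensity]
  rw [← integral_const_mul]
  congr 1
  ext x
  ring

lemma boundZ_sq_le (w : W) : 4 * (densW νZ νM νY p w / densWA νZ νM νY p w a' *
      densW νZ νM νY p w * sqMean νZ νM νY a' astar p w) ≤
    4 * weightedSq νZ νM νY a' astar p w := by
  have h0 := hL.mem.2.1
  have h1 := div_nonneg (densW_nonneg (νZ := νZ) (νM := νM) (νY := νY) h0 w)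
    (densWA_nonneg (νZ := νZ) (νM := νM) (νY := νY) h0 w astar)
  have h2 := mul_nonneg (mul_nonneg h1 (densW_nonneg (νZ := νZ) (νM := νM) (νY := νY) h0 w))
    (RegularFiber.sqMean_nonneg (νZ := νZ) (νM := νM) (νY := νY) (a' := a') (astar := astar)
      (w := w) h0)
  rw [weightedSq]
  linarith

lemma boundM_sq_le (w : W) : 4 * (densW νZ νM νY p w / densWA νZ νM νY p w astar *
      densW νZ νM νY p w * sqMean νZ νM νY a' astar p w) ≤
    4 * weightedSq νZ νM νY a' astar p w := by
  have h0 := hL.mem.2.1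
  have h1 := div_nonneg (densW_nonneg (νZ := νZ) (νM := νM) (νY := νY) h0 w)
    (densWA_nonneg (νZ := νZ) (νM := νM) (νY := νY) h0 w a')
  have h2 := mul_nonneg (mul_nonneg h1 (densW_nonneg (νZ := νZ) (νM := νM) (νY := νY) h0 w))
    (RegularFiber.sqMean_nonneg (νZ := νZ) (νM := νM) (νY := νY) (a' := a') (astar := astar)
      (w := w) h0)
  rw [weightedSq]
  linarith

end RegularLaw

/-! ### The gradient with perturbed weights -/

/-- The weighted outcome residual: the residual is that of `p`, the weight that of `pt`. -/
noncomputable def gradY (νZ : Measure Z) (νM : Measure M) (νY : Measure ℝ) (a' astar : A)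
    (p pt : W × A × Z × M × ℝ → ℝ) (o : W × A × Z × M × ℝ) : ℝ :=
  if o.2.1 = a' then
    targetDensity νZ νM νY a' astar pt (o.1, o.2.2.1, o.2.2.2.1) /
      densWAZM νY pt o.1 a' o.2.2.1 o.2.2.2.1 *
      (o.2.2.2.2 - b νY p a' o.2.2.1 o.2.2.2.1 o.1)
  else 0

/-- A function of `(W, A, Z)` supported on the treatment arm `a₀`. -/
noncomputable def armZ (a₀ : A) (f : W → Z → ℝ) (x : W × A × Z × M) : ℝ :=
  if x.2.1 = a₀ then f x.1 x.2.2.1 else 0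

/-- A function of `(W, A, M)` supported on the treatment arm `a₀`. -/
noncomputable def armM (a₀ : A) (f : W → M → ℝ) (x : W × A × Z × M) : ℝ :=
  if x.2.1 = a₀ then f x.1 x.2.2.2 else 0

lemma measurable_armZ (a₀ : A) {f : W → Z → ℝ} (hf : Measurable (Function.uncurry f)) :
    Measurable (armZ a₀ f : W × A × Z × M → ℝ) := by
  refine Measurable.ite ?_ (hf.comp (by fun_prop : Measurable fun x : W × A × Z × M =>
    (x.1, x.2.2.1))) measurable_const
  exact (by fun_prop : Measurable fun x : W × A × Z × M => x.2.1) (measurableSet_singleton a₀)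

lemma measurable_armM (a₀ : A) {f : W → M → ℝ} (hf : Measurable (Function.uncurry f)) :
    Measurable (armM a₀ f : W × A × Z × M → ℝ) := by
  refine Measurable.ite ?_ (hf.comp (by fun_prop : Measurable fun x : W × A × Z × M =>
    (x.1, x.2.2.2))) measurable_const
  exact (by fun_prop : Measurable fun x : W × A × Z × M => x.2.1) (measurableSet_singleton a₀)

/-- The gradient of the parameter with the regressions of `p` and the weights of `pt`. Its
integrals against `pt` and `p` are the parameter values at `pt` and `p`. -/
noncomputable def gradient (νZ : Measure Z) (νM : Measure M) (νY : Measure ℝ) (a' astar : A)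
    (p pt : W × A × Z × M × ℝ → ℝ) (o : W × A × Z × M × ℝ) : ℝ :=
  gradY νZ νM νY a' astar p pt o +
    armZ a' (stepZ νZ νM νY a' astar p pt) (o.1, o.2.1, o.2.2.1, o.2.2.2.1) +
    armM astar (stepM νZ νM νY a' astar p pt) (o.1, o.2.1, o.2.2.1, o.2.2.2.1) +
    v νZ νM νY a' p astar o.1

lemma gradY_self (o : W × A × Z × M × ℝ) :
    gradY νZ νM νY a' astar p p o = DY νZ νM νY a' astar p o := by
  obtain ⟨w, a, z, m, y⟩ := o
  simp only [gradY, DY, targetDensity, g, c, pM, pMZ, q]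
  split_ifs
  · simp only [div_eq_mul_inv, mul_inv, inv_inv]
    ring
  · simp

lemma gradient_self : gradient νZ νM νY a' astar p p = D νZ νM νY a' astar p := by
  ext ⟨w, a, z, m, y⟩
  simp only [gradient, gradY_self, D, DZ, DM, armZ, armM, stepZ, stepM, mixU, u, g]
  congr 3
  · split_ifs <;> simp
  · split_ifs <;> simp

section MeasurabilityOfParts

variable (hp : Measurable p) {pt : W × A × Z × M × ℝ → ℝ} (hpt : Measurable pt)
include hp

lemma measurable_v : Measurable fun w => v νZ νM νY a' p astar w :=
  measurable_integral_right (((measurable_b hp a' (by fun_prop) (by fun_prop) (by fun_prop)).mul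
    (measurable_q hp (by fun_prop) a' (by fun_prop))).mul
    (measurable_pM hp (by fun_prop) astar (by fun_prop)))

lemma measurable_absMean : Measurable fun w => absMean νZ νM νY a' astar p w :=
  measurable_integral_right ((measurable_b hp a' (by fun_prop) (by fun_prop) (by fun_prop)).norm.mul
    ((measurable_q hp (by fun_prop) a' (by fun_prop)).mul
    (measurable_pM hp (by fun_prop) astar (by fun_prop))))

lemma measurable_boundZ :
    Measurable (Function.uncurry (boundZ νZ νM νY a' astar p)) := by
  refine ((measurable_densW hp measurable_fst).div (measurable_densWA hp measurable_fst a')).mul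
    (Measurable.add ?_ ((measurable_absMean hp).comp measurable_fst))
  exact measurable_integral_right
    ((measurable_b hp a' (by fun_prop) (by fun_prop) (by fun_prop)).norm.mul
    (measurable_pM hp (by fun_prop) astar (by fun_prop)))

lemma measurable_boundM :
    Measurable (Function.uncurry (boundM νZ νM νY a' astar p)) := by
  refine ((measurable_densW hp measurable_fst).div (measurable_densWA hp measurable_fst astar)).mul
    (Measurable.add ?_ ((measurable_absMean hp).comp measurable_fst))
  exact measurable_integral_right
    ((measurable_b hp a' (by fun_prop) (by fun_prop) (by fun_prop)).norm.mul
    (measurable_q hp (by fun_prop) a' (by fun_prop)))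

include hpt

lemma measurable_stepZ :
    Measurable (Function.uncurry (stepZ νZ νM νY a' astar p pt)) := by
  refine ((measurable_densW hpt measurable_fst).div (measurable_densWA hpt measurable_fst a')).mul
    ((measurable_mixU hp hpt measurable_fst measurable_snd).sub ?_)
  exact measurable_integral_right ((measurable_mixU hp hpt (by fun_prop) (by fun_prop)).mul
    (measurable_q hp (by fun_prop) a' (by fun_prop)))

lemma measurable_stepM :
    Measurable (Function.uncurry (stepM νZ νM νY a' astar p pt)) :=
  ((measurable_densW hpt measurable_fst).div (measurable_densWA hpt measurable_fst astar)).mul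
    ((measurable_bq hp measurable_fst measurable_snd).sub
      ((measurable_v hp).comp measurable_fst))

lemma measurable_gradY : Measurable (gradY νZ νM νY a' astar p pt) := by
  refine Measurable.ite ?_ ?_ measurable_const
  · exact (by fun_prop : Measurable fun x : W × A × Z × M × ℝ => x.2.1) (measurableSet_singleton a')
  · exact ((measurable_targetDensity hpt a' astar (by fun_prop)).div
      (measurable_densWAZM hpt (by fun_prop) a' (by fun_prop) (by fun_prop))).mul
      ((by fun_prop : Measurable fun x : W × A × Z × M × ℝ => x.2.2.2.2).sub
        (measurable_b hp a' (by fun_prop) (by fun_prop) (by fun_prop)))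

end MeasurabilityOfParts

/-! ### Domination and convergence of the gradient -/

section Domination

variable (hL : RegularLaw νW νZ νM νY a' astar p)
include hL

lemma memLp_boundZ : MemLp (fun o : W × A × Z × M × ℝ => armZ a' (boundZ νZ νM νY a' astar p)
    (o.1, o.2.1, o.2.2.1, o.2.2.2.1)) 2 (law (refMeasure νW νZ νM νY) p) := by
  have hp := hL.mem.1
  refine memLp_of_arms hL.mem (measurable_armZ a' (measurable_boundZ hp)) fun a => ?_
  by_cases ha : a = a'
  · subst ha
    simp only [armZ, if_true]
    refine integrable_prod_of_integral_le (F := fun x : W × Z × M =>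
      boundZ νZ νM νY a astar p x.1 x.2.1 ^ 2 * densWAZM νY p x.1 a x.2.1 x.2.2)
      (((measurable_boundZ hp).comp (by fun_prop : Measurable fun x : W × Z × M =>
        (x.1, x.2.1))).pow_const 2 |>.mul (measurable_densWAZM hp (by fun_prop) a (by fun_prop)
        (by fun_prop)))
      (fun _ => mul_nonneg (sq_nonneg _) (integral_nonneg fun _ => hL.mem.2.1 _))
      (hL.integrable_weightedSq.const_mul 4) ?_
    filter_upwards [hL.ae_regularFiber] with w hw
    have := hw.sq_boundZ hp hL.mem.2.1
    exact ⟨this.1, this.2.trans (hL.boundZ_sq_le w)⟩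
  · simp [armZ, ha]

lemma memLp_boundM : MemLp (fun o : W × A × Z × M × ℝ => armM astar (boundM νZ νM νY a' astar p)
    (o.1, o.2.1, o.2.2.1, o.2.2.2.1)) 2 (law (refMeasure νW νZ νM νY) p) := by
  have hp := hL.mem.1
  refine memLp_of_arms hL.mem (measurable_armM astar (measurable_boundM hp)) fun a => ?_
  by_cases ha : a = astar
  · subst ha
    simp only [armM, if_true]
    refine integrable_prod_of_integral_le (F := fun x : W × Z × M =>
      boundM νZ νM νY a' a p x.1 x.2.2 ^ 2 * densWAZM νY p x.1 a x.2.1 x.2.2)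
      (((measurable_boundM hp).comp (by fun_prop : Measurable fun x : W × Z × M =>
        (x.1, x.2.2))).pow_const 2 |>.mul (measurable_densWAZM hp (by fun_prop) a (by fun_prop)
        (by fun_prop)))
      (fun _ => mul_nonneg (sq_nonneg _) (integral_nonneg fun _ => hL.mem.2.1 _))
      (hL.integrable_weightedSq.const_mul 4) ?_
    filter_upwards [hL.ae_regularFiber] with w hw
    have := hw.sq_boundM hp hL.mem.2.1
    exact ⟨this.1, this.2.trans (hL.boundM_sq_le w)⟩
  · simp [armM, ha]

lemma memLp_absMean : MemLp (fun o : W × A × Z × M × ℝ => absMean νZ νM νY a' astar p o.1) 2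
    (law (refMeasure νW νZ νM νY) p) := by
  have hp := hL.mem.1
  refine memLp_of_arms (F := fun x : W × A × Z × M => absMean νZ νM νY a' astar p x.1) hL.mem
    ((measurable_absMean hp).comp measurable_fst) fun a => ?_
  refine integrable_prod_of_integral_le (F := fun x : W × Z × M =>
    absMean νZ νM νY a' astar p x.1 ^ 2 * densWAZM νY p x.1 a x.2.1 x.2.2)
    (((measurable_absMean hp).comp measurable_fst).pow_const 2 |>.mul
      (measurable_densWAZM hp (by fun_prop) a (by fun_prop) (by fun_prop)))
    (fun _ => mul_nonneg (sq_nonneg _) (integral_nonneg fun _ => hL.mem.2.1 _))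
    hL.integrable_weightedSq ?_
  filter_upwards [hL.ae_regularFiber] with w hw
  have hw2 := hL.boundZ_sq_le w
  have := hw.sq_absMean hp hL.mem.2.1 a
  exact ⟨this.1, this.2.trans (by linarith)⟩

variable (h : ComparableSeq νW νZ νM νY C p P)
include h

lemma ae_dominated_gradY : ∀ᵐ o ∂law (refMeasure νW νZ νM νY) p,
    DominatedTendsto (C ^ 6 * |DY νZ νM νY a' astar p o|)
      (fun n => gradY νZ νM νY a' astar p (P n) o) (DY νZ νM νY a' astar p o) := by
  have hp := hL.mem.1
  have hm := fun n => measurable_gradY (νZ := νZ) (νM := νM) (νY := νY) (a' := a')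
    (astar := astar) hp (h.mem n).1
  have hm0 := measurable_gradY (νZ := νZ) (νM := νM) (νY := νY) (a' := a') (astar := astar) hp hp
  simp only [← gradY_self]
  refine ae_law_dominatedTendsto hp (hm0.norm.const_mul (C ^ 6)) hm hm0 fun a => ?_
  by_cases ha : a = a'
  · subst ha
    filter_upwards [Measure.quasiMeasurePreserving_fst.ae (h.ae_approx_densWAZM hL.mem a),
      Measure.quasiMeasurePreserving_fst.ae (h.ae_approx_targetDensity hL.mem a astar)]
      with x h1 h2 _
    have h3 := h2.div h1
    simp only [gradY, slice, if_true]
    refine ⟨fun n => ?_, h3.tendsto.mul_const _⟩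
    dsimp only
    rw [abs_mul, abs_mul, ← mul_assoc, abs_of_nonneg h3.nonneg, abs_of_nonneg (h3.nonneg_seq n)]
    refine mul_le_mul_of_nonneg_right ((h3.seq_le n).trans_eq ?_) (abs_nonneg _)
    ring
  · refine ae_of_all _ fun x _ => ?_
    simp [gradY, slice, ha, DominatedTendsto]

lemma ae_dominated_armZ : ∀ᵐ o ∂law (refMeasure νW νZ νM νY) p,
    DominatedTendsto
      (C ^ 4 * armZ a' (boundZ νZ νM νY a' astar p) (o.1, o.2.1, o.2.2.1, o.2.2.2.1))
      (fun n => armZ a' (stepZ νZ νM νY a' astar p (P n)) (o.1, o.2.1, o.2.2.1, o.2.2.2.1))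
      (armZ a' (stepZ νZ νM νY a' astar p p) (o.1, o.2.1, o.2.2.1, o.2.2.2.1)) := by
  have hp := hL.mem.1
  refine ae_law_dominatedTendsto hp
    (((measurable_armZ a' (measurable_boundZ hp)).comp (by fun_prop)).const_mul (C ^ 4))
    (fun n => (measurable_armZ a' (measurable_stepZ hp (h.mem n).1)).comp (by fun_prop))
    ((measurable_armZ a' (measurable_stepZ hp hp)).comp (by fun_prop)) fun a => ?_
  by_cases ha : a = a'
  · subst ha
    have h1 : ∀ᵐ x ∂νW.prod (νZ.prod νM), 0 < densWAZM νY p x.1 a x.2.1 x.2.2 →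
        DominatedTendsto (C ^ 4 * boundZ νZ νM νY a astar p x.1 x.2.1)
          (fun n => stepZ νZ νM νY a astar p (P n) x.1 x.2.1)
          (stepZ νZ νM νY a astar p p x.1 x.2.1) := by
      refine (Measure.ae_prod_iff_ae_ae ?_).2 ?_
      · have hc : Measurable fun x : W × Z × M => (x.1, x.2.1) := by fun_prop
        exact (measurableSet_lt measurable_const
          (measurable_densWAZM hp (by fun_prop) a (by fun_prop) (by fun_prop))).imp
          (measurableSet_dominatedTendsto (((measurable_boundZ hp).comp hc).const_mul _)
            (fun n => (measurable_stepZ hp (h.mem n).1).comp hc)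
            ((measurable_stepZ hp hp).comp hc))
      · filter_upwards [hL.ae_regularFiber, h.ae_fiberApprox hL.mem] with w hw1 hw2
        exact ae_stepZ hw2 hw1 hp hL.mem.2.1 fun n => (h.mem n).1
    filter_upwards [Measure.quasiMeasurePreserving_fst.ae h1, ae_densWAZM_pos hL.mem a]
      with x h2 h3 hpos
    simpa [armZ, slice] using h2 (h3 hpos)
  · refine ae_of_all _ fun x _ => ?_
    simp [armZ, slice, ha, DominatedTendsto]

lemma ae_dominated_armM : ∀ᵐ o ∂law (refMeasure νW νZ νM νY) p,
    DominatedTendsto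
      (C ^ 2 * armM astar (boundM νZ νM νY a' astar p) (o.1, o.2.1, o.2.2.1, o.2.2.2.1))
      (fun n => armM astar (stepM νZ νM νY a' astar p (P n)) (o.1, o.2.1, o.2.2.1, o.2.2.2.1))
      (armM astar (stepM νZ νM νY a' astar p p) (o.1, o.2.1, o.2.2.1, o.2.2.2.1)) := by
  have hp := hL.mem.1
  refine ae_law_dominatedTendsto hp
    (((measurable_armM astar (measurable_boundM hp)).comp (by fun_prop)).const_mul (C ^ 2))
    (fun n => (measurable_armM astar (measurable_stepM hp (h.mem n).1)).comp (by fun_prop))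
    ((measurable_armM astar (measurable_stepM hp hp)).comp (by fun_prop)) fun a => ?_
  by_cases ha : a = astar
  · subst ha
    have h1 := (Measure.quasiMeasurePreserving_fst (μ := νW) (ν := νZ.prod νM)).ae
      (h.ae_fiberApprox hL.mem)
    filter_upwards [Measure.quasiMeasurePreserving_fst.ae h1] with x h2 _
    simpa [armM, slice, DominatedTendsto] using
      (⟨abs_stepM_le h2 hL.mem.2.1 x.1.2.2, tendsto_stepM h2 x.1.2.2⟩ : DominatedTendsto _ _ _)
  · refine ae_of_all _ fun x _ => ?_
    simp [armM, slice, ha, DominatedTendsto]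

end Domination

end Mediation

lemma integral_sum_three {Ω : Type*} [MeasurableSpace Ω] {μ : Measure Ω} {f₁ f₂ f₃ : Ω → ℝ}
    (h₁ : Integrable f₁ μ) (h₂ : Integrable f₂ μ) (h₃ : Integrable f₃ μ) :
    ∫ o, (f₁ o + f₂ o + f₃ o) ∂μ = ∫ o, f₁ o ∂μ + ∫ o, f₂ o ∂μ + ∫ o, f₃ o ∂μ := by
  have h₁₂ : Integrable (fun o => f₁ o + f₂ o) μ := h₁.add h₂
  rw [integral_add h₁₂ h₃, integral_add h₁ h₂]

lemma integral_sum_four {Ω : Type*} [MeasurableSpace Ω] {μ : Measure Ω} {f₁ f₂ f₃ f₄ : Ω → ℝ}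
    (h₁ : Integrable f₁ μ) (h₂ : Integrable f₂ μ) (h₃ : Integrable f₃ μ) (h₄ : Integrable f₄ μ) :
    ∫ o, (f₁ o + f₂ o + f₃ o + f₄ o) ∂μ =
      ∫ o, f₁ o ∂μ + ∫ o, f₂ o ∂μ + ∫ o, f₃ o ∂μ + ∫ o, f₄ o ∂μ := by
  have h₁₃ : Integrable (fun o => f₁ o + f₂ o + f₃ o) μ := (h₁.add h₂).add h₃
  rw [integral_add h₁₃ h₄, integral_sum_three h₁ h₂ h₃]

section Mediation

variable {W A Z M : Type*} [MeasurableSpace W] [MeasurableSpace A] [MeasurableSpace Z]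
  [MeasurableSpace M] [Fintype A] [DecidableEq A] [MeasurableSingletonClass A]
  {νW : Measure W} {νZ : Measure Z} {νM : Measure M} {νY : Measure ℝ}
  [SigmaFinite νW] [SigmaFinite νZ] [SigmaFinite νM] [SigmaFinite νY]
  {p : W × A × Z × M × ℝ → ℝ} {P : ℕ → W × A × Z × M × ℝ → ℝ} {C : ℝ} {a' astar : A}

/-! ### The exact expansion of the parameter -/

section Expansion

variable (hL : RegularLaw νW νZ νM νY a' astar p)
  (h : ComparableSeq νW νZ νM νY C p P)
include hL

/-- The outcome regression is integrable under the target density. -/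
lemma integrable_abs_b_target : Integrable (fun x : W × Z × M => |b νY p a' x.2.1 x.2.2 x.1| *
    targetDensity νZ νM νY a' astar p x) (νW.prod (νZ.prod νM)) := by
  have hp := hL.mem.1
  have h0 := hL.mem.2.1
  refine integrable_prod_of_integral_le
    ((measurable_b hp a' (by fun_prop) (by fun_prop) (by fun_prop)).norm.mul
      (measurable_targetDensity hp a' astar measurable_id))
    (fun x => mul_nonneg (abs_nonneg _) (mul_nonneg (mul_nonneg (q_nonneg h0 _ _ _)
      (pM_nonneg h0 _ _ _)) (densW_nonneg h0 _)))
    ((integrable_densW hL.mem).add hL.integrable_weightedSq) ?_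
  filter_upwards [hL.ae_regularFiber] with w hw
  have h1 : ∀ x : Z × M, |b νY p a' x.1 x.2 w| * targetDensity νZ νM νY a' astar p (w, x) =
      |b νY p a' x.1 x.2 w| * (q νZ νM νY p x.1 a' w * pM νZ νM νY p x.2 astar w) *
        densW νZ νM νY p w := fun x => by
    simp only [targetDensity]; ring
  simp only [h1, Pi.add_apply]
  refine ⟨(hw.abs_int hp h0).mul_const _, ?_⟩
  rw [integral_mul_const]
  change absMean νZ νM νY a' astar p w * _ ≤ _
  have h2 := hw.absMean_sq_le hp h0
  have h3 := RegularFiber.sqMean_nonneg (νZ := νZ) (νM := νM) (νY := νY) (a' := a')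
    (astar := astar) (w := w) h0
  have h4 := hL.boundM_sq_le w
  have hn := densW_nonneg (νZ := νZ) (νM := νM) (νY := νY) h0 w
  have h5 : densW νZ νM νY p w * sqMean νZ νM νY a' astar p w ≤
      weightedSq νZ νM νY a' astar p w := by
    by_cases hn0 : densW νZ νM νY p w = 0
    · simp [hn0, weightedSq]
    · have hpos := hw.pos (hn.lt_of_ne' hn0)
      have h6 : 1 ≤ densW νZ νM νY p w / densWA νZ νM νY p w astar := by
        rw [one_le_div hpos.2]; exact densWA_le_densW h0 w astar
      have h7 := mul_nonneg hn h3
      nlinarith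
  have h8 : absMean νZ νM νY a' astar p w ≤ 1 + sqMean νZ νM νY a' astar p w := by
    nlinarith [sq_nonneg (absMean νZ νM νY a' astar p w - 1)]
  nlinarith

/-- Integrability against the law and against comparable densities, from square-integrable
domination. -/
lemma integrable_mul_of_dominated {f : W × A × Z × M × ℝ → ℝ}
    (hf : f ∈ nonparametricModel (refMeasure νW νZ νM νY))
    (hc : Comparable (refMeasure νW νZ νM νY) C f p)
    {E B : W × A × Z × M × ℝ → ℝ} (hE : Measurable E)
    (hB : MemLp B 2 (law (refMeasure νW νZ νM νY) p)) (k : ℝ)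
    (hEB : ∀ᵐ o ∂law (refMeasure νW νZ νM νY) p, |E o| ≤ k * B o) :
    Integrable (fun o => E o * p o) (refMeasure νW νZ νM νY) ∧
      Integrable (fun o => E o * f o) (refMeasure νW νZ νM νY) := by
  have := isProbabilityMeasure_law hL.mem
  have h1 : Integrable E (law (refMeasure νW νZ νM νY) p) :=
    ((hB.integrable (by norm_num)).const_mul k).mono' hE.aestronglyMeasurable hEB
  have h2 := (integrable_law_iff hL.mem.1 hL.mem.2.1).1 h1
  refine ⟨h2, (h2.norm.const_mul C).mono' (hE.mul hf.1).aestronglyMeasurable ?_⟩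
  filter_upwards [hc] with o ho
  rw [norm_mul, norm_mul, Real.norm_of_nonneg (hf.2.1 o), Real.norm_of_nonneg (hL.mem.2.1 o)]
  calc ‖E o‖ * f o ≤ ‖E o‖ * (C * p o) := mul_le_mul_of_nonneg_left ho.2 (norm_nonneg _)
    _ = _ := by ring

include h

/-- The outcome regression of `p` is integrable under the target densities of the sequence. -/
lemma integrable_b_target (n : ℕ) : Integrable (fun x : W × Z × M => b νY p a' x.2.1 x.2.2 x.1 *
    targetDensity νZ νM νY a' astar (P n) x) (νW.prod (νZ.prod νM)) := by
  refine ((integrable_abs_b_target hL).const_mul (C ^ 5)).mono'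
    ((measurable_b hL.mem.1 a' (by fun_prop) (by fun_prop) (by fun_prop)).mul
      (measurable_targetDensity (h.mem n).1 a' astar measurable_id)).aestronglyMeasurable ?_
  filter_upwards [h.ae_approx_targetDensity hL.mem a' astar] with x hx
  rw [norm_mul, Real.norm_of_nonneg (hx.nonneg_seq n), Real.norm_eq_abs]
  calc _ ≤ |b νY p a' x.2.1 x.2.2 x.1| * (C ^ 5 * targetDensity νZ νM νY a' astar p x) :=
        mul_le_mul_of_nonneg_left (hx.seq_le n) (abs_nonneg _)
    _ = _ := by ring

lemma integral_b_target (n : ℕ) :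
    ∫ x, b νY p a' x.2.1 x.2.2 x.1 * targetDensity νZ νM νY a' astar (P n) x
        ∂νW.prod (νZ.prod νM) =
      ∫ w, densW νZ νM νY (P n) w * mixMean νZ νM νY a' astar p (P n) (P n) w ∂νW := by
  rw [integral_prod _ (integrable_b_target hL h n)]
  refine integral_congr_ae (ae_of_all _ fun w => ?_)
  simp only [mixMean, targetDensity]
  rw [← integral_const_mul]
  congr 1
  ext x
  ring

lemma integrable_outcome_mul (n : ℕ) :
    Integrable (fun o : W × A × Z × M × ℝ => o.2.2.2.2 * P n o) (refMeasure νW νZ νM νY) := by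
  have h2 := (integrable_law_iff hL.mem.1 hL.mem.2.1).1 hL.outcome
  refine (h2.norm.const_mul C).mono'
    ((by fun_prop : Measurable fun o : W × A × Z × M × ℝ => o.2.2.2.2).mul
      (h.mem n).1).aestronglyMeasurable ?_
  filter_upwards [h.comparable n] with o ho
  rw [norm_mul, norm_mul, Real.norm_of_nonneg ((h.mem n).2.1 o),
    Real.norm_of_nonneg (hL.mem.2.1 o)]
  calc ‖o.2.2.2.2‖ * P n o ≤ ‖o.2.2.2.2‖ * (C * p o) :=
        mul_le_mul_of_nonneg_left ho.2 (norm_nonneg _)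
    _ = _ := by ring

/-- Where the target density does not vanish, neither does the density of `(W, Z, M)` in the arm
`a'`. -/
lemma ae_target_eq_zero (n : ℕ) : ∀ᵐ x ∂νW.prod (νZ.prod νM),
    densWAZM νY (P n) x.1 a' x.2.1 x.2.2 = 0 → targetDensity νZ νM νY a' astar (P n) x = 0 := by
  filter_upwards [hL.pos_pMZ, h.ae_approx_targetDensity hL.mem a' astar,
    h.ae_approx_densWAZM hL.mem a'] with x h1 h2 h3 h4
  refine h2.eq_zero ?_ n
  by_contra h5
  have h6 := h1 (h2.nonneg.lt_of_ne' h5)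
  have h7 : densWAZM νY p x.1 a' x.2.1 x.2.2 ≠ 0 := fun h8 => by
    simp [pMZ, h8] at h6
  exact (h3.pos (h3.nonneg.lt_of_ne' h7) n).ne' h4

omit h in
/-- The integral of the weighted residual against a density `f` in the model, after integrating out
the outcome. -/
lemma integral_gradY_mul {f pt : W × A × Z × M × ℝ → ℝ}
    (hf : f ∈ nonparametricModel (refMeasure νW νZ νM νY)) (hpt : Measurable pt)
    (hy : Integrable (fun o : W × A × Z × M × ℝ => o.2.2.2.2 * f o) (refMeasure νW νZ νM νY))
    (hi : Integrable (fun o => gradY νZ νM νY a' astar p pt o * f o)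
      (refMeasure νW νZ νM νY)) :
    Integrable (fun x : W × Z × M => targetDensity νZ νM νY a' astar pt x /
        densWAZM νY pt x.1 a' x.2.1 x.2.2 * ((∫ y, y * f (x.1, a', x.2.1, x.2.2, y) ∂νY) -
          b νY p a' x.2.1 x.2.2 x.1 * densWAZM νY f x.1 a' x.2.1 x.2.2))
        (νW.prod (νZ.prod νM)) ∧
      ∫ o, gradY νZ νM νY a' astar p pt o * f o ∂refMeasure νW νZ νM νY =
      ∫ x : W × Z × M, targetDensity νZ νM νY a' astar pt x /
        densWAZM νY pt x.1 a' x.2.1 x.2.2 * ((∫ y, y * f (x.1, a', x.2.1, x.2.2, y) ∂νY) -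
          b νY p a' x.2.1 x.2.2 x.1 * densWAZM νY f x.1 a' x.2.1 x.2.2)
        ∂νW.prod (νZ.prod νM) := by
  have hm : Measurable fun o => gradY νZ νM νY a' astar p pt o * f o :=
    (measurable_gradY hL.mem.1 hpt).mul hf.1
  have hym : Measurable fun o : W × A × Z × M × ℝ => o.2.2.2.2 * f o :=
    (by fun_prop : Measurable fun o : W × A × Z × M × ℝ => o.2.2.2.2).mul hf.1
  have hi' := (integrable_refMeasure_iff hm).1 hi a'
  have hin : ∀ᵐ x ∂νW.prod (νZ.prod νM),
      ∫ y, gradY νZ νM νY a' astar p pt (slice a' (x, y)) * f (slice a' (x, y)) ∂νY =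
      targetDensity νZ νM νY a' astar pt x /
        densWAZM νY pt x.1 a' x.2.1 x.2.2 * ((∫ y, y * f (x.1, a', x.2.1, x.2.2, y) ∂νY) -
          b νY p a' x.2.1 x.2.2 x.1 * densWAZM νY f x.1 a' x.2.1 x.2.2) := by
    filter_upwards [((integrable_refMeasure_iff hym).1 hy a').prod_right_ae,
      (integrable_slice hf a').prod_right_ae] with x h1 h2
    simp only [slice] at h1 h2
    rw [densWAZM.eq_def νY f, ← integral_const_mul, ← integral_sub h1 (h2.const_mul _),
      ← integral_const_mul]
    congr 1
    ext y
    simp only [gradY, slice, if_true]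
    ring
  refine ⟨hi'.integral_prod_left.congr hin, ?_⟩
  rw [integral_refMeasure hm hi, Finset.sum_eq_single a' (fun a _ ha => by
    simp [gradY, slice, ha]) (by simp), integral_prod _ hi']
  exact integral_congr_ae hin

/-- The residual part of the gradient accounts for replacing the outcome regression. -/
lemma integral_gradY_seq (n : ℕ)
    (hi : Integrable (fun o => gradY νZ νM νY a' astar p (P n) o * P n o)
      (refMeasure νW νZ νM νY)) :
    ∫ o, gradY νZ νM νY a' astar p (P n) o * P n o ∂refMeasure νW νZ νM νY =
      theta νW νZ νM νY a' astar (P n) -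
        ∫ x, b νY p a' x.2.1 x.2.2 x.1 * targetDensity νZ νM νY a' astar (P n) x
        ∂νW.prod (νZ.prod νM) := by
  obtain ⟨h1, h2⟩ := integral_gradY_mul hL (h.mem n) (h.mem n).1
    (integrable_outcome_mul hL h n) hi
  have h3 : (fun x : W × Z × M => targetDensity νZ νM νY a' astar (P n) x /
        densWAZM νY (P n) x.1 a' x.2.1 x.2.2 *
        ((∫ y, y * P n (x.1, a', x.2.1, x.2.2, y) ∂νY) -
          b νY p a' x.2.1 x.2.2 x.1 * densWAZM νY (P n) x.1 a' x.2.1 x.2.2)) =ᵐ[νW.prod (νZ.prod νM)]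
      fun x => b νY (P n) a' x.2.1 x.2.2 x.1 * targetDensity νZ νM νY a' astar (P n) x -
        b νY p a' x.2.1 x.2.2 x.1 * targetDensity νZ νM νY a' astar (P n) x := by
    filter_upwards [ae_target_eq_zero hL h n] with x hx
    rw [b.eq_def νY (P n)]
    by_cases h4 : densWAZM νY (P n) x.1 a' x.2.1 x.2.2 = 0
    · simp [hx h4]
    · field_simp
  have h5 := integrable_b_target hL h n
  have h6 : Integrable (fun x => b νY (P n) a' x.2.1 x.2.2 x.1 *
      targetDensity νZ νM νY a' astar (P n) x) (νW.prod (νZ.prod νM)) := by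
    refine ((h1.congr h3).add h5).congr (ae_of_all _ fun x => ?_)
    simp
  rw [h2, integral_congr_ae h3, integral_sub h6 h5]
  rfl

/-- The residual is centred under `p`. -/
lemma integral_gradY_base (n : ℕ)
    (hi : Integrable (fun o => gradY νZ νM νY a' astar p (P n) o * p o)
      (refMeasure νW νZ νM νY)) :
    ∫ o, gradY νZ νM νY a' astar p (P n) o * p o ∂refMeasure νW νZ νM νY = 0 := by
  obtain ⟨-, h2⟩ := integral_gradY_mul hL hL.mem (h.mem n).1
    ((integrable_law_iff hL.mem.1 hL.mem.2.1).1 hL.outcome) hi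
  rw [h2]
  refine integral_eq_zero_of_ae ?_
  filter_upwards [h.ae_approx_densWAZM hL.mem a'] with x hx
  by_cases h4 : densWAZM νY p x.1 a' x.2.1 x.2.2 = 0
  · simp [hx.eq_zero h4 n]
  · simp only [b, Pi.zero_apply]
    field_simp
    simp

/-- Integrals over the treatment arms of the parts of the gradient that do not involve the
outcome. -/
lemma integral_armZ (n : ℕ) {f : W × A × Z × M × ℝ → ℝ}
    (hf : f ∈ nonparametricModel (refMeasure νW νZ νM νY))
    (hi : Integrable (fun o : W × A × Z × M × ℝ => armZ a' (stepZ νZ νM νY a' astar p (P n))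
      (o.1, o.2.1, o.2.2.1, o.2.2.2.1) * f o) (refMeasure νW νZ νM νY)) {k : W → ℝ}
    (hk : ∀ᵐ w ∂νW, ∫ x : Z × M, stepZ νZ νM νY a' astar p (P n) w x.1 *
      densWAZM νY f w a' x.1 x.2 ∂νZ.prod νM = k w) :
    Integrable k νW ∧ ∫ o : W × A × Z × M × ℝ, armZ a' (stepZ νZ νM νY a' astar p (P n))
      (o.1, o.2.1, o.2.2.1, o.2.2.2.1) * f o ∂refMeasure νW νZ νM νY = ∫ w, k w ∂νW := by
  obtain ⟨h1, h2⟩ := integral_mul_density hf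
    (measurable_armZ a' (measurable_stepZ hL.mem.1 (h.mem n).1)) hi
  have h3 := h1 a'
  simp only [armZ, if_true] at h3
  refine ⟨h3.congr hk, ?_⟩
  rw [h2, Finset.sum_eq_single a' (fun a _ ha => by simp [armZ, ha]) (by simp)]
  simp only [armZ, if_true]
  exact integral_congr_ae hk

lemma integral_armM (n : ℕ) {f : W × A × Z × M × ℝ → ℝ}
    (hf : f ∈ nonparametricModel (refMeasure νW νZ νM νY))
    (hi : Integrable (fun o : W × A × Z × M × ℝ => armM astar (stepM νZ νM νY a' astar p (P n))
      (o.1, o.2.1, o.2.2.1, o.2.2.2.1) * f o) (refMeasure νW νZ νM νY)) {k : W → ℝ}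
    (hk : ∀ᵐ w ∂νW, ∫ x : Z × M, stepM νZ νM νY a' astar p (P n) w x.2 *
      densWAZM νY f w astar x.1 x.2 ∂νZ.prod νM = k w) :
    Integrable k νW ∧ ∫ o : W × A × Z × M × ℝ, armM astar (stepM νZ νM νY a' astar p (P n))
      (o.1, o.2.1, o.2.2.1, o.2.2.2.1) * f o ∂refMeasure νW νZ νM νY = ∫ w, k w ∂νW := by
  obtain ⟨h1, h2⟩ := integral_mul_density hf
    (measurable_armM astar (measurable_stepM hL.mem.1 (h.mem n).1)) hi
  have h3 := h1 astar
  simp only [armM, if_true] at h3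
  refine ⟨h3.congr hk, ?_⟩
  rw [h2, Finset.sum_eq_single astar (fun a _ ha => by simp [armM, ha]) (by simp)]
  simp only [armM, if_true]
  exact integral_congr_ae hk

omit h in
lemma integral_v_mul {f : W × A × Z × M × ℝ → ℝ}
    (hf : f ∈ nonparametricModel (refMeasure νW νZ νM νY))
    (hi : Integrable (fun o : W × A × Z × M × ℝ => v νZ νM νY a' p astar o.1 * f o)
      (refMeasure νW νZ νM νY)) :
    Integrable (fun w => densW νZ νM νY f w * mixMean νZ νM νY a' astar p p p w) νW ∧
      ∫ o : W × A × Z × M × ℝ, v νZ νM νY a' p astar o.1 * f o ∂refMeasure νW νZ νM νY =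
      ∫ w, densW νZ νM νY f w * mixMean νZ νM νY a' astar p p p w ∂νW := by
  obtain ⟨h1, h2⟩ := integral_mul_density (F := fun x => v νZ νM νY a' p astar x.1) hf
    ((measurable_v hL.mem.1).comp measurable_fst) hi
  have h3 : (fun w => ∑ a, ∫ x : Z × M, v νZ νM νY a' p astar w *
      densWAZM νY f w a x.1 x.2 ∂νZ.prod νM) =ᵐ[νW]
      fun w => densW νZ νM νY f w * mixMean νZ νM νY a' astar p p p w := by
    filter_upwards [ae_fiberIntegrable hf] with w hw
    simp only [integral_const_mul, ← Finset.mul_sum, v_eq_mixMean]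
    rw [mul_comm]
    congr 1
    exact Finset.sum_congr rfl fun a _ => integral_prod _ (hw a)
  refine ⟨(integrable_finsetSum _ fun a _ => h1 a).congr h3, ?_⟩
  rw [h2, ← integral_finsetSum _ fun a _ => h1 a]
  exact integral_congr_ae h3

/-- The gradient with the weights of `P n` integrates to the parameter of `P n` under `P n`, and to
the parameter of `p` under `p`. -/
theorem integral_gradient (n : ℕ) :
    Integrable (fun o => gradient νZ νM νY a' astar p (P n) o * P n o)
      (refMeasure νW νZ νM νY) ∧
    Integrable (fun o => gradient νZ νM νY a' astar p (P n) o * p o)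
      (refMeasure νW νZ νM νY) ∧
    ∫ o, gradient νZ νM νY a' astar p (P n) o * P n o ∂refMeasure νW νZ νM νY =
      theta νW νZ νM νY a' astar (P n) ∧
    ∫ o, gradient νZ νM νY a' astar p (P n) o * p o ∂refMeasure νW νZ νM νY =
      ∫ w, densW νZ νM νY p w * mixMean νZ νM νY a' astar p p p w ∂νW := by
  have hp := hL.mem.1
  have h0 := hL.mem.2.1
  have hc := h.comparable n
  obtain ⟨iY, iY'⟩ := integrable_mul_of_dominated hL (h.mem n) hc
    (E := gradY νZ νM νY a' astar p (P n)) (measurable_gradY hp (h.mem n).1) hL.memLp_DY.abs (C ^ 6)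
    ((ae_dominated_gradY hL h).mono fun o ho => ho.1 n)
  obtain ⟨iZ, iZ'⟩ := integrable_mul_of_dominated hL (h.mem n) hc
    (E := fun o => armZ a' (stepZ νZ νM νY a' astar p (P n)) (o.1, o.2.1, o.2.2.1, o.2.2.2.1))
    ((measurable_armZ a' (measurable_stepZ hp (h.mem n).1)).comp (by fun_prop))
    (memLp_boundZ hL) (C ^ 4) ((ae_dominated_armZ hL h).mono fun o ho => ho.1 n)
  obtain ⟨iM, iM'⟩ := integrable_mul_of_dominated hL (h.mem n) hc
    (E := fun o => armM astar (stepM νZ νM νY a' astar p (P n)) (o.1, o.2.1, o.2.2.1, o.2.2.2.1))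
    ((measurable_armM astar (measurable_stepM hp (h.mem n).1)).comp (by fun_prop))
    (memLp_boundM hL) (C ^ 2) ((ae_dominated_armM hL h).mono fun o ho => ho.1 n)
  obtain ⟨iV, iV'⟩ := integrable_mul_of_dominated hL (h.mem n) hc
    (E := fun o => v νZ νM νY a' p astar o.1)
    ((measurable_v hp).comp (by fun_prop)) (memLp_absMean hL) 1
    (ae_of_all _ fun o => (abs_v_le h0).trans_eq (one_mul _).symm)
  have hr := hL.ae_regularFiber
  have hfa := h.ae_fiberApprox hL.mem
  have hPm := fun n => (h.mem n).1
  have hP0 := fun n => (h.mem n).2.1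
  obtain ⟨jZ, eZ⟩ := integral_armZ hL h n (h.mem n) iZ' (by
    filter_upwards [hr, hfa] with w h1 h2
    exact (integral_stepZ_mul_seq h2 h1 hp h0 hPm hP0 n).2)
  obtain ⟨-, eZ₀⟩ := integral_armZ hL h n hL.mem iZ (k := fun _ => 0) (by
    filter_upwards [hr, hfa] with w h1 h2
    exact (integral_stepZ_mul_base h2 h1 hp h0 hPm hP0 n).2)
  obtain ⟨jM, eM⟩ := integral_armM hL h n (h.mem n) iM' (by
    filter_upwards [hr, hfa] with w h1 h2
    exact (integral_stepM_mul_seq h2 h1 hp h0 hPm hP0 n).2)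
  obtain ⟨-, eM₀⟩ := integral_armM hL h n hL.mem iM (k := fun _ => 0) (by
    filter_upwards [hr, hfa] with w h1 h2
    exact (integral_stepM_mul_base h2 h1 hp h0 hPm hP0 n).2)
  obtain ⟨jV, eV⟩ := integral_v_mul hL (h.mem n) iV'
  obtain ⟨-, eV₀⟩ := integral_v_mul hL hL.mem iV
  have hs : ∀ f : W × A × Z × M × ℝ → ℝ,
      (fun o => gradient νZ νM νY a' astar p (P n) o * f o) = fun o =>
        gradY νZ νM νY a' astar p (P n) o * f o +
        armZ a' (stepZ νZ νM νY a' astar p (P n)) (o.1, o.2.1, o.2.2.1, o.2.2.2.1) * f o +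
        armM astar (stepM νZ νM νY a' astar p (P n)) (o.1, o.2.1, o.2.2.1, o.2.2.2.1) * f o +
        v νZ νM νY a' p astar o.1 * f o := fun f => by
    ext o
    simp only [gradient]
    ring
  rw [hs, hs]
  refine ⟨((iY'.add iZ').add iM').add iV', ((iY.add iZ).add iM).add iV, ?_, ?_⟩
  · rw [integral_sum_four iY' iZ' iM' iV', eZ, eM, eV, integral_gradY_seq hL h n iY', integral_b_target hL h n]
    -- telescoping: the three regression parts add up to the mean of `b` under both perturbed densities
    have e1 : ∫ w, densW νZ νM νY (P n) w * mixMean νZ νM νY a' astar p (P n) (P n) w ∂νW =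
        ∫ w, densW νZ νM νY (P n) w * (mixMean νZ νM νY a' astar p (P n) (P n) w -
          mixMean νZ νM νY a' astar p p (P n) w) ∂νW +
        ∫ w, densW νZ νM νY (P n) w * (mixMean νZ νM νY a' astar p p (P n) w -
          mixMean νZ νM νY a' astar p p p w) ∂νW +
        ∫ w, densW νZ νM νY (P n) w * mixMean νZ νM νY a' astar p p p w ∂νW := by
      rw [← integral_sum_three jZ jM jV]
      congr 1
      ext w
      ring
    rw [e1]
    ring
  · rw [integral_sum_four iY iZ iM iV, eZ₀, eM₀, eV₀, integral_gradY_base hL h n iY]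
    simp

end Expansion

lemma comparableSeq_const (hp : p ∈ nonparametricModel (refMeasure νW νZ νM νY)) :
    ComparableSeq νW νZ νM νY 1 p fun _ => p :=
  ⟨fun _ => hp, fun _ => ae_of_all _ fun _ => by simp, ae_of_all _ fun _ => tendsto_const_nhds⟩

section Conclusion

variable (hL : RegularLaw νW νZ νM νY a' astar p)
include hL

lemma theta_eq : theta νW νZ νM νY a' astar p =
    ∫ w, densW νZ νM νY p w * mixMean νZ νM νY a' astar p p p w ∂νW :=
  integral_b_target hL (comparableSeq_const hL.mem) 0

lemma measurable_gradient {pt : W × A × Z × M × ℝ → ℝ} (hpt : Measurable pt) :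
    Measurable (gradient νZ νM νY a' astar p pt) :=
  (((measurable_gradY hL.mem.1 hpt).add
    ((measurable_armZ a' (measurable_stepZ hL.mem.1 hpt)).comp (by fun_prop))).add
    ((measurable_armM astar (measurable_stepM hL.mem.1 hpt)).comp (by fun_prop))).add
    ((measurable_v hL.mem.1).comp (by fun_prop))

/-- A square-integrable function that dominates all gradients along a comparable sequence. -/
lemma exists_dominating (h : ComparableSeq νW νZ νM νY C p P) :
    ∃ B : W × A × Z × M × ℝ → ℝ, Measurable B ∧ MemLp B 2 (law (refMeasure νW νZ νM νY) p) ∧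
      ∀ᵐ o ∂law (refMeasure νW νZ νM νY) p, DominatedTendsto (B o)
        (fun n => gradient νZ νM νY a' astar p (P n) o) (D νZ νM νY a' astar p o) := by
  have hp := hL.mem.1
  refine ⟨fun o => C ^ 6 * |DY νZ νM νY a' astar p o| +
    C ^ 4 * armZ a' (boundZ νZ νM νY a' astar p) (o.1, o.2.1, o.2.2.1, o.2.2.2.1) +
    C ^ 2 * armM astar (boundM νZ νM νY a' astar p) (o.1, o.2.1, o.2.2.1, o.2.2.2.1) +
    absMean νZ νM νY a' astar p o.1, ?_, ?_, ?_⟩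
  · have hY : Measurable (DY νZ νM νY a' astar p) := by
      have h1 := measurable_gradY (νZ := νZ) (νM := νM) (νY := νY) (a' := a') (astar := astar) hp hp
      rwa [show gradY νZ νM νY a' astar p p = DY νZ νM νY a' astar p from funext gradY_self] at h1
    exact (((hY.norm.const_mul _).add
      (((measurable_armZ a' (measurable_boundZ hp)).comp (by fun_prop)).const_mul _)).add
      (((measurable_armM astar (measurable_boundM hp)).comp (by fun_prop)).const_mul _)).add
      ((measurable_absMean hp).comp (by fun_prop))
  · exact (((hL.memLp_DY.abs.const_mul _).add ((memLp_boundZ hL).const_mul _)).add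
      ((memLp_boundM hL).const_mul _)).add (memLp_absMean hL)
  · rw [← gradient_self]
    filter_upwards [ae_dominated_gradY hL h, ae_dominated_armZ hL h, ae_dominated_armM hL h]
      with o h1 h2 h3
    have h4 : DominatedTendsto (absMean νZ νM νY a' astar p o.1)
        (fun _ => v νZ νM νY a' p astar o.1) (v νZ νM νY a' p astar o.1) :=
      ⟨fun _ => abs_v_le hL.mem.2.1, tendsto_const_nhds⟩
    simpa only [gradient, gradY_self] using ((h1.add h2).add h3).add h4

theorem hasExactExpansion_theta : HasExactExpansion (refMeasure νW νZ νM νY)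
    (theta νW νZ νM νY a' astar) p (D νZ νM νY a' astar p) := by
  intro P C _ hP hc hlim
  have h : ComparableSeq νW νZ νM νY C p P := ⟨hP, hc, hlim⟩
  obtain ⟨B, hBm, hBL, hB⟩ := exists_dominating hL h
  refine ⟨fun n => gradient νZ νM νY a' astar p (P n), B,
    fun n => measurable_gradient hL (hP n).1, hBm, hBL, fun n => hB.mono fun o ho => ho.1 n,
    hB.mono fun o ho => ho.2, fun n => ?_⟩
  obtain ⟨h1, h2, h3, h4⟩ := integral_gradient hL h n
  simp only [mul_sub]
  rw [integral_sub h1 h2, h3, h4, theta_eq hL]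

lemma memLp_D : MemLp (D νZ νM νY a' astar p) 2 (law (refMeasure νW νZ νM νY) p) := by
  obtain ⟨B, -, hBL, hB⟩ := exists_dominating hL (comparableSeq_const hL.mem)
  rw [gradient_self] at hB
  refine hBL.mono ?_ (hB.mono fun o ho => (ho.1 0).trans (le_abs_self _))
  rw [← gradient_self]
  exact (measurable_gradient hL hL.mem.1).aestronglyMeasurable

lemma integral_D : ∫ o, D νZ νM νY a' astar p o ∂law (refMeasure νW νZ νM νY) p =
    theta νW νZ νM νY a' astar p := by
  have h1 := (integral_gradient hL (comparableSeq_const hL.mem) 0).2.2.1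
  rwa [gradient_self, ← integral_law hL.mem.1 hL.mem.2.1] at h1

theorem isEfficientInfluenceFunction_theta_iff (φ : W × A × Z × M × ℝ → ℝ) :
    IsEfficientInfluenceFunction (refMeasure νW νZ νM νY)
        (nonparametricModel (refMeasure νW νZ νM νY)) (theta νW νZ νM νY a' astar) p φ ↔
      φ =ᵐ[law (refMeasure νW νZ νM νY) p]
        fun o => D νZ νM νY a' astar p o - theta νW νZ νM νY a' astar p := by
  have := isProbabilityMeasure_law hL.mem
  have hD := memLp_D hL
  have hDi : Integrable (D νZ νM νY a' astar p) (law (refMeasure νW νZ νM νY) p) :=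
    hD.integrable (by norm_num)
  refine isEfficientInfluenceFunction_iff hL.mem
    (ψ := fun o => D νZ νM νY a' astar p o - theta νW νZ νM νY a' astar p)
    (hD.sub (memLp_const _)) ?_ ?_ φ
  · rw [integral_sub hDi (integrable_const _), integral_D hL]
    simp
  · intro path s hs
    have h1 := (hasExactExpansion_theta hL).hasDerivAt hL.mem hs
    have hsi : Integrable s (law (refMeasure νW νZ νM νY) p) :=
      hs.score_memLp.integrable (by norm_num)
    have hDs : Integrable (fun o => D νZ νM νY a' astar p o * s o)
        (law (refMeasure νW νZ νM νY) p) := hD.integrable_mul hs.score_memLp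
    simp only [sub_mul]
    rwa [integral_sub hDs (hsi.const_mul _), integral_const_mul, hs.integral_score_eq_zero hL.mem,
      mul_zero, sub_zero]

end Conclusion

end Mediation

end MedEIF

theorem theorem1 {W A Z M : Type*} [MeasurableSpace W] [MeasurableSpace Z] [MeasurableSpace M]
    [Fintype A] [DecidableEq A] [MeasurableSpace A] [MeasurableSingletonClass A]
    (νW : Measure W) (νZ : Measure Z) (νM : Measure M) (νY : Measure ℝ)
    [SigmaFinite νW] [SigmaFinite νZ] [SigmaFinite νM] [SigmaFinite νY]
    (a' astar : A) (p : W × A × Z × M × ℝ → ℝ)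
    -- `p` is a density in the nonparametric model, under which the outcome is integrable
    (hp : p ∈ MedEIF.nonparametricModel (MedEIF.refMeasure νW νZ νM νY))
    (hY : Integrable (fun o : W × A × Z × M × ℝ => o.2.2.2.2)
      (MedEIF.law (MedEIF.refMeasure νW νZ νM νY) p))
    -- positivity of the treatment probabilities and of the mediator density
    (hg : ∀ᵐ w ∂νW, 0 < MedEIF.densW νZ νM νY p w →
      0 < MedEIF.g νZ νM νY p a' w ∧ 0 < MedEIF.g νZ νM νY p astar w)
    (hM : ∀ᵐ x ∂(νW.prod (νZ.prod νM)), 0 < MedEIF.targetDensity νZ νM νY a' astar p x →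
      0 < MedEIF.pMZ νM νY p x.2.2 a' x.2.1 x.1)
    -- finite weighted second moments
    (hDY : MemLp (MedEIF.DY νZ νM νY a' astar p) 2
      (MedEIF.law (MedEIF.refMeasure νW νZ νM νY) p))
    (hb : Integrable (fun x : W × Z × M =>
      (MedEIF.b νY p a' x.2.1 x.2.2 x.1) ^ 2 *
        (1 / MedEIF.g νZ νM νY p a' x.1 + 1 / MedEIF.g νZ νM νY p astar x.1) *
        MedEIF.targetDensity νZ νM νY a' astar p x) (νW.prod (νZ.prod νM))) :
    ∀ φ : W × A × Z × M × ℝ → ℝ,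
      MedEIF.IsEfficientInfluenceFunction (MedEIF.refMeasure νW νZ νM νY)
          (MedEIF.nonparametricModel (MedEIF.refMeasure νW νZ νM νY))
          (MedEIF.theta νW νZ νM νY a' astar) p φ ↔
        φ =ᵐ[MedEIF.law (MedEIF.refMeasure νW νZ νM νY) p]
          fun o => MedEIF.D νZ νM νY a' astar p o - MedEIF.theta νW νZ νM νY a' astar p := by
  exact MedEIF.isEfficientInfluenceFunction_theta_iff ⟨hp, hY, hg, hM, hDY, hb⟩
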